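/- Let $m\ge 1$, let $(\varepsilon_u)_{u\in\mathbb Z}$ be i.i.d. real random variables, let $f\colon\mathbb R^{\mathbb Z}\to\mathbb R$ be measurable and let $X_t=f((\varepsilon_{t-u})_{u\in\mathbb Z})$ for $t\in\mathbb Z$. Let $(\varepsilon'_u)_{u\in\mathbb Z}$ be an independent copy of $(\varepsilon_u)_{u\in\mathbb Z}$. For $i\in\mathbb Z$ and $k\ge1$ put $$\delta_i(X^k)=\big\|f\big((\varepsilon_{-u})_{u\in\mathbb Z}\big)^k-f\big((\varepsilon^{*,i}_{-u})_{u\in\mathbb Z}\big)^k\big\|_{2},\qquad \|Y\|_2=(E[Y^2])^{1/2},$$ where $\varepsilon^{*,i}_v=\varepsilon'_i$ if $v=i$ and $\varepsilon^{*,i}_v=\varepsilon_v$ otherwise. Let $h\colon\mathbb R^2\to\mathbb R$ be symmetric, let $g\colon\mathbb R^m\to\mathbb R$ be measurable, let $(b_n)_n$ and $(\ell_n)_n$ be sequences of natural numbers, and assume: 1. $h$ is Lipschitz-continuous. 2. $E[X_1^{2m}]<\infty$ and $\sum_{i\in\mathbb Z}\sum_{k=1}^m i^2\,\delta_i(X^k)<\infty$.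 3. With $v_0=(E[X_1^k])_{k=1}^m$, $g(v_0)=0$, and for some $a>0$ the function $g$ is differentiable at each point of the open cube $\prod_{k=1}^m(E[X_1^k]-2a,\,E[X_1^k]+2a)$, with gradient bounded on this cube. 4. $b_n\to\infty$, $\ell_n\to\infty$ and $b_n/\ell_n\to0$ as $n\to\infty$. Let $\eta\colon\mathbb R^m\to[0,1]$ be a smooth function with $\eta(x)=1$ if $\|x-v_0\|_2\le a$ and $\eta(x)=0$ if $\|x-v_0\|_2>2a$ (Euclidean norm). For $j\ge1$ let $B_{n,j}=\{(j-1)\ell_n+1,\dots,j\ell_n\}$ and $$W_{n,j}=\sqrt{\ell_n}\;g\Big(\Big(\tfrac1{\ell_n}\sum_{t\in B_{n,j}}X_t^k\Big)_{k=1}^m\Big),\qquad W^{(\eta)}_{n,j}=\sqrt{\ell_n}\,(g\cdot\eta)\Big(\Big(\tfrac1{\ell_n}\sum_{t\in B_{n,j}}X_t^k\Big)_{k=1}^m\Big),$$ $$U_n=\frac1{b_n(b_n-1)}\sum_{1\le j\ne k\le b_n}h(W_{n,j},W_{n,k}).$$ Then $h(W^{(\eta)}_{n,j},W^{(\eta)}_{n,k})$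 is integrable for all $n$ and $1\le j\ne k\le b_n$, and, with $Y_t=\sum_{k=1}^m\frac{\partial g}{\partial x_k}(v_0)X_t^k$, the series $\sigma^2:=\sum_{t\in\mathbb Z}\mathrm{Cov}(Y_0,Y_t)$ converges absolutely. If $\sigma^2>0$, then, with $\sigma=\sqrt{\sigma^2}$, $$\sqrt{b_n}\Big(U_n-\frac1{b_n(b_n-1)}\sum_{1\le j\ne k\le b_n}E\big[h(W^{(\eta)}_{n,j},W^{(\eta)}_{n,k})\big]\Big)\longrightarrow N(0,4\gamma^2)$$ in distribution as $n\to\infty$, where $\gamma^2=\mathrm{Cov}\big(h(\sigma N,\sigma N'),h(\sigma N',\sigma N'')\big)\ge0$ for independent standard normal random variables $N,N',N''$, and $N(0,0)$ is the point mass at $0$. -/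

import Mathlib

open MeasureTheory ProbabilityTheory Filter Topology
open scoped NNReal ENNReal

namespace BlockUStat

noncomputable section

/-- The two-sided Bernoulli shift `X_t = f((ε_{t-u})_{u ∈ ℤ})`. -/
def bernoulliShift {Ω : Type*} (f : (ℤ → ℝ) → ℝ) (ε : ℤ → Ω → ℝ) (t : ℤ) (ω : Ω) : ℝ :=
  f (fun u => ε (t - u) ω)

/-- The noise `ε^{*,i}`: the variable with index `i` is replaced by `ε'_i`, the others are kept. -/
def coupledNoise {Ω : Type*} (ε ε' : ℤ → Ω → ℝ) (i : ℤ) : ℤ → Ω → ℝ :=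
  Function.update ε i (ε' i)

/-- The physical dependence measure `δ_i = ‖X_0 - X_0^{*,i}‖_2` of the Bernoulli shift with
functional `f` and noise `ε`. The independent copy `ε'` of `ε` is realised on the product space
`Ω × Ω`, on which `ε` depends on the first coordinate only and `ε'` is the same process evaluated
at the second coordinate. -/
def physicalDependence {Ω : Type*} [MeasurableSpace Ω] (P : Measure Ω)
    (f : (ℤ → ℝ) → ℝ) (ε : ℤ → Ω → ℝ) (i : ℤ) : ℝ≥0∞ :=
  let e : ℤ → Ω × Ω → ℝ := fun u p => ε u p.1
  let e' : ℤ → Ω × Ω → ℝ := fun u p => ε u p.2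
  eLpNorm (fun p => bernoulliShift f e 0 p - bernoulliShift f (coupledNoise e e' i) 0 p) 2
    (P.prod P)

/-- The moment vector `v₀ = (E[X_1^k])_{k = 1, …, m}`; the coordinate `k : Fin m` carries the
moment of order `k + 1`. -/
def momentVector {Ω : Type*} [MeasurableSpace Ω] (P : Measure Ω) (X : ℤ → Ω → ℝ) (m : ℕ) :
    EuclideanSpace ℝ (Fin m) :=
  WithLp.toLp 2 (fun k => ∫ ω, X 1 ω ^ ((k : ℕ) + 1) ∂P)

/-- The open cube `∏_k (v_k - r, v_k + r)`. -/
def openCube {m : ℕ} (v : EuclideanSpace ℝ (Fin m)) (r : ℝ) : Set (EuclideanSpace ℝ (Fin m)) :=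
  {x | ∀ k, x k ∈ Set.Ioo (v k - r) (v k + r)}

/-- The `k`-th partial derivative of `g` at `v`. -/
def partialDeriv {m : ℕ} (g : EuclideanSpace ℝ (Fin m) → ℝ) (v : EuclideanSpace ℝ (Fin m))
    (k : Fin m) : ℝ :=
  fderiv ℝ g v (EuclideanSpace.single k 1)

/-- The block `{(j-1)ℓ + 1, …, jℓ}`. -/
def block (ℓ j : ℕ) : Finset ℤ :=
  Finset.Icc (((j : ℤ) - 1) * ℓ + 1) ((j : ℤ) * ℓ)

/-- The vector of the first `m` empirical moments of `X` over the `j`-th block of length `ℓ`. -/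
def blockMoments {Ω : Type*} (X : ℤ → Ω → ℝ) (m ℓ j : ℕ) (ω : Ω) :
    EuclideanSpace ℝ (Fin m) :=
  WithLp.toLp 2 (fun k => (1 / (ℓ : ℝ)) * ∑ t ∈ block ℓ j, X t ω ^ ((k : ℕ) + 1))

/-- The block statistic `√ℓ · g(empirical moments of the j-th block)`. -/
def blockStat {Ω : Type*} {m : ℕ} (g : EuclideanSpace ℝ (Fin m) → ℝ) (X : ℤ → Ω → ℝ)
    (ℓ j : ℕ) (ω : Ω) : ℝ :=
  Real.sqrt ℓ * g (blockMoments X m ℓ j ω)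

/-- The average `1 / (b (b - 1)) · ∑_{1 ≤ j ≠ k ≤ b} c j k`. -/
def offDiagAverage (b : ℕ) (c : ℕ → ℕ → ℝ) : ℝ :=
  (1 / ((b : ℝ) * ((b : ℝ) - 1))) * ∑ p ∈ (Finset.Icc 1 b).offDiag, c p.1 p.2

/-- The U-statistic with kernel `h` and entries `W 1, …, W b`. -/
def uStat {Ω : Type*} (h : ℝ × ℝ → ℝ) (b : ℕ) (W : ℕ → Ω → ℝ) (ω : Ω) : ℝ :=
  offDiagAverage b (fun j k => h (W j ω, W k ω))

/-- The centring term `1 / (b (b - 1)) · ∑_{1 ≤ j ≠ k ≤ b} E[h(W_j, W_k)]`. -/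
def uStatMean {Ω : Type*} [MeasurableSpace Ω] (P : Measure Ω) (h : ℝ × ℝ → ℝ) (b : ℕ)
    (W : ℕ → Ω → ℝ) : ℝ :=
  offDiagAverage b (fun j k => ∫ ω, h (W j ω, W k ω) ∂P)

/-- The linearised process `Y_t = ∑_{k=1}^m ∂g/∂x_k(v) · X_t^k`. -/
def linearised {Ω : Type*} {m : ℕ} (g : EuclideanSpace ℝ (Fin m) → ℝ)
    (v : EuclideanSpace ℝ (Fin m)) (X : ℤ → Ω → ℝ) (t : ℤ) (ω : Ω) : ℝ :=
  ∑ k : Fin m, partialDeriv g v k * X t ω ^ ((k : ℕ) + 1)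

/-- The long-run variance `∑_{t ∈ ℤ} Cov(Y_0, Y_t)`. -/
def longRunVariance {Ω : Type*} [MeasurableSpace Ω] (P : Measure Ω) (Y : ℤ → Ω → ℝ) : ℝ :=
  ∑' t : ℤ, cov[Y 0, Y t; P]

/-- `Cov(h(σN, σN'), h(σN', σN''))` for independent standard normal `N, N', N''`, realised as the
coordinates of the standard Gaussian measure on `ℝ³`. -/
def gaussianKernelCov (h : ℝ × ℝ → ℝ) (σ : ℝ) : ℝ :=
  cov[fun z : Fin 3 → ℝ => h (σ * z 0, σ * z 1), fun z : Fin 3 → ℝ => h (σ * z 1, σ * z 2);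
    Measure.pi (fun _ : Fin 3 => gaussianReal 0 1)]

end

end BlockUStat

open BlockUStat

/-! Each truncated block statistic is `√ℓ * G` of the block average of the centred powers, where `G
y = g (v₀ + y) * η (v₀ + y)`. The cut-off makes `G` globally Lipschitz
(`exists_abs_mul_cutoff_sub_le`), with `G 0 = 0` and the derivative of `g` at `v₀`. All `L²`
estimates concern this version. By Chebyshev's inequality and a union bound it agrees with the
original one on all blocks outside an event of probability `O(b / ℓ)`.

Dependence is handled by coupling. On a space with countably many copies of the noise, `select s a`
reads copy `s i` at time `i`, and selections that differ at every time are independent. The weight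
`i²` in the dependence condition implies that resampling noise at distance at least `c` costs
`O(c⁻²)` in `L²` (`SingleSiteBound.shortRange`). These costs are summable, so resampling all noise
outside a block changes the sum over the block by `O(1)`, whatever its length
(`ShortRange.eLpNorm_blockSum_sub_le`), and the block statistic by `O(1 / √ℓ)`. With separate
outside noise for each block the blocks become independent, while `√b` times the centred U-statistic
moves by `O(√(b / ℓ))`, because the kernel is Lipschitz.

For independent blocks, Hoeffding's decomposition leaves a linear part and a degenerate part. The
latter, scaled by `√b`, has second moment `O(1 / b)` by orthogonality. The linear part obeys the
row-wise central limit theorem `tendstoInDistribution_rows`, which needs uniformly integrable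
squares and convergent variances. The variance of the projection is an integral over three
independent variables with one shared argument. It converges to the Gaussian value because a single
block statistic converges in law to `N(0, σ²)` with uniformly integrable squares
(`tendsto_sharedIntegral`).

The single-block limit follows from cutting a sum of length `n` into about `n^(1/4)` pieces, coupled
as above, and then from the delta method (`tendstoInDistribution_blockValue`). Uniform integrability
is proved by truncation (`ShortRange.sqUnifIntegrable_normSum`): a bounded functional has fourth
moments of block sums of order `p²`, by a doubling recursion, and the remainder contributes little
variance. -/

namespace BlockUStat

/-! ### Square integrability and uniform integrability of squares -/

section SquareIntegrable

variable {α : Type*} [MeasurableSpace α] {μ : Measure α}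

lemma eLpNorm_two_le_ofReal_iff {f : α → ℝ} (hf : MemLp f 2 μ) {c : ℝ} (hc : 0 ≤ c) :
    eLpNorm f 2 μ ≤ ENNReal.ofReal c ↔ ∫ x, f x ^ 2 ∂μ ≤ c ^ 2 := by
  rw [hf.eLpNorm_eq_integral_rpow_norm (by simp) (by simp), ENNReal.ofReal_le_ofReal_iff hc]
  simp only [ENNReal.toReal_ofNat, Real.rpow_ofNat, Real.norm_eq_abs, sq_abs]
  rw [← one_div, ← Real.sqrt_eq_rpow, Real.sqrt_le_left hc]

lemma memLp_of_eLpNorm_le_ofReal {f : α → ℝ} {p : ℝ≥0∞} (hf : AEStronglyMeasurable f μ) {c : ℝ}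
    (h : eLpNorm f p μ ≤ ENNReal.ofReal c) : MemLp f p μ :=
  ⟨hf, h.trans_lt ENNReal.ofReal_lt_top⟩

lemma abs_integral_mul_le {f g : α → ℝ} (hf : AEStronglyMeasurable f μ)
    (hg : AEStronglyMeasurable g μ) {c d : ℝ} (hc : 0 ≤ c) (hd : 0 ≤ d)
    (hfc : eLpNorm f 2 μ ≤ ENNReal.ofReal c) (hgd : eLpNorm g 2 μ ≤ ENNReal.ofReal d) :
    |∫ x, f x * g x ∂μ| ≤ c * d := by
  have h1 : ENNReal.ofReal |∫ x, f x * g x ∂μ| ≤ ENNReal.ofReal (c * d) := by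
    rw [← Real.norm_eq_abs, ofReal_norm]
    calc ‖∫ x, f x * g x ∂μ‖ₑ ≤ ∫⁻ x, ‖f x * g x‖ₑ ∂μ := enorm_integral_le_lintegral_enorm _
      _ = eLpNorm (fun x => f x * g x) 1 μ := eLpNorm_one_eq_lintegral_enorm.symm
      _ ≤ eLpNorm f 2 μ * eLpNorm g 2 μ := by
        have := eLpNorm_smul_le_mul_eLpNorm (p := 2) (q := 2) (r := 1) hg hf
        exact this
      _ ≤ _ := by rw [ENNReal.ofReal_mul hc]; gcongr
  exact (ENNReal.ofReal_le_ofReal_iff (by positivity)).1 h1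

lemma integral_abs_le [IsProbabilityMeasure μ] {f : α → ℝ} (hf : AEStronglyMeasurable f μ)
    {c : ℝ} (hc : 0 ≤ c) (hfc : eLpNorm f 2 μ ≤ ENNReal.ofReal c) : ∫ x, |f x| ∂μ ≤ c := by
  have h1 : eLpNorm (fun x => |f x|) 2 μ ≤ ENNReal.ofReal c := by
    simpa [← Real.norm_eq_abs, eLpNorm_norm] using hfc
  have h2 := abs_integral_mul_le (g := fun _ => 1) (f := fun x => |f x|)
    (by simpa [← Real.norm_eq_abs] using hf.norm) (by fun_prop) hc zero_le_one h1 (by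
      rw [eLpNorm_const _ (by simp) (NeZero.ne μ)]; simp)
  simpa using (le_abs_self _).trans h2

/-- The part of `|x|` that exceeds the level `c`. -/
noncomputable def excess (c x : ℝ) : ℝ := max (|x| - c) 0

lemma excess_nonneg (c x : ℝ) : 0 ≤ excess c x := le_max_right _ _

@[fun_prop]
lemma measurable_excess (c : ℝ) : Measurable (excess c) := by unfold excess; fun_prop

lemma excess_le_abs {c : ℝ} (hc : 0 ≤ c) (x : ℝ) : excess c x ≤ |x| :=
  max_le (by linarith) (abs_nonneg x)

/-- Joint subadditivity in level and argument is the advantage of `excess` over an indicator of `|x|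
> c`: sums are handled without splitting events. -/
lemma excess_add_le (c d x y : ℝ) : excess (c + d) (x + y) ≤ excess c x + excess d y := by
  refine max_le ?_ (add_nonneg (excess_nonneg _ _) (excess_nonneg _ _))
  have := abs_add_le x y
  have h1 : |x| - c ≤ excess c x := le_max_left _ _
  have h2 : |y| - d ≤ excess d y := le_max_left _ _
  linarith

lemma excess_le_excess {c x y : ℝ} (h : |x| ≤ |y|) : excess c x ≤ excess c y :=
  max_le_max (by linarith) le_rfl

lemma excess_mul {c k : ℝ} (hk : 0 ≤ k) (x : ℝ) : excess (k * c) (k * x) = k * excess c x := by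
  unfold excess
  rw [mul_max_of_nonneg _ _ hk, abs_mul, abs_of_nonneg hk]; ring_nf

lemma excess_anti {c d : ℝ} (h : c ≤ d) (x : ℝ) : excess d x ≤ excess c x :=
  max_le_max (by linarith) le_rfl

lemma excess_le_sq_div {c : ℝ} (hc : 0 < c) (x : ℝ) : excess c x ≤ x ^ 2 / c := by
  refine max_le ?_ (by positivity)
  rw [le_div_iff₀ hc, ← sq_abs x]
  nlinarith [sq_nonneg (|x| - c), sq_nonneg c, abs_nonneg x]

/-- The squares of the random variables are uniformly integrable. -/
def SqUnifIntegrable {ι : Type*} (Z : ι → α → ℝ) (μ : Measure α) : Prop :=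
  ∀ ε : ℝ, 0 < ε → ∃ c : ℝ, 0 ≤ c ∧
    ∀ i, eLpNorm (fun x => excess c (Z i x)) 2 μ ≤ ENNReal.ofReal ε

namespace SqUnifIntegrable

variable {ι : Type*} {Z Y : ι → α → ℝ}

lemma mono (hZ : SqUnifIntegrable Z μ) (h : ∀ i x, |Y i x| ≤ |Z i x|) :
    SqUnifIntegrable Y μ := by
  intro ε hε
  obtain ⟨c, hc, H⟩ := hZ ε hε
  refine ⟨c, hc, fun i => (eLpNorm_mono fun x => ?_).trans (H i)⟩
  rw [Real.norm_of_nonneg (excess_nonneg _ _), Real.norm_of_nonneg (excess_nonneg _ _)]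
  exact excess_le_excess (h i x)

lemma add (hZ : SqUnifIntegrable Z μ) (hY : SqUnifIntegrable Y μ)
    (hZm : ∀ i, AEStronglyMeasurable (Z i) μ) (hYm : ∀ i, AEStronglyMeasurable (Y i) μ) :
    SqUnifIntegrable (fun i x => Z i x + Y i x) μ := by
  intro ε hε
  obtain ⟨c, hc, H⟩ := hZ (ε / 2) (by positivity)
  obtain ⟨d, hd, H'⟩ := hY (ε / 2) (by positivity)
  refine ⟨c + d, by positivity, fun i => ?_⟩
  calc eLpNorm (fun x => excess (c + d) (Z i x + Y i x)) 2 μ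
      ≤ eLpNorm ((fun x => excess c (Z i x)) + fun x => excess d (Y i x)) 2 μ := by
        refine eLpNorm_mono_real fun x => ?_
        rw [Real.norm_of_nonneg (excess_nonneg _ _)]
        exact excess_add_le _ _ _ _
    _ ≤ ENNReal.ofReal (ε / 2) + ENNReal.ofReal (ε / 2) := by
        refine (eLpNorm_add_le ?_ ?_ (by norm_num)).trans (add_le_add (H i) (H' i))
        · exact ((measurable_excess c).comp_aemeasurable (hZm i).aemeasurable).aestronglyMeasurable
        · exact ((measurable_excess d).comp_aemeasurable (hYm i).aemeasurable).aestronglyMeasurable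
    _ = ENNReal.ofReal ε := by rw [← ENNReal.ofReal_add] <;> [ring_nf; positivity; positivity]

lemma const_mul (hZ : SqUnifIntegrable Z μ) (k : ℝ) :
    SqUnifIntegrable (fun i x => k * Z i x) μ := by
  -- Enlarging the factor to `|k| + 1` makes it positive, so that `k = 0` needs no separate
  -- treatment.
  suffices H : SqUnifIntegrable (fun i x => (|k| + 1) * Z i x) μ by
    refine H.mono fun i x => ?_
    rw [abs_mul, abs_mul, abs_of_nonneg (by positivity : 0 ≤ |k| + 1)]
    gcongr; linarith
  have hk : 0 < |k| + 1 := by positivity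
  generalize |k| + 1 = k at hk
  intro ε hε
  obtain ⟨c, hc, H⟩ := hZ (ε / k) (by positivity)
  refine ⟨k * c, by positivity, fun i => ?_⟩
  simp_rw [excess_mul hk.le]
  have := eLpNorm_const_smul_le (c := k) (f := fun x => excess c (Z i x)) (p := 2) (μ := μ)
  calc _ ≤ _ := this
    _ ≤ ENNReal.ofReal k * ENNReal.ofReal (ε / k) := by
      rw [← ofReal_norm, Real.norm_of_nonneg hk.le]; gcongr; exact H i
    _ = _ := by rw [← ENNReal.ofReal_mul hk.le]; field_simp

lemma sum {κ : Type*} (s : Finset κ) {Z : κ → ι → α → ℝ} (hZ : ∀ k ∈ s, SqUnifIntegrable (Z k) μ)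
    (hm : ∀ k ∈ s, ∀ i, AEStronglyMeasurable (Z k i) μ) :
    SqUnifIntegrable (fun i x => ∑ k ∈ s, Z k i x) μ := by
  classical
  induction s using Finset.induction_on with
  | empty =>
    intro ε hε
    exact ⟨0, le_rfl, fun i => by simp [excess]⟩
  | insert a s ha ih =>
    simp_rw [Finset.sum_insert ha]
    refine (hZ a (by simp)).add (ih (fun k hk => hZ k (by simp [hk]))
      (fun k hk => hm k (by simp [hk]))) (hm a (by simp)) fun i => ?_
    exact Finset.aestronglyMeasurable_fun_sum _ fun k hk => hm k (by simp [hk]) i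

lemma const [IsFiniteMeasure μ] {w : ι → ℝ} {C : ℝ} (hw : ∀ i, |w i| ≤ C) :
    SqUnifIntegrable (fun i (_ : α) => w i) μ := by
  intro ε hε
  refine ⟨max C 0, le_max_right _ _, fun i => ?_⟩
  have : excess (max C 0) (w i) = 0 := max_eq_right (by linarith [hw i, le_max_left C 0])
  simp [this]

/-- Criterion: approximation in `L²` by random variables with bounded fourth moments. -/
lemma of_approx (hZm : ∀ i, AEStronglyMeasurable (Z i) μ)
    (H : ∀ ε : ℝ, 0 < ε → ∃ (C : ℝ) (A : ι → α → ℝ),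
      (∀ i, AEStronglyMeasurable (A i) μ) ∧ (∀ i, Integrable (fun x => A i x ^ 4) μ) ∧
      (∀ i, ∫ x, A i x ^ 4 ∂μ ≤ C) ∧
      ∀ i, eLpNorm (fun x => Z i x - A i x) 2 μ ≤ ENNReal.ofReal ε) :
    SqUnifIntegrable Z μ := by
  intro ε hε
  obtain ⟨C, A, hAm, hAi, hAC, hZA⟩ := H (ε / 2) (by positivity)
  -- The `L²` norm of `A² / c` is at most `√C / c`, so this level makes it at most `ε / 2`; the
  -- summand `1` keeps `c` positive when `C ≤ 0`.
  set c : ℝ := √(max C 0) / (ε / 2) + 1 with hc_def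
  have hc : 0 < c := by positivity
  refine ⟨c, hc.le, fun i => ?_⟩
  have hsq : MemLp (fun x => A i x ^ 2 / c) 2 μ := by
    rw [memLp_two_iff_integrable_sq (by have := hAm i; fun_prop)]
    refine ((hAi i).div_const (c ^ 2)).congr (ae_of_all _ fun x => ?_)
    simp only [div_pow]; ring
  calc eLpNorm (fun x => excess c (Z i x)) 2 μ
      ≤ eLpNorm ((fun x => A i x ^ 2 / c) + fun x => |Z i x - A i x|) 2 μ := by
        refine eLpNorm_mono_real fun x => ?_
        rw [Real.norm_of_nonneg (excess_nonneg _ _)]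
        have h1 := excess_add_le c 0 (A i x) (Z i x - A i x)
        simp only [add_zero, add_sub_cancel] at h1
        exact h1.trans (add_le_add (excess_le_sq_div hc _) (excess_le_abs le_rfl _))
    _ ≤ ENNReal.ofReal (ε / 2) + ENNReal.ofReal (ε / 2) := by
        refine (eLpNorm_add_le hsq.1 ?_ (by norm_num)).trans (add_le_add ?_ ?_)
        · simpa [Real.norm_eq_abs] using ((hZm i).sub (hAm i)).norm
        · rw [eLpNorm_two_le_ofReal_iff hsq (by positivity)]
          have : ∀ x, (A i x ^ 2 / c) ^ 2 = A i x ^ 4 / c ^ 2 := fun x => by rw [div_pow]; ring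
          simp_rw [this]
          rw [integral_div, div_le_iff₀ (by positivity)]
          have h2 : √(max C 0) ≤ (ε / 2) * c := by
            rw [hc_def, mul_add, mul_div_cancel₀ _ (by positivity)]; linarith
          calc _ ≤ max C 0 := (hAC i).trans (le_max_left _ _)
            _ = √(max C 0) ^ 2 := (Real.sq_sqrt (le_max_right _ _)).symm
            _ ≤ ((ε / 2) * c) ^ 2 := by gcongr
            _ = _ := by ring
        · simpa [← Real.norm_eq_abs, eLpNorm_norm] using hZA i
    _ = ENNReal.ofReal ε := by rw [← ENNReal.ofReal_add] <;> [ring_nf; positivity; positivity]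

/-- A uniform bound for the second moments. -/
lemma exists_bound [IsProbabilityMeasure μ] (hZ : SqUnifIntegrable Z μ)
    (hZm : ∀ i, AEStronglyMeasurable (Z i) μ) :
    ∃ C : ℝ, 0 ≤ C ∧ ∀ i, eLpNorm (Z i) 2 μ ≤ ENNReal.ofReal C := by
  obtain ⟨c, hc, H⟩ := hZ 1 one_pos
  refine ⟨1 + c, by positivity, fun i => ?_⟩
  calc eLpNorm (Z i) 2 μ ≤ eLpNorm ((fun x => excess c (Z i x)) + fun _ => c) 2 μ := by
        refine eLpNorm_mono_real fun x => ?_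
        have : |Z i x| - c ≤ excess c (Z i x) := le_max_left _ _
        simp only [Pi.add_apply, Real.norm_eq_abs]; linarith
    _ ≤ ENNReal.ofReal 1 + ENNReal.ofReal c := by
        refine (eLpNorm_add_le ?_ (by fun_prop) (by norm_num)).trans (add_le_add (H i) ?_)
        · exact ((measurable_excess c).comp_aemeasurable (hZm i).aemeasurable).aestronglyMeasurable
        · rw [eLpNorm_const _ (by simp) (NeZero.ne μ), ← ofReal_norm, Real.norm_of_nonneg hc]
          simp
    _ = _ := by rw [ENNReal.ofReal_add zero_le_one hc]

lemma comp {β : Type*} [MeasurableSpace β] {ν : Measure β} {κ : Type*} (hZ : SqUnifIntegrable Z μ)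
    {σ : κ → ι} {Y : κ → β → ℝ} (h : ∀ k, IdentDistrib (Y k) (Z (σ k)) ν μ) : SqUnifIntegrable Y ν := by
  intro ε hε
  obtain ⟨c, hc, H⟩ := hZ ε hε
  refine ⟨c, hc, fun k => ?_⟩
  have := ((h k).comp (measurable_excess c)).eLpNorm_eq 2
  exact this.le.trans (H _)

end SqUnifIntegrable

end SquareIntegrable

/-! ### Central limit theorem for rows of i.i.d. variables -/

section RowCLT

lemma norm_exp_mul_I_sub_taylor_le (y : ℝ) :
    ‖Complex.exp (y * Complex.I) - (1 + y * Complex.I - y ^ 2 / 2)‖ ≤ 3 * y ^ 2 * min |y| 1 := by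
  have hn : ‖(y : ℂ) * Complex.I‖ = |y| := by simp
  rcases le_total |y| 1 with h | h
  · rw [min_eq_left h]
    have h1 := Complex.exp_bound (x := y * Complex.I) (by rw [hn]; exact h) (n := 3) (by norm_num)
    rw [hn] at h1
    have h2 : ∑ m ∈ Finset.range 3, ((y : ℂ) * Complex.I) ^ m / (m.factorial : ℂ)
        = 1 + y * Complex.I - y ^ 2 / 2 := by
      simp [Finset.sum_range_succ, mul_pow]; ring
    rw [h2] at h1
    refine h1.trans ?_
    have h3 : |y| ^ 3 = y ^ 2 * |y| := by rw [← sq_abs]; ring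
    rw [h3]
    norm_num [Nat.factorial]
    nlinarith [mul_nonneg (sq_nonneg y) (abs_nonneg y)]
  · rw [min_eq_right h]
    have h1 : ‖Complex.exp (y * Complex.I) - 1‖ ≤ |y| := by
      rw [mul_comm]; exact Real.norm_exp_I_mul_ofReal_sub_one_le
    have h2 : ‖(y : ℂ) ^ 2 / 2‖ = y ^ 2 / 2 := by simp
    have h3 : |y| ≤ y ^ 2 := by rw [← sq_abs]; nlinarith
    calc _ = ‖(Complex.exp (y * Complex.I) - 1) - y * Complex.I + (y : ℂ) ^ 2 / 2‖ := by ring_nf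
      _ ≤ |y| + |y| + y ^ 2 / 2 := by
        refine (norm_add_le _ _).trans (add_le_add ((norm_sub_le _ _).trans ?_) h2.le)
        exact add_le_add h1 hn.le
      _ ≤ _ := by nlinarith

/-- Lindeberg's split at `|x| = 2c`: below it the cubic bound applies, above it `|x| ≤ 2 * excess c
x`. -/
lemma norm_exp_mul_I_sub_taylor_le_excess {c : ℝ} (hc : 0 ≤ c) (t x : ℝ) :
    ‖Complex.exp (t * x * Complex.I) - (1 + t * x * Complex.I - t ^ 2 * x ^ 2 / 2)‖
      ≤ t ^ 2 * (6 * c * |t| * x ^ 2 + 12 * excess c x ^ 2) := by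
  have h := norm_exp_mul_I_sub_taylor_le (t * x)
  push_cast at h
  rw [mul_pow] at h
  refine h.trans ?_
  rcases le_total |x| (2 * c) with hx | hx
  · calc 3 * (t * x) ^ 2 * min |t * x| 1 ≤ 3 * (t * x) ^ 2 * (|t| * (2 * c)) := by
          gcongr
          exact (min_le_left _ _).trans (by rw [abs_mul]; gcongr)
      _ = t ^ 2 * (6 * c * |t| * x ^ 2) := by ring
      _ ≤ _ := by gcongr; linarith [sq_nonneg (excess c x)]
  · have h1 : |x| ≤ 2 * excess c x := by
      have : |x| - c ≤ excess c x := le_max_left _ _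
      linarith
    have h2 : x ^ 2 ≤ 4 * excess c x ^ 2 := by
      rw [← sq_abs]; nlinarith [abs_nonneg x]
    calc 3 * (t * x) ^ 2 * min |t * x| 1 ≤ 3 * (t * x) ^ 2 * 1 := by
          gcongr; exact min_le_right _ _
      _ = t ^ 2 * (3 * x ^ 2) := by ring
      _ ≤ _ := by
        gcongr
        have : 0 ≤ 6 * c * |t| * x ^ 2 := by positivity
        linarith

variable {Ω Ω' : Type*} [MeasurableSpace Ω] [MeasurableSpace Ω'] {Q : Measure Ω} {ν : Measure Ω'}
  [IsProbabilityMeasure Q] [IsProbabilityMeasure ν]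

lemma norm_charFun_sub_taylor_le {X : Ω' → ℝ} (hX : MemLp X 2 ν) (h0 : ∫ x, X x ∂ν = 0)
    {c : ℝ} (hc : 0 ≤ c) (t : ℝ) :
    ‖charFun (ν.map X) t - ((1 - t ^ 2 * (∫ x, X x ^ 2 ∂ν) / 2 : ℝ) : ℂ)‖ ≤
      t ^ 2 * (6 * c * |t| * (∫ x, X x ^ 2 ∂ν) + 12 * ∫ x, excess c (X x) ^ 2 ∂ν) := by
  have hXm := hX.1.aemeasurable
  have hi : Integrable X ν := hX.integrable (by norm_num)
  have hi2 : Integrable (fun x => X x ^ 2) ν := hX.integrable_sq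
  have hiC : Integrable (fun x => (X x : ℂ)) ν := hi.ofReal
  have hi2C : Integrable (fun x => (X x : ℂ) ^ 2) ν := by simpa using hi2.ofReal (𝕜 := ℂ)
  have hie : Integrable (fun x => excess c (X x) ^ 2) ν := by
    refine hi2.mono' (((measurable_excess c).comp_aemeasurable hXm).pow_const 2).aestronglyMeasurable
      (ae_of_all _ fun x => ?_)
    rw [Real.norm_of_nonneg (sq_nonneg _), ← sq_abs (X x)]
    exact pow_le_pow_left₀ (excess_nonneg _ _) (excess_le_abs hc _) 2
  have hexp : Integrable (fun x => Complex.exp (t * X x * Complex.I)) ν := by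
    refine (integrable_const (1 : ℝ)).mono' (by fun_prop) (ae_of_all _ fun x => ?_)
    rw [← Complex.ofReal_mul, Complex.norm_exp_ofReal_mul_I]
  have hcf : charFun (ν.map X) t = ∫ x, Complex.exp (t * X x * Complex.I) ∂ν := by
    rw [charFun_apply_real, integral_map hXm (by fun_prop)]
  have hT : (((1 - t ^ 2 * (∫ x, X x ^ 2 ∂ν) / 2 : ℝ)) : ℂ) =
      ∫ x, (1 + t * X x * Complex.I - t ^ 2 * X x ^ 2 / 2 : ℂ) ∂ν := by
    have e1 : ∫ x, (X x : ℂ) ∂ν = 0 := by rw [integral_complex_ofReal, h0]; simp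
    have e2 : ∫ x, (X x : ℂ) ^ 2 ∂ν = ((∫ x, X x ^ 2 ∂ν : ℝ) : ℂ) := by
      rw [← integral_complex_ofReal]; simp
    rw [integral_sub, integral_add, integral_div, integral_const_mul, integral_mul_const,
      integral_const_mul, e1, e2]
    · simp
    · exact integrable_const _
    · exact (hiC.const_mul _).mul_const _
    · exact (integrable_const _).add ((hiC.const_mul _).mul_const _)
    · exact (hi2C.const_mul _).div_const _
  have hTi : Integrable (fun x => (1 + t * X x * Complex.I - t ^ 2 * X x ^ 2 / 2 : ℂ)) ν :=
    ((integrable_const _).add ((hiC.const_mul _).mul_const _)).sub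
      ((hi2C.const_mul _).div_const _)
  rw [hcf, hT, ← integral_sub hexp hTi]
  have hR : ∫ x, t ^ 2 * (6 * c * |t| * X x ^ 2 + 12 * excess c (X x) ^ 2) ∂ν =
      t ^ 2 * (6 * c * |t| * (∫ x, X x ^ 2 ∂ν) + 12 * ∫ x, excess c (X x) ^ 2 ∂ν) := by
    rw [integral_const_mul, integral_add (hi2.const_mul _) (hie.const_mul _), integral_const_mul,
      integral_const_mul]
  rw [← hR]
  refine norm_integral_le_of_norm_le ?_ (ae_of_all _ fun x => ?_)
  · exact ((hi2.const_mul _).add (hie.const_mul _)).const_mul _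
  · exact norm_exp_mul_I_sub_taylor_le_excess hc t (X x)

lemma norm_pow_sub_pow_le {a b : ℂ} (ha : ‖a‖ ≤ 1) (hb : ‖b‖ ≤ 1) (n : ℕ) :
    ‖a ^ n - b ^ n‖ ≤ n * ‖a - b‖ := by
  induction n with
  | zero => simp
  | succ n ih =>
    calc ‖a ^ (n + 1) - b ^ (n + 1)‖ = ‖a ^ n * (a - b) + (a ^ n - b ^ n) * b‖ := by ring_nf
      _ ≤ ‖a‖ ^ n * ‖a - b‖ + ‖a ^ n - b ^ n‖ * ‖b‖ := by
        refine (norm_add_le _ _).trans ?_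
        rw [norm_mul, norm_mul, norm_pow]
      _ ≤ 1 * ‖a - b‖ + (n * ‖a - b‖) * 1 := by
        gcongr
        exact pow_le_one₀ (norm_nonneg _) ha
      _ = _ := by push_cast; ring

/-- Central limit theorem for triangular arrays with independent, identically distributed rows. -/
theorem tendstoInDistribution_rows {J : ℕ → Finset ℕ}
    (hJ : Tendsto (fun n => (J n).card) atTop atTop) {Z : ℕ → Ω' → ℝ} (hZ : ∀ n, MemLp (Z n) 2 ν)
    (hZ0 : ∀ n, ∫ x, Z n x ∂ν = 0) (hUI : SqUnifIntegrable Z ν) {v : ℝ≥0}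
    (hv : Tendsto (fun n => ∫ x, Z n x ^ 2 ∂ν) atTop (𝓝 v)) {ξ : ℕ → ℕ → Ω → ℝ}
    (hind : ∀ n, iIndepFun (ξ n) Q) (hid : ∀ n j, IdentDistrib (ξ n j) (Z n) Q ν) :
    TendstoInDistribution (fun n ω => (√((J n).card : ℝ))⁻¹ * ∑ j ∈ J n, ξ n j ω) atTop
      (id : ℝ → ℝ) (fun _ => Q) (gaussianReal 0 v) where
  forall_aemeasurable n :=
    .const_mul (Finset.aemeasurable_fun_sum _ fun j _ ↦ (hid n j).aemeasurable_fst) _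
  tendsto := by
    refine ProbabilityMeasure.tendsto_iff_tendsto_charFun.2 fun t ↦ ?_
    have hcf : ∀ n, charFun (Q.map (fun ω => (√((J n).card : ℝ))⁻¹ * ∑ j ∈ J n, ξ n j ω)) t =
        charFun (ν.map (Z n)) ((√((J n).card : ℝ))⁻¹ * t) ^ (J n).card := by
      intro n
      rw [charFun_map_mul_comp, ((hind n).restrict _).charFun_map_fun_finsetSum_eq_prod
        (fun j _ ↦ (hid n j).aemeasurable_fst)]
      · simp [fun j ↦ (hid n j).map_eq]
      · exact Finset.aemeasurable_fun_sum _ fun j _ ↦ (hid n j).aemeasurable_fst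
    simp only [ProbabilityMeasure.coe_mk, hcf, Measure.map_id, charFun_gaussianReal]
    set q : ℕ → ℕ := fun n => (J n).card with hq
    set V : ℕ → ℝ := fun n => ∫ x, Z n x ^ 2 ∂ν with hV
    have hqR : Tendsto (fun n => (q n : ℝ)) atTop atTop := tendsto_natCast_atTop_atTop.comp hJ
    -- The Gaussian characteristic function is `exp (-w n) ^ q n`, so comparing `q n`-th powers
    -- costs `q n` times the difference of the bases.
    set w : ℕ → ℝ := fun n => v * t ^ 2 / 2 / q n with hw
    have hwlim : Tendsto w atTop (𝓝 0) := hqR.const_div_atTop _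
    rw [tendsto_iff_norm_sub_tendsto_zero]
    have hbound : ∀ ε > 0, ∃ c : ℝ, 0 ≤ c ∧ ∀ᶠ n in atTop,
        ‖charFun (ν.map (Z n)) ((√(q n : ℝ))⁻¹ * t) ^ (q n) -
          Complex.exp (t * (0 : ℝ) * Complex.I - v * t ^ 2 / 2)‖ ≤ 12 * t ^ 2 * ε ^ 2 +
          (t ^ 2 * (6 * c * |(√(q n : ℝ))⁻¹ * t| * V n) + t ^ 2 * |V n - v| / 2 +
            v * t ^ 2 / 2 * w n) := by
      intro ε hε
      obtain ⟨c, hc, hcε⟩ := hUI ε hε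
      refine ⟨c, hc, ?_⟩
      filter_upwards [hJ.eventually_ge_atTop 1, hwlim.eventually_le_const one_pos] with n hn hwn
      have hqn : (0 : ℝ) < q n := by exact_mod_cast hn
      have hw0 : 0 ≤ w n := by positivity
      have : IsProbabilityMeasure (ν.map (Z n)) :=
        Measure.isProbabilityMeasure_map (hZ n).1.aemeasurable
      have hexp : Complex.exp (t * (0 : ℝ) * Complex.I - v * t ^ 2 / 2)
          = ((Real.exp (-w n) : ℝ) : ℂ) ^ q n := by
        rw [← Complex.ofReal_pow (Real.exp (-w n)), ← Real.exp_nat_mul, Complex.ofReal_exp]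
        congr 1
        have : (q n : ℝ) * -w n = - (v * t ^ 2 / 2) := by simp only [hw]; field_simp
        rw [this]; push_cast; ring
      rw [hexp]
      have hb1 : ‖((Real.exp (-w n) : ℝ) : ℂ)‖ ≤ 1 := by
        rw [Complex.norm_real, Real.norm_of_nonneg (Real.exp_nonneg _), Real.exp_le_one_iff]
        linarith
      refine (norm_pow_sub_pow_le (norm_charFun_le_one _) hb1 (q n)).trans ?_
      set s : ℝ := (√(q n : ℝ))⁻¹ * t with hs
      have hs2 : q n * s ^ 2 = t ^ 2 := by
        rw [hs, mul_pow, inv_pow, Real.sq_sqrt hqn.le]; field_simp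
      have h1 := norm_charFun_sub_taylor_le (hZ n) (hZ0 n) hc s
      have hme : MemLp (fun x => excess c (Z n x)) 2 ν :=
        memLp_of_eLpNorm_le_ofReal ((measurable_excess c).comp_aemeasurable
          (hZ n).1.aemeasurable).aestronglyMeasurable (hcε n)
      have h2 := (eLpNorm_two_le_ofReal_iff hme hε.le).1 (hcε n)
      have h3 : |Real.exp (-w n) - 1 - (-w n)| ≤ (-w n) ^ 2 :=
        Real.abs_exp_sub_one_sub_id_le (by rw [abs_neg, abs_of_nonneg hw0]; exact hwn)
      have h4 : ‖(((1 - s ^ 2 * V n / 2 : ℝ)) : ℂ) - ((Real.exp (-w n) : ℝ) : ℂ)‖ ≤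
          s ^ 2 * |V n - v| / 2 + w n ^ 2 := by
        rw [← Complex.ofReal_sub, Complex.norm_real, Real.norm_eq_abs]
        have hws : w n = s ^ 2 * v / 2 := by simp only [hw]; rw [← hs2]; field_simp
        have : (1 - s ^ 2 * V n / 2) - Real.exp (-w n) =
            -(s ^ 2 * (V n - v) / 2) - (Real.exp (-w n) - 1 - (-w n)) := by rw [hws]; ring
        rw [this]
        refine (abs_sub _ _).trans (add_le_add ?_ (by simpa using h3))
        rw [abs_neg, abs_div, abs_mul, abs_of_nonneg (sq_nonneg s), abs_two]
      calc (q n : ℝ) * ‖charFun (ν.map (Z n)) s - ((Real.exp (-w n) : ℝ) : ℂ)‖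
          ≤ q n * (s ^ 2 * (6 * c * |s| * V n + 12 * ε ^ 2) +
              (s ^ 2 * |V n - v| / 2 + w n ^ 2)) := by
            refine mul_le_mul_of_nonneg_left ?_ hqn.le
            refine (norm_sub_le_norm_sub_add_norm_sub _ _ _).trans (add_le_add (h1.trans ?_) h4)
            gcongr
        _ = (q n * s ^ 2) * (6 * c * |s| * V n + 12 * ε ^ 2) + (q n * s ^ 2) * |V n - v| / 2 +
              (q n * w n) * w n := by ring
        _ = _ := by
            have : q n * w n = v * t ^ 2 / 2 := by simp only [hw]; field_simp
            rw [hs2, this]; ring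
    rw [Metric.tendsto_nhds]
    intro δ hδ
    -- With this `ε` the term `12 t² ε²` is at most `δ / 2`. The level `c` is then fixed, and all
    -- other terms vanish as `n` grows.
    obtain ⟨c, hc, H⟩ := hbound (√(δ / (24 * (t ^ 2 + 1)))) (by positivity)
    have hsq : Tendsto (fun n => |(√(q n : ℝ))⁻¹ * t|) atTop (𝓝 0) := by
      have : Tendsto (fun n => (√(q n : ℝ))⁻¹ * t) atTop (𝓝 (0 * t)) :=
        (tendsto_inv_atTop_zero.comp (Real.tendsto_sqrt_atTop.comp hqR)).mul_const t
      simpa using this.abs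
    have hrest : Tendsto (fun n => t ^ 2 * (6 * c * |(√(q n : ℝ))⁻¹ * t| * V n) +
        t ^ 2 * |V n - v| / 2 + v * t ^ 2 / 2 * w n) atTop (𝓝 0) := by
      have e1 := ((hsq.const_mul (6 * c)).mul hv).const_mul (t ^ 2)
      have e2 := (((hv.sub_const (v : ℝ)).abs).const_mul (t ^ 2)).div_const 2
      have e3 := hwlim.const_mul (v * t ^ 2 / 2)
      simpa using (e1.add e2).add e3
    filter_upwards [H, hrest.eventually_lt_const (half_pos hδ)] with n h1 h2
    rw [dist_zero_right, norm_norm]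
    refine h1.trans_lt ?_
    have : 12 * t ^ 2 * √(δ / (24 * (t ^ 2 + 1))) ^ 2 ≤ δ / 2 := by
      rw [Real.sq_sqrt (by positivity), mul_div_assoc', div_le_div_iff₀ (by positivity) two_pos]
      nlinarith
    linarith

end RowCLT

/-! ### Coupling through many copies of the noise -/

section Coupling

/-- The law of a two-sided sequence of independent random variables with law `μ`. -/
noncomputable abbrev noiseLaw (μ : Measure ℝ) : Measure (ℤ → ℝ) := Measure.infinitePi fun _ => μ

/-- The law of a sequence of independent copies of the two-sided noise. -/
noncomputable abbrev copiesLaw (μ : Measure ℝ) : Measure (ℕ × ℤ → ℝ) :=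
  Measure.infinitePi fun _ => μ

/-- The noise that uses the copy number `s i` at time `i`, seen from time `a`. -/
def select (s : ℤ → ℕ) (a : ℤ) (ω : ℕ × ℤ → ℝ) : ℤ → ℝ := fun v => ω (s (a + v), a + v)

/-- The noise seen from time `a`. -/
def shift (a : ℤ) (x : ℤ → ℝ) : ℤ → ℝ := fun v => x (a + v)

@[fun_prop]
lemma measurable_select (s : ℤ → ℕ) (a : ℤ) : Measurable (select s a) := by
  unfold select; fun_prop

@[fun_prop]
lemma measurable_shift (a : ℤ) : Measurable (shift a) := by
  unfold shift; fun_prop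

lemma shift_select (s : ℤ → ℕ) (a t : ℤ) (ω : ℕ × ℤ → ℝ) :
    shift t (select s a ω) = select s (a + t) ω := by
  ext v; simp [shift, select, add_assoc]

variable {μ : Measure ℝ} [IsProbabilityMeasure μ]

lemma measurePreserving_select (s : ℤ → ℕ) (a : ℤ) :
    MeasurePreserving (select s a) (copiesLaw μ) (noiseLaw μ) := by
  refine ⟨by fun_prop, ?_⟩
  have hinj : Function.Injective (fun v : ℤ => (s (a + v), a + v)) := by
    intro v w h
    have := (Prod.ext_iff.1 h).2
    simpa using this
  exact Measure.map_infinitePi_infinitePi_of_inj (P := fun _ : ℕ × ℤ => μ) hinj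

lemma measurePreserving_shift (a : ℤ) :
    MeasurePreserving (shift a) (noiseLaw μ) (noiseLaw μ) :=
  ⟨by fun_prop, Measure.map_infinitePi_infinitePi_of_inj (P := fun _ : ℤ => μ)
    (add_right_injective a)⟩

/-- The selections read pairwise disjoint sets of coordinates: at a common time they use different
copies. -/
lemma iIndepFun_select {ι : Type*} (s : ι → ℤ → ℕ) (a : ι → ℤ)
    (h : ∀ i, Function.Injective fun j => s j i) :
    iIndepFun (fun j => select (s j) (a j)) (copiesLaw μ) := by
  rw [iIndepFun_iff_map_fun_eq_infinitePi_map (by fun_prop)]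
  have hinj : Function.Injective
      (fun p : ι × ℤ => (s p.1 (a p.1 + p.2), a p.1 + p.2)) := by
    rintro ⟨j, v⟩ ⟨k, w⟩ hjk
    simp only [Prod.mk.injEq] at hjk
    obtain ⟨h1, h2⟩ := hjk
    rw [h2] at h1
    have := h _ h1
    subst this
    simpa using h2
  have h1 := Measure.map_infinitePi_infinitePi_of_inj (P := fun _ : ℕ × ℤ => μ) hinj
  have h2 := Measure.infinitePi_map_curry (ι := ι) (κ := ℤ) (fun _ _ => μ)
  have h3 : (fun ω j => select (s j) (a j) ω) = (MeasurableEquiv.curry ι ℤ ℝ) ∘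
      fun (ω : ℕ × ℤ → ℝ) (p : ι × ℤ) => ω (s p.1 (a p.1 + p.2), a p.1 + p.2) := rfl
  rw [h3, ← Measure.map_map (by fun_prop) (by fun_prop), h1, h2]
  simp_rw [fun j => (measurePreserving_select (μ := μ) (s j) (a j)).map_eq]

lemma indepFun_select {s s' : ℤ → ℕ} (a a' : ℤ) (h : ∀ i, s i ≠ s' i) :
    IndepFun (select s a) (select s' a') (copiesLaw μ) := by
  have := iIndepFun_select (μ := μ) (fun j : Bool => cond j s s') (fun j => cond j a a')
    (fun i => by
      rintro (_ | _) (_ | _) hjk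
      · rfl
      · exact absurd hjk.symm (h i)
      · exact absurd hjk (h i)
      · rfl)
  exact this.indepFun (i := true) (j := false) (by simp)

/-- Replacing the noise at one time changes `φ` by at most `δ i` in `L²`. -/
def SingleSiteBound (μ : Measure ℝ) (φ : (ℤ → ℝ) → ℝ) (δ : ℤ → ℝ≥0∞) : Prop :=
  ∀ (i : ℤ) (s s' : ℤ → ℕ), (∀ j, j ≠ i → s j = s' j) →
    eLpNorm (fun ω => φ (select s 0 ω) - φ (select s' 0 ω)) 2 (copiesLaw μ) ≤ δ i

omit [IsProbabilityMeasure μ] in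
-- Telescoping: the times in `F` are switched one by one.
lemma SingleSiteBound.finset {φ : (ℤ → ℝ) → ℝ} {δ : ℤ → ℝ≥0∞} (hφ : Measurable φ)
    (h : SingleSiteBound μ φ δ) (F : Finset ℤ) (s s' : ℤ → ℕ) (hs : ∀ j, j ∉ F → s j = s' j) :
    eLpNorm (fun ω => φ (select s 0 ω) - φ (select s' 0 ω)) 2 (copiesLaw μ) ≤ ∑ i ∈ F, δ i := by
  induction F using Finset.induction_on generalizing s with
  | empty =>
    have : s = s' := funext fun j => hs j (by simp)
    simp [this]
  | insert i F hi ih =>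
    rw [Finset.sum_insert hi]
    set s₁ := Function.update s i (s' i) with hs₁
    have h1 := h i s s₁ (fun j hj => by simp [hs₁, hj])
    have h2 := ih s₁ (fun j hj => by
      by_cases hji : j = i
      · subst hji; simp [hs₁]
      · simp only [hs₁, Function.update_of_ne hji]
        exact hs j (by simp [hji, hj]))
    have h3 : (fun ω => φ (select s 0 ω) - φ (select s' 0 ω)) =
        (fun ω => φ (select s 0 ω) - φ (select s₁ 0 ω)) +
          fun ω => φ (select s₁ 0 ω) - φ (select s' 0 ω) := by
      ext ω; simp
    rw [h3]
    refine (eLpNorm_add_le ?_ ?_ (by norm_num)).trans (add_le_add h1 h2)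
    · exact Measurable.aestronglyMeasurable (by fun_prop)
    · exact Measurable.aestronglyMeasurable (by fun_prop)

/-- The filtration generated by the coordinates in `[-n, n]`. -/
noncomputable def windowFiltration : Filtration ℕ (MeasurableSpace.pi : MeasurableSpace (ℤ → ℝ)) where
  seq n := Filtration.piFinset (Finset.Icc (-(n : ℤ)) n)
  mono' n m hnm := Filtration.piFinset.mono (Finset.Icc_subset_Icc (by lia) (by lia))
  le' n := Filtration.piFinset.le _

lemma iSup_windowFiltration : ⨆ n, windowFiltration n = MeasurableSpace.pi := by
  refine le_antisymm (iSup_le fun n => windowFiltration.le n) (iSup_le fun i => ?_)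
  refine le_trans ?_ (le_iSup _ i.natAbs)
  have hi : i ∈ (Finset.Icc (-(i.natAbs : ℤ)) i.natAbs) := by
    rw [Finset.mem_Icc]; lia
  change _ ≤ MeasurableSpace.comap _ MeasurableSpace.pi
  rw [show (fun b : ℤ → ℝ => b i) = (fun y : (Finset.Icc (-(i.natAbs : ℤ)) i.natAbs : Set ℤ) → ℝ =>
    y ⟨i, hi⟩) ∘ Set.domRestrict _ from rfl, ← MeasurableSpace.comap_comp]
  exact MeasurableSpace.comap_mono (measurable_pi_apply _).comap_le

/-- By Lévy's upward theorem, the conditional expectation given the window `[-n, n]` approximates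
`φ` in `L¹`, and it only sees noise on which the two selections agree. Both approximation errors
have the same norm, since every selection has law `noiseLaw μ`. -/
lemma tendsto_eLpNorm_select {φ : (ℤ → ℝ) → ℝ} (hφ : Measurable φ)
    (hi : Integrable φ (noiseLaw μ)) (s : ℕ → ℤ → ℕ) (s' : ℤ → ℕ)
    (hs : ∀ n : ℕ, ∀ i ∈ Finset.Icc (-(n : ℤ)) n, s n i = s' i) :
    Tendsto (fun n => eLpNorm ((fun ω => φ (select (s n) 0 ω)) - fun ω => φ (select s' 0 ω)) 1
      (copiesLaw μ)) atTop (𝓝 0) := by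
  have hlim := hi.tendsto_eLpNorm_condExp (ℱ := windowFiltration)
    (by rw [iSup_windowFiltration]; exact hφ.stronglyMeasurable)
  set g : ℕ → (ℤ → ℝ) → ℝ := fun n => (noiseLaw μ)[φ | windowFiltration n] with hg
  have hgsm : ∀ n, StronglyMeasurable (g n) := fun n =>
    (stronglyMeasurable_condExp (m := windowFiltration n)).mono (windowFiltration.le n)
  have hgm : ∀ n, Measurable (g n) := fun n => (hgsm n).measurable
  have hdep : ∀ n, DependsOn (g n) (Finset.Icc (-(n : ℤ)) n) := fun n =>
    (stronglyMeasurable_condExp (m := windowFiltration n)).dependsOn_of_piFinset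
  have hsame : ∀ n ω, g n (select (s n) 0 ω) = g n (select s' 0 ω) := fun n ω => by
    refine hdep n fun i hi => ?_
    simp only [select, zero_add]
    rw [hs n i hi]
  have hterm : ∀ n (r : ℤ → ℕ),
      eLpNorm ((g n - φ) ∘ select r 0) 1 (copiesLaw μ) = eLpNorm (g n - φ) 1 (noiseLaw μ) :=
    fun n r => eLpNorm_comp_measurePreserving
      ((hgm n).sub hφ).aestronglyMeasurable (measurePreserving_select r 0)
  have hle : ∀ n, eLpNorm ((fun ω => φ (select (s n) 0 ω)) - fun ω => φ (select s' 0 ω)) 1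
      (copiesLaw μ) ≤ eLpNorm (g n - φ) 1 (noiseLaw μ) + eLpNorm (g n - φ) 1 (noiseLaw μ) := by
    intro n
    have h1 : ((fun ω => φ (select (s n) 0 ω)) - fun ω => φ (select s' 0 ω)) =
        (g n - φ) ∘ select s' 0 - (g n - φ) ∘ select (s n) 0 := by
      ext ω; simp [hsame]
    rw [h1]
    refine (eLpNorm_sub_le ?_ ?_ le_rfl).trans (add_le_add (hterm n _).le (hterm n _).le)
    · exact (((hgm n).sub hφ).comp (measurable_select _ _)).aestronglyMeasurable
    · exact (((hgm n).sub hφ).comp (measurable_select _ _)).aestronglyMeasurable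
  refine tendsto_of_tendsto_of_tendsto_of_le_of_le tendsto_const_nhds ?_ (fun _ => zero_le) hle
  simpa using hlim.add hlim

/-- Infinitely many changes: the noise is first switched on `[-n, n]` only, where the finite bound
applies. The results converge almost surely along a subsequence, and Fatou's lemma carries the `L²`
bound to the limit. -/
lemma SingleSiteBound.tsum {φ : (ℤ → ℝ) → ℝ} {δ : ℤ → ℝ≥0∞} (hφ : Measurable φ)
    (hi : Integrable φ (noiseLaw μ)) (h : SingleSiteBound μ φ δ) (s s' : ℤ → ℕ) :
    eLpNorm (fun ω => φ (select s 0 ω) - φ (select s' 0 ω)) 2 (copiesLaw μ) ≤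
      ∑' i, if s i = s' i then 0 else δ i := by
  set r : ℕ → ℤ → ℕ := fun n i => if i ∈ Finset.Icc (-(n : ℤ)) n then s' i else s i with hr
  have hlim := tendsto_eLpNorm_select (μ := μ) hφ hi r s' (fun n i hi => by simp only [hr, hi, if_true])
  have hmeas := tendstoInMeasure_of_tendsto_eLpNorm one_ne_zero
    (fun n => Measurable.aestronglyMeasurable (by fun_prop))
    (Measurable.aestronglyMeasurable (by fun_prop)) hlim
  obtain ⟨ns, -, hns⟩ := hmeas.exists_seq_tendsto_ae
  have hfatou := Lp.eLpNorm_lim_le_liminf_eLpNorm (p := 2) (μ := copiesLaw μ)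
    (f := fun k ω => φ (select s 0 ω) - φ (select (r (ns k)) 0 ω))
    (fun k => Measurable.aestronglyMeasurable (by fun_prop))
    (fun ω => φ (select s 0 ω) - φ (select s' 0 ω))
    (by filter_upwards [hns] with ω hω using hω.const_sub _)
  refine hfatou.trans (liminf_le_of_le (by isBoundedDefault) fun b hb => ?_)
  obtain ⟨k, hk⟩ := hb.exists
  refine hk.trans ?_
  have h1 := h.finset hφ ((Finset.Icc (-(ns k : ℤ)) (ns k)).filter fun i => s i ≠ s' i) s (r (ns k))
    (fun j hj => by
      simp only [Finset.mem_filter, not_and, not_not] at hj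
      by_cases hjm : j ∈ Finset.Icc (-(ns k : ℤ)) (ns k)
      · simp only [hr, hjm, if_true]; exact hj hjm
      · simp only [hr, hjm, if_false])
  refine h1.trans ?_
  rw [Finset.sum_filter]
  refine le_trans (Finset.sum_le_sum fun i _ => ?_) (ENNReal.sum_le_tsum (Finset.Icc (-(ns k : ℤ)) (ns k)))
  by_cases his : s i = s' i <;> simp [his]

end Coupling

/-! ### From physical dependence to the coupling -/

section PhysicalDependence

variable {Ω : Type*} [MeasurableSpace Ω] {P : Measure Ω} [IsProbabilityMeasure P]

omit [IsProbabilityMeasure P] in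
lemma measurePreserving_noise {ε : ℤ → Ω → ℝ} (hε_meas : ∀ u, Measurable (ε u))
    (hε_indep : iIndepFun ε P) (hε_ident : ∀ u, IdentDistrib (ε u) (ε 0) P P) :
    MeasurePreserving (fun ω u => ε u ω) P (noiseLaw (P.map (ε 0))) := by
  refine ⟨by fun_prop, ?_⟩
  rw [hε_indep.map_fun_eq_infinitePi_map hε_meas]
  simp_rw [fun u => (hε_ident u).map_eq]

/-- The noise and the replacing variable have the same joint law, a product, on `Ω × Ω` and on the
space of copies, so both `L²` norms are the norm of one function `G`. The reflection `x (-u)`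
reflects the index `t - u` in the Bernoulli shift. -/
lemma singleSiteBound_physicalDependence {ε : ℤ → Ω → ℝ} (hε_meas : ∀ u, Measurable (ε u))
    (hε_indep : iIndepFun ε P) (hε_ident : ∀ u, IdentDistrib (ε u) (ε 0) P P)
    {F : (ℤ → ℝ) → ℝ} (hF : Measurable F) :
    SingleSiteBound (P.map (ε 0)) (fun x => F (fun u => x (-u))) (physicalDependence P F ε) := by
  intro i s s' hs
  have : IsProbabilityMeasure (P.map (ε 0)) :=
    Measure.isProbabilityMeasure_map (hε_meas 0).aemeasurable
  by_cases hi : s i = s' i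
  · have : s = s' := funext fun j => by
      by_cases hj : j = i
      · rw [hj, hi]
      · exact hs j hj
    simp [this]
  set μ := P.map (ε 0) with hμ
  set G : (ℤ → ℝ) × ℝ → ℝ := fun p =>
    F (fun u => p.1 (-u)) - F (fun u => Function.update p.1 i p.2 (-u)) with hG
  have hupd : Measurable fun p : (ℤ → ℝ) × ℝ => Function.update p.1 i p.2 := by
    refine measurable_pi_iff.2 fun j => ?_
    by_cases hj : j = i
    · subst hj; simpa using measurable_snd
    · simp only [Function.update_of_ne hj]; fun_prop
  have hGm : Measurable G := by
    refine (hF.comp (by fun_prop)).sub (hF.comp ?_)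
    exact measurable_pi_iff.2 fun u => (measurable_pi_apply (-u)).comp hupd
  have hε := measurePreserving_noise hε_meas hε_indep hε_ident
  have hεi : MeasurePreserving (ε i) P μ := ⟨hε_meas i, (hε_ident i).map_eq⟩
  have h1 : physicalDependence P F ε i = eLpNorm G 2 ((noiseLaw μ).prod μ) := by
    rw [← eLpNorm_comp_measurePreserving hGm.aestronglyMeasurable (hε.prod hεi)]
    unfold physicalDependence bernoulliShift coupledNoise
    simp only [zero_sub]
    congr 1
    ext p
    simp only [hG, Function.comp_apply]
    congr 2
    ext u
    by_cases hu : -u = i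
    · rw [hu]; simp
    · simp [Function.update_of_ne hu]
  have h2 : MeasurePreserving (fun ω : ℕ × ℤ → ℝ => (select s 0 ω, ω (s' i, i)))
      (copiesLaw μ) ((noiseLaw μ).prod μ) := by
    -- An auxiliary selection that differs from `s` at every time and reads `ω (s' i, i)` at time
    -- `i`; its other values play no role.
    have hind := (indepFun_select (μ := μ) (s := s)
      (s' := fun j => if j = i then s' i else s j + 1) 0 0 (fun j => by
        by_cases hj : j = i
        · subst hj; simpa using hi
        · simp [hj])).comp measurable_id (measurable_pi_apply i)
    have he : ((fun x : ℤ → ℝ => x i) ∘ select (fun j => if j = i then s' i else s j + 1) 0) =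
        fun ω : ℕ × ℤ → ℝ => ω (s' i, i) := by
      ext ω; simp [select]
    rw [he, Function.id_comp] at hind
    refine ⟨by fun_prop, ?_⟩
    rw [(indepFun_iff_map_prod_eq_prod_map_map (by fun_prop)
      (measurable_pi_apply (s' i, i)).aemeasurable).1 hind,
      (measurePreserving_select (μ := μ) s 0).map_eq]
    congr 1
    exact Measure.infinitePi_map_eval (fun _ : ℕ × ℤ => μ) (s' i, i)
  rw [h1, ← eLpNorm_comp_measurePreserving hGm.aestronglyMeasurable h2]
  refine (congrArg (fun g => eLpNorm g 2 (copiesLaw μ)) ?_).le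
  ext ω
  simp only [hG, Function.comp_apply]
  congr 2
  ext u
  by_cases hu : -u = i
  · rw [hu]; simp [select]
  · simp [Function.update_of_ne hu, select, hs _ hu]

end PhysicalDependence

/-! ### Short-range functionals of the noise -/

section ShortRange

/-- A square integrable functional `φ` of the noise that changes by at most `D / c ^ 2` in `L²` if
the noise is replaced at times of distance at least `c`. -/
structure ShortRange (μ : Measure ℝ) (φ : (ℤ → ℝ) → ℝ) (D : ℝ) : Prop where
  measurable : Measurable φ
  memLp : MemLp φ 2 (noiseLaw μ)
  nonneg : 0 ≤ D
  bound : ∀ (s s' : ℤ → ℕ) (t : ℤ) (c : ℕ), 1 ≤ c → (∀ i, |i - t| < c → s i = s' i) →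
    eLpNorm (fun ω => φ (select s t ω) - φ (select s' t ω)) 2 (copiesLaw μ)
      ≤ ENNReal.ofReal (D / c ^ 2)

variable {μ : Measure ℝ} [IsProbabilityMeasure μ] {φ ψ : (ℤ → ℝ) → ℝ} {D D' : ℝ}

/-- Stationarity moves `t` to `0`. A replaced time `i` then satisfies `i² ≥ c²`, so the
corresponding `δ i` add up to at most `c⁻²` times the weighted sum. -/
lemma SingleSiteBound.shortRange {δ : ℤ → ℝ≥0∞} (hφ : Measurable φ) (hm : MemLp φ 2 (noiseLaw μ))
    (h : SingleSiteBound μ φ δ) (hδ : ∑' i : ℤ, ENNReal.ofReal ((i : ℝ) ^ 2) * δ i ≠ ∞) :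
    ShortRange μ φ (∑' i : ℤ, ENNReal.ofReal ((i : ℝ) ^ 2) * δ i).toReal where
  measurable := hφ
  memLp := hm
  nonneg := ENNReal.toReal_nonneg
  bound s s' t c hc hs := by
    have hc0 : (0 : ℝ) < c := by exact_mod_cast hc
    have hre : MeasurePreserving (fun (ω : ℕ × ℤ → ℝ) (p : ℕ × ℤ) => ω (p.1, t + p.2))
        (copiesLaw μ) (copiesLaw μ) := by
      refine ⟨by fun_prop, Measure.map_infinitePi_infinitePi_of_inj (P := fun _ : ℕ × ℤ => μ) ?_⟩
      rintro ⟨j, v⟩ ⟨k, w⟩ hjk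
      simpa using hjk
    have h1 : (fun ω => φ (select s t ω) - φ (select s' t ω)) =
        (fun ω => φ (select (fun v => s (t + v)) 0 ω) - φ (select (fun v => s' (t + v)) 0 ω)) ∘
          fun (ω : ℕ × ℤ → ℝ) (p : ℕ × ℤ) => ω (p.1, t + p.2) := by
      ext ω
      simp only [Function.comp_apply]
      congr 2 <;> · ext v; simp [select]
    rw [h1, eLpNorm_comp_measurePreserving (Measurable.aestronglyMeasurable (by fun_prop)) hre]
    refine (h.tsum hφ (hm.integrable (by norm_num)) _ _).trans ?_
    rw [ENNReal.ofReal_div_of_pos (by positivity), ENNReal.ofReal_toReal hδ,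
      ENNReal.le_div_iff_mul_le (by left; simpa using hc0.ne') (by left; simp), ← ENNReal.tsum_mul_right]
    refine ENNReal.tsum_le_tsum fun i => ?_
    by_cases hi : s (t + i) = s' (t + i)
    · simp [hi]
    · simp only [hi, if_false]
      rw [mul_comm]
      refine mul_le_mul' (ENNReal.ofReal_le_ofReal ?_) le_rfl
      have h2 : (c : ℤ) ≤ |i| := by
        by_contra hlt
        exact hi (hs (t + i) (by simpa using hlt))
      have h3 : (c : ℝ) ≤ |(i : ℝ)| := by exact_mod_cast h2
      exact (pow_le_pow_left₀ hc0.le h3 2).trans (sq_abs _).le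

namespace ShortRange

lemma memLp_select (h : ShortRange μ φ D) (s : ℤ → ℕ) (t : ℤ) :
    MemLp (fun ω => φ (select s t ω)) 2 (copiesLaw μ) :=
  h.memLp.comp_measurePreserving (measurePreserving_select s t)

/-- Used for truncation and for its complement: both are 1-Lipschitz, so both parts of a truncated
functional keep the constant `D`. -/
lemma comp (h : ShortRange μ φ D) {τ : ℝ → ℝ} (hτ : ∀ x y, |τ x - τ y| ≤ |x - y|) :
    ShortRange μ (fun x => τ (φ x)) D := by
  have hτm : Measurable τ := by
    have : LipschitzWith 1 τ := LipschitzWith.of_dist_le_mul fun x y => by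
      simpa [Real.dist_eq] using hτ x y
    exact this.continuous.measurable
  refine ⟨hτm.comp h.measurable, ?_, h.nonneg, fun s s' t c hc hs => ?_⟩
  · refine ((memLp_const |τ 0|).add h.memLp.norm).mono
      (hτm.comp h.measurable).aestronglyMeasurable (ae_of_all _ fun x => ?_)
    have h1 := hτ (φ x) 0
    have h2 := abs_sub_abs_le_abs_sub (τ (φ x)) (τ 0)
    rw [sub_zero] at h1
    change |τ (φ x)| ≤ |(|τ 0| + |φ x|)|
    rw [abs_of_nonneg (a := |τ 0| + |φ x|) (by positivity)]
    linarith
  · refine (eLpNorm_mono fun ω => ?_).trans (h.bound s s' t c hc hs)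
    exact hτ _ _

lemma sub_const (h : ShortRange μ φ D) (a : ℝ) : ShortRange μ (fun x => φ x - a) D :=
  h.comp (τ := fun y => y - a) (by simp)

omit [IsProbabilityMeasure μ] in
lemma add (h : ShortRange μ φ D) (h' : ShortRange μ ψ D') :
    ShortRange μ (fun x => φ x + ψ x) (D + D') := by
  refine ⟨h.measurable.add h'.measurable, h.memLp.add h'.memLp, add_nonneg h.nonneg h'.nonneg,
    fun s s' t c hc hs => ?_⟩
  have := h.measurable
  have := h'.measurable
  have h1 : (fun ω => φ (select s t ω) + ψ (select s t ω) -
      (φ (select s' t ω) + ψ (select s' t ω))) =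
      (fun ω => φ (select s t ω) - φ (select s' t ω)) +
        fun ω => ψ (select s t ω) - ψ (select s' t ω) := by
    ext ω; simp only [Pi.add_apply]; ring
  rw [h1, add_div, ENNReal.ofReal_add (by have := h.nonneg; positivity)
    (by have := h'.nonneg; positivity)]
  refine (eLpNorm_add_le (Measurable.aestronglyMeasurable (by fun_prop))
    (Measurable.aestronglyMeasurable (by fun_prop)) (by norm_num)).trans
    (add_le_add (h.bound s s' t c hc hs) (h'.bound s s' t c hc hs))

omit [IsProbabilityMeasure μ] in
lemma const_mul (h : ShortRange μ φ D) (a : ℝ) : ShortRange μ (fun x => a * φ x) (|a| * D) := by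
  refine ⟨h.measurable.const_mul a, h.memLp.const_mul a, mul_nonneg (abs_nonneg a) h.nonneg,
    fun s s' t c hc hs => ?_⟩
  have h1 : (fun ω => a * φ (select s t ω) - a * φ (select s' t ω)) =
      a • (fun ω => φ (select s t ω) - φ (select s' t ω)) := by
    ext ω; simp only [Pi.smul_apply, smul_eq_mul]; ring
  rw [h1, mul_div_assoc, ENNReal.ofReal_mul (abs_nonneg a)]
  refine eLpNorm_const_smul_le.trans ?_
  rw [← ofReal_norm, Real.norm_eq_abs]
  gcongr
  exact h.bound s s' t c hc hs

lemma finset_sum {κ : Type*} (K : Finset κ) {φ : κ → (ℤ → ℝ) → ℝ} {D : κ → ℝ}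
    (h : ∀ k ∈ K, ShortRange μ (φ k) (D k)) :
    ShortRange μ (fun x => ∑ k ∈ K, φ k x) (∑ k ∈ K, D k) := by
  classical
  induction K using Finset.induction_on with
  | empty =>
    simp only [Finset.sum_empty]
    exact ⟨measurable_const, memLp_const 0, le_rfl, fun s s' t c hc hs => by simp⟩
  | insert k K hk ih =>
    simp_rw [Finset.sum_insert hk]
    exact (h k (by simp)).add (ih fun j hj => h j (by simp [hj]))

end ShortRange

end ShortRange

/-! ### Double sums over differences -/

section DoubleSums

/-- The sum of the inverse squares of the non-zero integers. -/
noncomputable def zetaTwo : ℝ := ∑' d : ℤ, 1 / (d : ℝ) ^ 2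

lemma summable_int_inv_sq : Summable fun d : ℤ => 1 / (d : ℝ) ^ 2 :=
  Real.summable_one_div_int_pow.2 one_lt_two

lemma zetaTwo_nonneg : 0 ≤ zetaTwo := tsum_nonneg fun d => by positivity

lemma sum_comp_le_tsum {a : ℤ → ℝ} (ha : Summable a) (h0 : ∀ d, 0 ≤ a d) {g : ℕ → ℤ}
    (hg : Function.Injective g) (p : ℕ) : ∑ t ∈ Finset.range p, a (g t) ≤ ∑' d, a d :=
  ((ha.comp_injective hg).sum_le_tsum _ fun _ _ => h0 _).trans
    (tsum_comp_le_tsum_of_inj ha h0 hg)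

lemma sum_inv_sq_le (p : ℕ) : ∑ t ∈ Finset.range p, 1 / ((t : ℝ) + 1) ^ 2 ≤ zetaTwo := by
  have := sum_comp_le_tsum summable_int_inv_sq (fun d => by positivity)
    (g := fun t : ℕ => (t : ℤ) + 1) (fun a b h => by simpa using h) p
  simpa [zetaTwo] using this

/-- The new row and column contain every difference in `[-p, p]` once; the term `a 0` is subtracted
because `n = 0` counts it twice. -/
lemma double_sum_succ (a : ℤ → ℝ) (p : ℕ) :
    ∑ s ∈ Finset.range (p + 1), ∑ t ∈ Finset.range (p + 1), a (t - s) =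
      ∑ s ∈ Finset.range p, ∑ t ∈ Finset.range p, a (t - s) +
        (∑ n ∈ Finset.range (p + 1), (a n + a (-n)) - a 0) := by
  rw [Finset.sum_range_succ, Finset.sum_range_succ (n := p) (f := fun t => a (t - p))]
  simp_rw [Finset.sum_range_succ (n := p) (f := fun t => a ((t : ℤ) - _))]
  rw [Finset.sum_add_distrib, Finset.sum_range_succ' (fun n => a n + a (-n)),
    Finset.sum_add_distrib]
  have h1 : ∑ s ∈ Finset.range p, a ((p : ℤ) - s) = ∑ n ∈ Finset.range p, a ((n + 1 : ℕ) : ℤ) := by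
    rw [← Finset.sum_range_reflect]
    refine Finset.sum_congr rfl fun s hs => ?_
    rw [Finset.mem_range] at hs
    congr 1; lia
  have h2 : ∑ s ∈ Finset.range p, a ((s : ℤ) - p) = ∑ n ∈ Finset.range p, a (-((n + 1 : ℕ) : ℤ)) := by
    rw [← Finset.sum_range_reflect]
    refine Finset.sum_congr rfl fun s hs => ?_
    rw [Finset.mem_range] at hs
    congr 1; lia
  rw [h1, h2]
  simp
  ring

/-- By `double_sum_succ` the double sum is the sum of the symmetric partial sums of `a`, so this is
convergence of Cesàro means. -/
lemma tendsto_double_sum {a : ℤ → ℝ} (ha : Summable a) :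
    Tendsto (fun p : ℕ => (p : ℝ)⁻¹ * ∑ s ∈ Finset.range p, ∑ t ∈ Finset.range p, a (t - s)) atTop
      (𝓝 (∑' d, a d)) := by
  have h1 : Tendsto (fun p : ℕ => ∑ n ∈ Finset.range (p + 1), (a n + a (-n)) - a 0) atTop
      (𝓝 (∑' d, a d)) := by
    have := (ha.hasSum.nat_add_neg).tendsto_sum_nat.comp (tendsto_add_atTop_nat 1)
    simpa using this.sub_const (a 0)
  refine h1.cesaro.congr fun p => ?_
  congr 1
  induction p with
  | zero => simp
  | succ p ih => rw [Finset.sum_range_succ, ih, double_sum_succ]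

lemma double_sum_le {a u : ℤ → ℝ} (hu : Summable u) (h : ∀ d, |a d| ≤ u d) (p : ℕ) :
    ∑ s ∈ Finset.range p, ∑ t ∈ Finset.range p, a (t - s) ≤ p * ∑' d, u d := by
  calc _ ≤ ∑ s ∈ Finset.range p, ∑' d, u d := by
        refine Finset.sum_le_sum fun s _ => ?_
        refine le_trans (Finset.sum_le_sum fun t _ => (le_abs_self _).trans (h _)) ?_
        exact sum_comp_le_tsum hu (fun d => (abs_nonneg _).trans (h d))
          (g := fun t : ℕ => (t : ℤ) - s) (fun x y hxy => by simpa using hxy) p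
    _ = _ := by simp

end DoubleSums

/-! ### Autocovariances and second moments of block sums -/

section BlockSums

lemma integral_comp_of_measurePreserving {α β : Type*} [MeasurableSpace α] [MeasurableSpace β]
    {ν : Measure α} {ν' : Measure β} {T : α → β} (hT : MeasurePreserving T ν ν') {g : β → ℝ}
    (hg : AEStronglyMeasurable g ν') : ∫ x, g (T x) ∂ν = ∫ y, g y ∂ν' := by
  rw [← hT.map_eq, integral_map hT.measurable.aemeasurable (by rwa [hT.map_eq])]

/-- The sum of `φ` over the times `1, …, p`. -/
def blockSum (φ : (ℤ → ℝ) → ℝ) (p : ℕ) (x : ℤ → ℝ) : ℝ :=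
  ∑ t ∈ Finset.range p, φ (shift ((t : ℤ) + 1) x)

/-- The expectation of the product of `φ` at the times `0` and `d`. -/
noncomputable def autocov (μ : Measure ℝ) (φ : (ℤ → ℝ) → ℝ) (d : ℤ) : ℝ :=
  ∫ x, φ x * φ (shift d x) ∂(noiseLaw μ)

lemma blockSum_select (φ : (ℤ → ℝ) → ℝ) (p : ℕ) (s : ℤ → ℕ) (a : ℤ) (ω : ℕ × ℤ → ℝ) :
    blockSum φ p (select s a ω) = ∑ t ∈ Finset.range p, φ (select s (a + (t + 1)) ω) := by
  simp [blockSum, shift_select]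

lemma measurable_blockSum {φ : (ℤ → ℝ) → ℝ} (hφ : Measurable φ) (p : ℕ) :
    Measurable (blockSum φ p) := by
  unfold blockSum; fun_prop

variable {μ : Measure ℝ} [IsProbabilityMeasure μ] {φ : (ℤ → ℝ) → ℝ} {D τ : ℝ}

lemma shift_shift (a b : ℤ) (x : ℤ → ℝ) : shift b (shift a x) = shift (a + b) x := by
  ext v; simp [shift, add_assoc]

lemma integral_shift_mul_shift (hφ : Measurable φ) (s t : ℤ) :
    ∫ x, φ (shift s x) * φ (shift t x) ∂(noiseLaw μ) = autocov μ φ (t - s) := by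
  rw [autocov, ← integral_comp_of_measurePreserving (measurePreserving_shift s)
    (g := fun x => φ x * φ (shift (t - s) x)) (Measurable.aestronglyMeasurable (by fun_prop))]
  simp [shift_shift]

lemma autocov_neg (hφ : Measurable φ) (d : ℤ) : autocov μ φ (-d) = autocov μ φ d := by
  rw [← zero_sub, ← integral_shift_mul_shift hφ d 0]
  have := integral_shift_mul_shift (μ := μ) hφ 0 d
  rw [sub_zero] at this
  rw [← this]
  simp_rw [mul_comm]

namespace ShortRange

lemma memLp_shift (h : ShortRange μ φ D) (t : ℤ) : MemLp (fun x => φ (shift t x)) 2 (noiseLaw μ) :=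
  h.memLp.comp_measurePreserving (measurePreserving_shift t)

lemma memLp_blockSum (h : ShortRange μ φ D) (p : ℕ) : MemLp (blockSum φ p) 2 (noiseLaw μ) :=
  memLp_finsetSum _ fun _ _ => h.memLp_shift _

lemma integral_blockSum_sq (h : ShortRange μ φ D) (p : ℕ) :
    ∫ x, blockSum φ p x ^ 2 ∂(noiseLaw μ) =
      ∑ s ∈ Finset.range p, ∑ t ∈ Finset.range p, autocov μ φ (t - s) := by
  simp_rw [blockSum, sq, Finset.sum_mul_sum]
  have hi : ∀ s t : ℤ, Integrable (fun x => φ (shift s x) * φ (shift t x)) (noiseLaw μ) :=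
    fun s t => (h.memLp_shift s).integrable_mul (h.memLp_shift t)
  rw [integral_finsetSum _ fun s _ => integrable_finsetSum _ fun t _ => hi _ _]
  refine Finset.sum_congr rfl fun s _ => ?_
  rw [integral_finsetSum _ fun t _ => hi _ _]
  refine Finset.sum_congr rfl fun t _ => ?_
  rw [integral_shift_mul_shift h.measurable]
  congr 1; ring

lemma integral_blockSum (h : ShortRange μ φ D) (h0 : ∫ x, φ x ∂(noiseLaw μ) = 0) (p : ℕ) :
    ∫ x, blockSum φ p x ∂(noiseLaw μ) = 0 := by
  simp_rw [blockSum]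
  rw [integral_finsetSum _ fun t _ => (h.memLp_shift _).integrable (by norm_num)]
  exact Finset.sum_eq_zero fun t _ => (integral_comp_of_measurePreserving
    (measurePreserving_shift _) h.memLp.1).trans h0

/-- The time axis is cut at `c ≈ t / 2`. Replacing the noise from `c` on in the factor at time `0`,
and before `c` in the factor at time `t`, makes the factors independent and centred. Each
replacement takes place at distance about `t / 2` and costs at most `4 D / t²` in `L²`. -/
lemma abs_autocov_nat_le (h : ShortRange μ φ D) (h0 : ∫ x, φ x ∂(noiseLaw μ) = 0) (hτ0 : 0 ≤ τ)
    (hτ : eLpNorm φ 2 (noiseLaw μ) ≤ ENNReal.ofReal τ) {t : ℕ} (ht : 1 ≤ t) :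
    |autocov μ φ t| ≤ 8 * τ * D * (1 / (t : ℝ) ^ 2) := by
  have hφ := h.measurable
  have hD := h.nonneg
  obtain ⟨c, hc1, hct, hc2⟩ : ∃ c : ℕ, 1 ≤ c ∧ c ≤ t ∧ (t = 2 * c ∨ t + 1 = 2 * c) :=
    ⟨(t + 1) / 2, by lia, by lia, by lia⟩
  set s₀ : ℤ → ℕ := fun _ => 0
  set s₁ : ℤ → ℕ := fun i => if i < c then 0 else 1 with hs₁
  set s₂ : ℤ → ℕ := fun i => if i < c then 1 else 0 with hs₂
  have hnorm : ∀ s a, eLpNorm (fun ω => φ (select s a ω)) 2 (copiesLaw μ) ≤ ENNReal.ofReal τ :=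
    fun s a => (eLpNorm_comp_measurePreserving hφ.aestronglyMeasurable
      (measurePreserving_select s a)).le.trans hτ
  have hint : ∀ s a, ∫ ω, φ (select s a ω) ∂(copiesLaw μ) = 0 := fun s a =>
    (integral_comp_of_measurePreserving (measurePreserving_select s a) h.memLp.1).trans h0
  have hsm : ∀ s a, AEStronglyMeasurable (fun ω => φ (select s a ω)) (copiesLaw μ) :=
    fun s a => Measurable.aestronglyMeasurable (by fun_prop)
  have hb : ∀ k : ℕ, 1 ≤ k → t ≤ 2 * k → D / (k : ℝ) ^ 2 ≤ 4 * D * (1 / (t : ℝ) ^ 2) := by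
    intro k hk htk
    have hk0 : (0 : ℝ) < k := by exact_mod_cast hk
    have ht0 : (0 : ℝ) < t := by exact_mod_cast ht
    have htk' : (t : ℝ) ≤ 2 * k := by exact_mod_cast htk
    rw [mul_one_div, div_le_div_iff₀ (by positivity) (by positivity)]
    nlinarith [mul_le_mul_of_nonneg_left (pow_le_pow_left₀ ht0.le htk' 2) hD]
  have hB0 : 0 ≤ 4 * D * (1 / (t : ℝ) ^ 2) := by positivity
  have e1 : eLpNorm (fun ω => φ (select s₀ 0 ω) - φ (select s₁ 0 ω)) 2 (copiesLaw μ) ≤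
      ENNReal.ofReal (4 * D * (1 / (t : ℝ) ^ 2)) :=
    (h.bound s₀ s₁ 0 c hc1 fun i hi => by
      have : i < c := by rw [abs_lt] at hi; lia
      simp [s₀, hs₁, this]).trans (ENNReal.ofReal_le_ofReal (hb c hc1 (by lia)))
  -- Times within distance less than `t - c + 1` of `t` are at least `c`, and `2 * (t - c + 1) ≥ t`
  -- because `2 * c ≤ t + 1`.
  have e2 : eLpNorm (fun ω => φ (select s₀ t ω) - φ (select s₂ t ω)) 2 (copiesLaw μ) ≤
      ENNReal.ofReal (4 * D * (1 / (t : ℝ) ^ 2)) :=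
    (h.bound s₀ s₂ t (t - c + 1) (by lia) fun i hi => by
      have : ¬ i < c := by rw [abs_lt] at hi; push_cast [hct] at hi; lia
      simp [s₀, hs₂, this]).trans (ENNReal.ofReal_le_ofReal (hb _ (by lia) (by lia)))
  have i1 : Integrable (fun ω => (φ (select s₀ 0 ω) - φ (select s₁ 0 ω)) * φ (select s₀ t ω))
      (copiesLaw μ) := ((h.memLp_select s₀ 0).sub (h.memLp_select s₁ 0)).integrable_mul
        (h.memLp_select s₀ t)
  have i2 : Integrable (fun ω => φ (select s₁ 0 ω) * (φ (select s₀ t ω) - φ (select s₂ t ω)))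
      (copiesLaw μ) := (h.memLp_select s₁ 0).integrable_mul
        ((h.memLp_select s₀ t).sub (h.memLp_select s₂ t))
  have i3 : Integrable (fun ω => φ (select s₁ 0 ω) * φ (select s₂ t ω))
      (copiesLaw μ) := (h.memLp_select s₁ 0).integrable_mul (h.memLp_select s₂ t)
  have hz : ∫ ω, φ (select s₁ 0 ω) * φ (select s₂ t ω) ∂(copiesLaw μ) = 0 := by
    have hind := (indepFun_select (μ := μ) (s := s₁) (s' := s₂) 0 t (fun i => by
      by_cases hi : i < c <;> simp [hs₁, hs₂, hi])).comp hφ hφ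
    have := hind.integral_fun_mul_eq_mul_integral (hsm _ _) (hsm _ _)
    simp only [Function.comp_apply] at this
    rw [this, hint, zero_mul]
  have hsplit : autocov μ φ t =
      ∫ ω, (φ (select s₀ 0 ω) - φ (select s₁ 0 ω)) * φ (select s₀ t ω) ∂(copiesLaw μ) +
      ∫ ω, φ (select s₁ 0 ω) * (φ (select s₀ t ω) - φ (select s₂ t ω)) ∂(copiesLaw μ) := by
    have h1 : autocov μ φ t = ∫ ω, ((φ (select s₀ 0 ω) - φ (select s₁ 0 ω)) * φ (select s₀ t ω) +
        φ (select s₁ 0 ω) * (φ (select s₀ t ω) - φ (select s₂ t ω))) +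
        φ (select s₁ 0 ω) * φ (select s₂ t ω) ∂(copiesLaw μ) := by
      rw [autocov, ← integral_comp_of_measurePreserving (measurePreserving_select s₀ 0)
        (Measurable.aestronglyMeasurable (by fun_prop))]
      congr 1
      ext ω
      simp only [shift_select, zero_add]
      ring
    rw [h1, integral_add (by exact i1.add i2) i3, hz, add_zero, integral_add i1 i2]
  rw [hsplit]
  have b1 := abs_integral_mul_le ((hsm s₀ 0).sub (hsm s₁ 0)) (hsm s₀ t) hB0 hτ0 e1 (hnorm _ _)
  have b2 := abs_integral_mul_le (hsm s₁ 0) ((hsm s₀ t).sub (hsm s₂ t)) hτ0 hB0 (hnorm _ _) e2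
  refine (abs_add_le _ _).trans ((add_le_add b1 b2).trans (le_of_eq ?_))
  ring

/-- The indicator covers `d = 0`, where `1 / 0 ^ 2 = 0`. Both terms carry a factor `τ`: a functional
of small norm, with `D` fixed, has block sums of small normalised variance. -/
lemma abs_autocov_le (h : ShortRange μ φ D) (h0 : ∫ x, φ x ∂(noiseLaw μ) = 0) (hτ0 : 0 ≤ τ)
    (hτ : eLpNorm φ 2 (noiseLaw μ) ≤ ENNReal.ofReal τ) (d : ℤ) :
    |autocov μ φ d| ≤ (if d = 0 then τ ^ 2 else 0) + 8 * τ * D * (1 / (d : ℝ) ^ 2) := by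
  by_cases hd : d = 0
  · subst hd
    have := abs_integral_mul_le h.memLp.1 (h.memLp_shift 0).1 hτ0 hτ0 hτ
      ((eLpNorm_comp_measurePreserving h.memLp.1 (measurePreserving_shift 0)).le.trans hτ)
    simpa [autocov, sq] using this
  · have h1 := h.abs_autocov_nat_le h0 hτ0 hτ (t := d.natAbs) (by lia)
    have h2 : autocov μ φ d = autocov μ φ d.natAbs := by
      rcases Int.natAbs_eq d with hd' | hd'
      · rw [← hd']
      · conv_lhs => rw [hd']
        exact autocov_neg h.measurable _
    rw [h2, if_neg hd, zero_add]
    refine h1.trans (le_of_eq ?_)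
    have : ((d.natAbs : ℕ) : ℝ) ^ 2 = (d : ℝ) ^ 2 := by
      rw [Nat.cast_natAbs, Int.cast_abs, sq_abs]
    rw [this]

lemma summable_autocov_bound (τ D : ℝ) :
    Summable fun d : ℤ => (if d = 0 then τ ^ 2 else 0) + 8 * τ * D * (1 / (d : ℝ) ^ 2) :=
  (summable_of_ne_finset_zero (s := {0}) (fun d hd => by simp_all)).add
    (summable_int_inv_sq.mul_left _)

lemma summable_autocov (h : ShortRange μ φ D) (h0 : ∫ x, φ x ∂(noiseLaw μ) = 0) :
    Summable (autocov μ φ) := by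
  refine Summable.of_norm_bounded (summable_autocov_bound (eLpNorm φ 2 (noiseLaw μ)).toReal D)
    fun d => ?_
  exact h.abs_autocov_le h0 ENNReal.toReal_nonneg (ENNReal.ofReal_toReal h.memLp.2.ne).ge d

lemma integral_blockSum_sq_le (h : ShortRange μ φ D) (h0 : ∫ x, φ x ∂(noiseLaw μ) = 0)
    (hτ0 : 0 ≤ τ) (hτ : eLpNorm φ 2 (noiseLaw μ) ≤ ENNReal.ofReal τ) (p : ℕ) :
    ∫ x, blockSum φ p x ^ 2 ∂(noiseLaw μ) ≤ p * (τ ^ 2 + 8 * τ * D * zetaTwo) := by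
  rw [h.integral_blockSum_sq]
  refine (double_sum_le (summable_autocov_bound τ D) (h.abs_autocov_le h0 hτ0 hτ) p).trans_eq ?_
  rw [Summable.tsum_add (summable_of_ne_finset_zero (s := {0}) (fun d hd => by simp_all))
    (summable_int_inv_sq.mul_left _), tsum_mul_left, tsum_ite_eq]
  rfl

lemma tendsto_integral_blockSum_sq (h : ShortRange μ φ D) (h0 : ∫ x, φ x ∂(noiseLaw μ) = 0) :
    Tendsto (fun p : ℕ => (p : ℝ)⁻¹ * ∫ x, blockSum φ p x ^ 2 ∂(noiseLaw μ)) atTop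
      (𝓝 (∑' d, autocov μ φ d)) := by
  simp_rw [h.integral_blockSum_sq]
  exact tendsto_double_sum (h.summable_autocov h0)

omit [IsProbabilityMeasure μ] in
/-- Replacing the noise outside of a block changes the sum over the block by a bounded amount. -/
lemma eLpNorm_blockSum_sub_le (h : ShortRange μ φ D) (p : ℕ) (a : ℤ) {s s' : ℤ → ℕ}
    (hs : ∀ i, a < i → i ≤ a + p → s i = s' i) :
    eLpNorm (fun ω => blockSum φ p (select s a ω) - blockSum φ p (select s' a ω)) 2 (copiesLaw μ)
      ≤ ENNReal.ofReal (2 * D * zetaTwo) := by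
  have hφ := h.measurable
  have hD := h.nonneg
  have h1 : (fun ω => blockSum φ p (select s a ω) - blockSum φ p (select s' a ω)) =
      ∑ t ∈ Finset.range p,
        fun ω => φ (select s (a + (t + 1)) ω) - φ (select s' (a + (t + 1)) ω) := by
    ext ω; simp [blockSum_select]
  rw [h1]
  refine (eLpNorm_sum_le (fun t _ => Measurable.aestronglyMeasurable (by fun_prop))
    (by norm_num)).trans ?_
  -- Position `t + 1` has distance `min (t + 1) (p - t)` from the outside of the block. The inverse
  -- square of a minimum is at most the sum of both inverse squares, and each of the two sums is at
  -- most `zetaTwo`.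
  have h2 : ∀ t ∈ Finset.range p,
      eLpNorm (fun ω => φ (select s (a + (t + 1)) ω) - φ (select s' (a + (t + 1)) ω)) 2
        (copiesLaw μ) ≤ ENNReal.ofReal (D * (1 / ((t : ℝ) + 1) ^ 2) +
          D * (1 / (((p - 1 - t : ℕ) : ℝ) + 1) ^ 2)) := by
    intro t ht
    rw [Finset.mem_range] at ht
    refine (h.bound s s' _ (min (t + 1) (p - 1 - t + 1)) (by lia) fun i hi => ?_).trans
      (ENNReal.ofReal_le_ofReal ?_)
    · rw [abs_lt] at hi
      push_cast at hi
      exact hs i (by lia) (by lia)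
    · rcases min_choice (t + 1) (p - 1 - t + 1) with hm | hm
      · rw [hm, mul_one_div]; push_cast
        exact le_add_of_nonneg_right (by positivity)
      · rw [hm, Nat.cast_add_one]
        rw [mul_one_div, mul_one_div]
        exact le_add_of_nonneg_left (by positivity)
  refine (Finset.sum_le_sum h2).trans ?_
  rw [← ENNReal.ofReal_sum_of_nonneg fun t _ => by positivity]
  refine ENNReal.ofReal_le_ofReal ?_
  rw [Finset.sum_add_distrib, ← Finset.mul_sum, ← Finset.mul_sum,
    Finset.sum_range_reflect (fun t : ℕ => 1 / ((t : ℝ) + 1) ^ 2) p]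
  nlinarith [mul_le_mul_of_nonneg_left (sum_inv_sq_le p) hD]

end ShortRange

end BlockSums

/-! ### Fourth moments of block sums of bounded functionals -/

section FourthMoments

/-- The constants are `(1 + θ)³` and `(1 + 1/θ)³` with `θ = 1/10`. Twice the first must stay below
`4` in the doubling recursion. -/
lemma add_pow_four_le (x y : ℝ) : (x + y) ^ 4 ≤ 1331 / 1000 * x ^ 4 + 1331 * y ^ 4 := by
  have h1 : (x + y) ^ 2 ≤ 11 / 10 * x ^ 2 + 11 * y ^ 2 := by nlinarith [sq_nonneg (x - 10 * y)]
  have h2 : ((x + y) ^ 2) ^ 2 ≤ (11 / 10 * x ^ 2 + 11 * y ^ 2) ^ 2 :=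
    pow_le_pow_left₀ (sq_nonneg _) h1 2
  nlinarith [sq_nonneg (x ^ 2 - 100 * y ^ 2)]

lemma add_add_pow_four_le (x y z : ℝ) : (x + y + z) ^ 4 ≤ 27 * (x ^ 4 + y ^ 4 + z ^ 4) := by
  have h1 : (x + y + z) ^ 2 ≤ 3 * (x ^ 2 + y ^ 2 + z ^ 2) := by
    nlinarith [sq_nonneg (x - y), sq_nonneg (y - z), sq_nonneg (x - z)]
  have h2 : ((x + y + z) ^ 2) ^ 2 ≤ (3 * (x ^ 2 + y ^ 2 + z ^ 2)) ^ 2 :=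
    pow_le_pow_left₀ (sq_nonneg _) h1 2
  nlinarith [sq_nonneg (x ^ 2 - y ^ 2), sq_nonneg (y ^ 2 - z ^ 2), sq_nonneg (x ^ 2 - z ^ 2)]

/-- Independence and centring remove the mixed terms of odd order; only `6 E[A²] E[B²]` survives. -/
lemma integral_add_pow_four_le {α : Type*} [MeasurableSpace α] {ν : Measure α}
    [IsProbabilityMeasure ν] {A B : α → ℝ} (hA : Measurable A) (hB : Measurable B) {N : ℝ}
    (hAN : ∀ x, |A x| ≤ N) (hBN : ∀ x, |B x| ≤ N) (hind : IndepFun A B ν)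
    (hA0 : ∫ x, A x ∂ν = 0) (hB0 : ∫ x, B x ∂ν = 0) {w m : ℝ} (hA2 : ∫ x, A x ^ 2 ∂ν ≤ w)
    (hB2 : ∫ x, B x ^ 2 ∂ν ≤ w) (hA4 : ∫ x, A x ^ 4 ∂ν ≤ m) (hB4 : ∫ x, B x ^ 4 ∂ν ≤ m) :
    ∫ x, (A x + B x) ^ 4 ∂ν ≤ 2 * m + 6 * w ^ 2 := by
  have hi : ∀ j k : ℕ, Integrable (fun x => A x ^ j * B x ^ k) ν := fun j k => by
    refine Integrable.of_bound (Measurable.aestronglyMeasurable (by fun_prop)) (N ^ j * N ^ k)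
      (ae_of_all _ fun x => ?_)
    rw [Real.norm_eq_abs, abs_mul, abs_pow, abs_pow]
    have := (abs_nonneg _).trans (hAN x)
    gcongr
    · exact hAN x
    · exact hBN x
  have hprod : ∀ j k : ℕ, ∫ x, A x ^ j * B x ^ k ∂ν = (∫ x, A x ^ j ∂ν) * ∫ x, B x ^ k ∂ν := by
    intro j k
    have := hind.comp (φ := fun y => y ^ j) (ψ := fun y => y ^ k) (by fun_prop) (by fun_prop)
    exact this.integral_fun_mul_eq_mul_integral (Measurable.aestronglyMeasurable (by fun_prop))
      (Measurable.aestronglyMeasurable (by fun_prop))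
  have hexp : ∀ x, (A x + B x) ^ 4 = ((A x ^ 4 * B x ^ 0 + 4 * (A x ^ 3 * B x ^ 1)) +
      (6 * (A x ^ 2 * B x ^ 2) + 4 * (A x ^ 1 * B x ^ 3))) + A x ^ 0 * B x ^ 4 := fun x => by ring
  simp_rw [hexp]
  have i1 := (hi 4 0).add ((hi 3 1).const_mul 4)
  have i2 := ((hi 2 2).const_mul 6).add ((hi 1 3).const_mul 4)
  rw [integral_add (by exact i1.add i2) (hi 0 4), integral_add (by exact i1) (by exact i2),
    integral_add (hi 4 0) ((hi 3 1).const_mul 4),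
    integral_add ((hi 2 2).const_mul 6) ((hi 1 3).const_mul 4),
    integral_const_mul, integral_const_mul, integral_const_mul, hprod 3 1, hprod 2 2, hprod 1 3]
  simp only [pow_zero, mul_one, one_mul, pow_one, hA0, hB0, mul_zero, zero_mul, add_zero]
  have h2 : (∫ x, A x ^ 2 ∂ν) * (∫ x, B x ^ 2 ∂ν) ≤ w * w := by
    have : 0 ≤ ∫ x, A x ^ 2 ∂ν := integral_nonneg fun x => sq_nonneg _
    exact mul_le_mul hA2 hB2 (integral_nonneg fun x => sq_nonneg _) (this.trans hA2)
  nlinarith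

variable {μ : Measure ℝ} [IsProbabilityMeasure μ] {φ : (ℤ → ℝ) → ℝ} {D M : ℝ}

lemma blockSum_two_mul_add (φ : (ℤ → ℝ) → ℝ) (p r : ℕ) (x : ℤ → ℝ) :
    blockSum φ (2 * p + r) x =
      blockSum φ p x + blockSum φ p (shift p x) + blockSum φ r (shift (2 * p : ℕ) x) := by
  simp only [blockSum, shift_shift, two_mul, Finset.sum_range_add]
  push_cast
  simp only [add_assoc]

lemma abs_blockSum_le (hM : ∀ x, |φ x| ≤ M) (p : ℕ) (x : ℤ → ℝ) : |blockSum φ p x| ≤ p * M := by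
  refine (Finset.abs_sum_le_sum_abs _ _).trans ?_
  refine (Finset.sum_le_sum fun t _ => hM _).trans (by simp)

/-- The coupling error is at most `2pM` pointwise and `O(1)` in `L²`, so its fourth moment has the
admissible order `p²`. -/
lemma ShortRange.integral_blockSum_sub_pow_four_le (h : ShortRange μ φ D)
    (hM : ∀ x, |φ x| ≤ M) (p : ℕ) (a : ℤ) {s s' : ℤ → ℕ}
    (hs : ∀ i, a < i → i ≤ a + p → s i = s' i) :
    ∫ ω, (blockSum φ p (select s a ω) - blockSum φ p (select s' a ω)) ^ 4 ∂(copiesLaw μ) ≤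
      (2 * (p * M)) ^ 2 * (2 * D * zetaTwo) ^ 2 := by
  have hm := measurable_blockSum h.measurable p
  have hS : ∀ ω, |blockSum φ p (select s a ω) - blockSum φ p (select s' a ω)| ≤ 2 * (p * M) :=
    fun ω => (abs_sub _ _).trans (by
      linarith [abs_blockSum_le hM p (select s a ω), abs_blockSum_le hM p (select s' a ω)])
  have hmem : MemLp (fun ω => blockSum φ p (select s a ω) - blockSum φ p (select s' a ω)) 2
      (copiesLaw μ) :=
    MemLp.of_bound (Measurable.aestronglyMeasurable (by fun_prop)) _ (ae_of_all _ hS)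
  have h2 := (eLpNorm_two_le_ofReal_iff hmem
    (by have := h.nonneg; have := zetaTwo_nonneg; positivity)).1 (h.eLpNorm_blockSum_sub_le p a hs)
  calc _ ≤ ∫ ω, (2 * (p * M)) ^ 2 *
        (blockSum φ p (select s a ω) - blockSum φ p (select s' a ω)) ^ 2 ∂(copiesLaw μ) := by
        refine integral_mono_of_nonneg (ae_of_all _ fun ω => by positivity)
          (hmem.integrable_sq.const_mul _) (ae_of_all _ fun ω => ?_)
        have := sq_le_sq' (abs_le.1 (hS ω)).1 (abs_le.1 (hS ω)).2
        simp only
        nlinarith [sq_nonneg (blockSum φ p (select s a ω) - blockSum φ p (select s' a ω))]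
    _ ≤ _ := by
        rw [integral_const_mul]
        gcongr

/-- Doubling: two adjacent sums of length `p` are replaced by independent ones, which gives `m (2p +
r) ≤ 2.662 m p + K p² + L`. Since `2.662 < 2²`, the order `p²` reproduces itself. -/
lemma ShortRange.exists_integral_blockSum_pow_four_le (h : ShortRange μ φ D)
    (h0 : ∫ x, φ x ∂(noiseLaw μ) = 0) (hM : ∀ x, |φ x| ≤ M) :
    ∃ C : ℝ, ∀ p : ℕ, ∫ x, blockSum φ p x ^ 4 ∂(noiseLaw μ) ≤ C * (p : ℝ) ^ 2 := by
  have hM0 : 0 ≤ M := (abs_nonneg _).trans (hM 0)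
  have hm := fun p => measurable_blockSum h.measurable p
  obtain ⟨w, hw⟩ : ∃ w : ℝ, ∀ p : ℕ, ∫ x, blockSum φ p x ^ 2 ∂(noiseLaw μ) ≤ p * w :=
    ⟨_, h.integral_blockSum_sq_le h0 ENNReal.toReal_nonneg (ENNReal.ofReal_toReal h.memLp.2.ne).ge⟩
  set m : ℕ → ℝ := fun p => ∫ x, blockSum φ p x ^ 4 ∂(noiseLaw μ) with hmdef
  set K := 1331 / 1000 * (6 * w ^ 2) + 1331 * 27 * (2 * (4 * M ^ 2 * (2 * D * zetaTwo) ^ 2)) with hK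
  set L := 1331 * 27 * M ^ 4 with hL
  have hK0 : 0 ≤ K := by positivity
  have hL0 : 0 ≤ L := by positivity
  have key : ∀ p r : ℕ, r ≤ 1 → m (2 * p + r) ≤ 1331 / 500 * m p + K * p ^ 2 + L := by
    intro p r hr
    set s₁ : ℤ → ℕ := fun i => if i ≤ p then 0 else 1 with hs₁
    set s₂ : ℤ → ℕ := fun i => if i ≤ p then 1 else 0 with hs₂
    set s₀ : ℤ → ℕ := fun _ => 0
    set A : (ℕ × ℤ → ℝ) → ℝ := fun ω => blockSum φ p (select s₁ 0 ω) with hA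
    set B : (ℕ × ℤ → ℝ) → ℝ := fun ω => blockSum φ p (select s₂ p ω) with hB
    set R₁ : (ℕ × ℤ → ℝ) → ℝ := fun ω => blockSum φ p (select s₀ 0 ω) - A ω with hR₁
    set R₂ : (ℕ × ℤ → ℝ) → ℝ := fun ω => blockSum φ p (select s₀ p ω) - B ω with hR₂
    set R₃ : (ℕ × ℤ → ℝ) → ℝ := fun ω => blockSum φ r (select s₀ (2 * p : ℕ) ω) with hR₃
    have hAm : Measurable A := by have := hm p; fun_prop
    have hBm : Measurable B := by have := hm p; fun_prop
    have hR₁m : Measurable R₁ := by have := hm p; fun_prop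
    have hR₂m : Measurable R₂ := by have := hm p; fun_prop
    have hR₃m : Measurable R₃ := by have := hm r; fun_prop
    have hAb : ∀ ω, |A ω| ≤ p * M := fun ω => abs_blockSum_le hM p _
    have hBb : ∀ ω, |B ω| ≤ p * M := fun ω => abs_blockSum_le hM p _
    have hR₁b : ∀ ω, |R₁ ω| ≤ p * M + p * M := fun ω =>
      (abs_sub _ _).trans (add_le_add (abs_blockSum_le hM p _) (hAb ω))
    have hR₂b : ∀ ω, |R₂ ω| ≤ p * M + p * M := fun ω =>
      (abs_sub _ _).trans (add_le_add (abs_blockSum_le hM p _) (hBb ω))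
    have hR₃b : ∀ ω, |R₃ ω| ≤ M := fun ω => (abs_blockSum_le hM r _).trans (by
      have : (r : ℝ) ≤ 1 := by exact_mod_cast hr
      nlinarith)
    have hint4 : ∀ {G : (ℕ × ℤ → ℝ) → ℝ} {N : ℝ}, Measurable G → (∀ ω, |G ω| ≤ N) →
        Integrable (fun ω => G ω ^ 4) (copiesLaw μ) := fun {G N} hG hN =>
      Integrable.of_bound (hG.pow_const 4).aestronglyMeasurable (N ^ 4) (ae_of_all _ fun ω => by
        rw [Real.norm_eq_abs, abs_pow]; gcongr; exact hN ω)
    have hlaw : ∀ s a (k : ℕ), ∫ ω, blockSum φ p (select s a ω) ^ k ∂(copiesLaw μ) =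
        ∫ x, blockSum φ p x ^ k ∂(noiseLaw μ) := fun s a k =>
      integral_comp_of_measurePreserving (measurePreserving_select s a)
        (g := fun x => blockSum φ p x ^ k) ((hm p).pow_const k).aestronglyMeasurable
    have hind : IndepFun A B (copiesLaw μ) := (indepFun_select (μ := μ) (s := s₁) (s' := s₂) 0 p
      (fun i => by by_cases hi : i ≤ p <;> simp [hs₁, hs₂, hi])).comp (hm p) (hm p)
    have hAB := integral_add_pow_four_le hAm hBm hAb hBb hind
      (by simpa [h.integral_blockSum h0] using hlaw s₁ 0 1)
      (by simpa [h.integral_blockSum h0] using hlaw s₂ p 1)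
      ((hlaw s₁ 0 2).le.trans (hw p)) ((hlaw s₂ p 2).le.trans (hw p))
      (hlaw s₁ 0 4).le (hlaw s₂ p 4).le
    have hB1 : ∫ ω, R₁ ω ^ 4 ∂(copiesLaw μ) ≤ (2 * (p * M)) ^ 2 * (2 * D * zetaTwo) ^ 2 :=
      h.integral_blockSum_sub_pow_four_le hM p 0 (fun i hi hi' => by
        have : i ≤ p := by simpa using hi'
        simp [s₀, hs₁, this])
    have hB2 : ∫ ω, R₂ ω ^ 4 ∂(copiesLaw μ) ≤ (2 * (p * M)) ^ 2 * (2 * D * zetaTwo) ^ 2 :=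
      h.integral_blockSum_sub_pow_four_le hM p p (fun i hi hi' => by
        have : ¬ i ≤ p := by simpa using hi
        simp [s₀, hs₂, this])
    have hB3 : ∫ ω, R₃ ω ^ 4 ∂(copiesLaw μ) ≤ M ^ 4 := by
      refine (integral_mono (hint4 hR₃m hR₃b) (integrable_const (M ^ 4)) fun ω => ?_).trans (by simp)
      simp only
      rw [← (show Even 4 by decide).pow_abs]
      gcongr; exact hR₃b ω
    have hI : m (2 * p + r) = ∫ ω, ((A ω + B ω) + (R₁ ω + R₂ ω + R₃ ω)) ^ 4 ∂(copiesLaw μ) := by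
      change ∫ x, blockSum φ (2 * p + r) x ^ 4 ∂(noiseLaw μ) = _
      rw [← integral_comp_of_measurePreserving (measurePreserving_select s₀ 0)
        (g := fun x => blockSum φ (2 * p + r) x ^ 4) ((hm _).pow_const 4).aestronglyMeasurable]
      congr 1
      ext ω
      rw [blockSum_two_mul_add, shift_select, shift_select]
      simp only [hR₁, hR₂, hR₃, zero_add]
      ring
    rw [hI]
    have i1 := hint4 (hAm.add hBm) (fun ω => (abs_add_le _ _).trans (add_le_add (hAb ω) (hBb ω)))
    have i2 := (hint4 hR₁m hR₁b).add (hint4 hR₂m hR₂b)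
    have i3 := hint4 hR₃m hR₃b
    calc _ ≤ ∫ ω, (1331 / 1000 * (A ω + B ω) ^ 4 +
          1331 * (27 * (R₁ ω ^ 4 + R₂ ω ^ 4 + R₃ ω ^ 4))) ∂(copiesLaw μ) := by
          refine integral_mono_of_nonneg (ae_of_all _ fun ω => by positivity) ?_
            (ae_of_all _ fun ω => ?_)
          · exact (i1.const_mul _).add (((i2.add i3).const_mul 27).const_mul 1331)
          · have := add_add_pow_four_le (R₁ ω) (R₂ ω) (R₃ ω)
            refine (add_pow_four_le _ _).trans ?_
            simp only
            linarith
      _ = 1331 / 1000 * (∫ ω, (A ω + B ω) ^ 4 ∂(copiesLaw μ)) +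
          1331 * (27 * ((∫ ω, R₁ ω ^ 4 ∂(copiesLaw μ)) + (∫ ω, R₂ ω ^ 4 ∂(copiesLaw μ)) +
            ∫ ω, R₃ ω ^ 4 ∂(copiesLaw μ))) := by
          rw [integral_add (by exact i1.const_mul _)
            (by exact ((i2.add i3).const_mul 27).const_mul 1331), integral_const_mul,
            integral_const_mul, integral_const_mul, integral_add (by exact i2) i3,
            integral_add (hint4 hR₁m hR₁b) (hint4 hR₂m hR₂b)]
      _ ≤ 1331 / 1000 * (2 * m p + 6 * (p * w) ^ 2) +
          1331 * (27 * ((2 * (p * M)) ^ 2 * (2 * D * zetaTwo) ^ 2 +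
            (2 * (p * M)) ^ 2 * (2 * D * zetaTwo) ^ 2 + M ^ 4)) := by
          have hAB' : ∫ ω, (A ω + B ω) ^ 4 ∂(copiesLaw μ) ≤ 2 * m p + 6 * (p * w) ^ 2 := hAB
          linarith
      _ = _ := by rw [hK, hL]; ring
  -- For `p ≥ 1` the induction closes because `2.662 (K + L) p² + K p² + L ≤ 4 (K + L) p²`; for `p =
  -- 0` only `L` remains.
  refine ⟨K + L, fun n => ?_⟩
  induction n using Nat.strong_induction_on with
  | _ n ih =>
    rcases Nat.eq_zero_or_pos n with rfl | hn
    · simp [blockSum]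
    · obtain ⟨p, r, hr, rfl⟩ : ∃ p r, r ≤ 1 ∧ n = 2 * p + r :=
        ⟨n / 2, n % 2, by lia, by lia⟩
      refine (key p r hr).trans ?_
      have h1 := ih p (by lia)
      rcases Nat.eq_zero_or_pos p with rfl | hp
      · have : r = 1 := by lia
        subst this
        simp only [hmdef, blockSum]
        norm_num
        exact hK0
      · have hp1 : (1 : ℝ) ≤ (p : ℝ) ^ 2 := by
          have : (1 : ℝ) ≤ p := by exact_mod_cast hp
          nlinarith
        have h2 : 4 * (p : ℝ) ^ 2 ≤ ((2 * p + r : ℕ) : ℝ) ^ 2 := by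
          push_cast
          have : (0 : ℝ) ≤ r := by positivity
          nlinarith [mul_nonneg this (Nat.cast_nonneg (α := ℝ) p)]
        have h3 : m p ≤ (K + L) * (p : ℝ) ^ 2 := h1
        nlinarith [mul_le_mul_of_nonneg_left h2 (add_nonneg hK0 hL0),
          mul_le_mul_of_nonneg_left hp1 hL0, mul_nonneg hK0 (sq_nonneg (p : ℝ))]

end FourthMoments

/-! ### Uniform integrability of squared normalised sums -/

section UniformIntegrability

variable {μ : Measure ℝ} [IsProbabilityMeasure μ] {φ : (ℤ → ℝ) → ℝ} {D : ℝ}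

/-- The truncation of `x` to the interval `[-M, M]`. -/
noncomputable def truncate (M x : ℝ) : ℝ := max (-M) (min x M)

lemma abs_truncate_sub_le (M x y : ℝ) : |truncate M x - truncate M y| ≤ |x - y| := by
  unfold truncate
  refine (abs_max_sub_max_le_max _ _ _ _).trans (max_le (by simp) ?_)
  exact (abs_min_sub_min_le_max _ _ _ _).trans (by simp)

lemma abs_sub_truncate_sub_le {M : ℝ} (hM : 0 ≤ M) (x y : ℝ) :
    |(x - truncate M x) - (y - truncate M y)| ≤ |x - y| := by
  unfold truncate
  grind

lemma abs_truncate_le {M : ℝ} (hM : 0 ≤ M) (x : ℝ) : |truncate M x| ≤ M := by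
  unfold truncate
  grind

lemma abs_sub_truncate {M : ℝ} (hM : 0 ≤ M) (x : ℝ) : |x - truncate M x| = excess M x := by
  unfold truncate excess
  grind

lemma tendsto_eLpNorm_excess {α : Type*} [MeasurableSpace α] {ν : Measure α} {f : α → ℝ}
    (hf : MemLp f 2 ν) : Tendsto (fun n : ℕ => eLpNorm (fun x => excess n (f x)) 2 ν) atTop (𝓝 0) := by
  have hmem : ∀ n : ℕ, MemLp (fun x => excess n (f x)) 2 ν := fun n =>
    hf.mono ((measurable_excess _).comp_aemeasurable hf.1.aemeasurable).aestronglyMeasurable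
      (ae_of_all _ fun x => by
        rw [Real.norm_of_nonneg (excess_nonneg _ _)]
        exact excess_le_abs (Nat.cast_nonneg n) _)
  have h1 : Tendsto (fun n : ℕ => ∫ x, excess n (f x) ^ 2 ∂ν) atTop (𝓝 (∫ _, (0 : ℝ) ∂ν)) := by
    refine tendsto_integral_of_dominated_convergence (fun x => f x ^ 2)
      (fun n => (hmem n).integrable_sq.1) hf.integrable_sq (fun n => ae_of_all _ fun x => ?_)
      (ae_of_all _ fun x => ?_)
    · rw [Real.norm_of_nonneg (sq_nonneg _), ← sq_abs (f x)]
      exact pow_le_pow_left₀ (excess_nonneg _ _) (excess_le_abs (Nat.cast_nonneg n) _) 2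
    · refine tendsto_const_nhds.congr' ?_
      filter_upwards [eventually_ge_atTop ⌈|f x|⌉₊] with n hn
      have : |f x| ≤ n := (Nat.le_ceil _).trans (by exact_mod_cast hn)
      simp [excess, this]
  rw [ENNReal.tendsto_atTop_zero]
  intro ε hε
  rcases eq_or_ne ε ∞ with rfl | hε'
  · exact ⟨0, fun _ _ => le_top⟩
  have hε2 : 0 < ε.toReal := ENNReal.toReal_pos hε.ne' hε'
  rw [integral_zero] at h1
  obtain ⟨n₀, hn₀⟩ := eventually_atTop.1 (h1.eventually_le_const (pow_pos hε2 2))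
  refine ⟨n₀, fun n hn => ?_⟩
  rw [← ENNReal.ofReal_toReal hε', eLpNorm_two_le_ofReal_iff (hmem n) hε2.le]
  exact hn₀ n hn

/-- The normalised block sum. -/
noncomputable def normSum (φ : (ℤ → ℝ) → ℝ) (p : ℕ) (x : ℤ → ℝ) : ℝ := (√(p : ℝ))⁻¹ * blockSum φ p x

lemma measurable_normSum (hφ : Measurable φ) (p : ℕ) : Measurable (normSum φ p) :=
  (measurable_blockSum hφ p).const_mul _

lemma ShortRange.memLp_normSum (h : ShortRange μ φ D) (p : ℕ) : MemLp (normSum φ p) 2 (noiseLaw μ) :=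
  (h.memLp_blockSum p).const_mul _

lemma ShortRange.eLpNorm_normSum_le (h : ShortRange μ φ D) (h0 : ∫ x, φ x ∂(noiseLaw μ) = 0)
    {τ ε : ℝ} (hτ0 : 0 ≤ τ) (hτ : eLpNorm φ 2 (noiseLaw μ) ≤ ENNReal.ofReal τ) (hε : 0 ≤ ε)
    (hτε : τ ^ 2 + 8 * τ * D * zetaTwo ≤ ε ^ 2) (p : ℕ) :
    eLpNorm (normSum φ p) 2 (noiseLaw μ) ≤ ENNReal.ofReal ε := by
  rw [eLpNorm_two_le_ofReal_iff (h.memLp_normSum p) hε]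
  refine le_trans ?_ hτε
  simp_rw [normSum, mul_pow, inv_pow, Real.sq_sqrt (Nat.cast_nonneg p)]
  rw [integral_const_mul]
  have := h.integral_blockSum_sq_le h0 hτ0 hτ p
  rcases Nat.eq_zero_or_pos p with rfl | hp
  · simp
    have := h.nonneg
    have := zetaTwo_nonneg
    positivity
  · rw [inv_mul_le_iff₀ (by positivity)]
    exact this

/-- The truncated functional has normalised sums with bounded fourth moments. The remainder has
small norm and the same `D`, so its normalised sums are small in `L²` uniformly in `p`. -/
theorem ShortRange.sqUnifIntegrable_normSum (h : ShortRange μ φ D)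
    (h0 : ∫ x, φ x ∂(noiseLaw μ) = 0) : SqUnifIntegrable (normSum φ) (noiseLaw μ) := by
  have hφ := h.measurable
  refine SqUnifIntegrable.of_approx (fun p => (measurable_normSum hφ p).aestronglyMeasurable)
    fun ε hε => ?_
  -- Centring can double the norm of the remainder, whence `2 * τ` in the variance bound.
  obtain ⟨τ, hτ0, hτε⟩ : ∃ τ : ℝ, 0 < τ ∧ (2 * τ) ^ 2 + 8 * (2 * τ) * D * zetaTwo ≤ ε ^ 2 := by
    have hc : Tendsto (fun τ : ℝ => (2 * τ) ^ 2 + 8 * (2 * τ) * D * zetaTwo) (𝓝[>] 0) (𝓝 0) := by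
      have : Continuous fun τ : ℝ => (2 * τ) ^ 2 + 8 * (2 * τ) * D * zetaTwo := by fun_prop
      simpa using (this.tendsto 0).mono_left nhdsWithin_le_nhds
    obtain ⟨τ, h1, h2⟩ := ((hc.eventually_le_const (pow_pos hε 2)).and self_mem_nhdsWithin).exists
    exact ⟨τ, h2, h1⟩
  obtain ⟨N, hN⟩ := ((tendsto_eLpNorm_excess h.memLp).eventually_le_const
    (ENNReal.ofReal_pos.2 hτ0)).exists
  have hN0 : (0 : ℝ) ≤ N := Nat.cast_nonneg N
  -- As `φ` is centred, the remainder has mean `-e`; hence `φ = ψ + ρ` with both parts centred.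
  set e := ∫ x, truncate N (φ x) ∂(noiseLaw μ) with he
  set ψ : (ℤ → ℝ) → ℝ := fun x => truncate N (φ x) - e with hψ
  set ρ : (ℤ → ℝ) → ℝ := fun x => (φ x - truncate N (φ x)) - (-e) with hρ
  have hT := h.comp (abs_truncate_sub_le N)
  have hψs : ShortRange μ ψ D := hT.sub_const e
  have hE := h.comp (τ := fun y => y - truncate N y) (abs_sub_truncate_sub_le hN0)
  have hρs : ShortRange μ ρ D := hE.sub_const (-e)
  have hTi : Integrable (fun x => truncate N (φ x)) (noiseLaw μ) := hT.memLp.integrable (by norm_num)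
  have hψ0 : ∫ x, ψ x ∂(noiseLaw μ) = 0 := by
    simp only [hψ]
    rw [integral_sub hTi (integrable_const _)]
    simp [he]
  have hEint : ∫ x, (φ x - truncate N (φ x)) ∂(noiseLaw μ) = -e := by
    rw [integral_sub (h.memLp.integrable (by norm_num)) hTi, h0, zero_sub]
  have hρ0 : ∫ x, ρ x ∂(noiseLaw μ) = 0 := by
    simp only [hρ]
    rw [integral_sub (hE.memLp.integrable (by norm_num)) (integrable_const _), hEint]
    simp
  have hEn : eLpNorm (fun x => φ x - truncate N (φ x)) 2 (noiseLaw μ) ≤ ENNReal.ofReal τ := by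
    refine le_trans (eLpNorm_mono fun x => ?_) hN
    rw [Real.norm_of_nonneg (excess_nonneg _ _), Real.norm_eq_abs, abs_sub_truncate hN0]
  have hEe : |e| ≤ τ := by
    have := integral_abs_le hE.memLp.1 hτ0.le hEn
    calc |e| = |∫ x, (φ x - truncate N (φ x)) ∂(noiseLaw μ)| := by rw [hEint, abs_neg]
      _ ≤ _ := (abs_integral_le_integral_abs).trans this
  have hρn : eLpNorm ρ 2 (noiseLaw μ) ≤ ENNReal.ofReal (2 * τ) := by
    have : ρ = (fun x => φ x - truncate N (φ x)) + fun _ => e := by ext x; simp [hρ]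
    rw [this, two_mul, ENNReal.ofReal_add hτ0.le hτ0.le]
    refine (eLpNorm_add_le hE.memLp.1 (by fun_prop) (by norm_num)).trans (add_le_add hEn ?_)
    rw [eLpNorm_const _ (by simp) (NeZero.ne _), ← ofReal_norm, Real.norm_eq_abs]
    simpa using ENNReal.ofReal_le_ofReal hEe
  have hψM : ∀ x, |ψ x| ≤ N + |e| := fun x =>
    (abs_sub _ _).trans (by linarith [abs_truncate_le hN0 (φ x)])
  obtain ⟨C, hC⟩ := hψs.exists_integral_blockSum_pow_four_le hψ0 hψM
  have hψm := hψs.measurable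
  refine ⟨C, normSum ψ, fun p => (measurable_normSum hψm p).aestronglyMeasurable, fun p => ?_,
    fun p => ?_, fun p => ?_⟩
  · refine Integrable.of_bound ((measurable_normSum hψm p).pow_const 4).aestronglyMeasurable
      (((√(p : ℝ))⁻¹ * (p * (N + |e|))) ^ 4) (ae_of_all _ fun x => ?_)
    rw [Real.norm_eq_abs, abs_pow, normSum, abs_mul, abs_of_nonneg (a := (√(p : ℝ))⁻¹) (by positivity)]
    gcongr
    exact abs_blockSum_le hψM p x
  · simp_rw [normSum, mul_pow]
    rw [integral_const_mul]
    rcases Nat.eq_zero_or_pos p with rfl | hp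
    · have h1 := hC 1
      have : 0 ≤ ∫ x, blockSum ψ 1 x ^ 4 ∂(noiseLaw μ) := integral_nonneg fun x => by positivity
      simp at h1 ⊢
      exact this.trans h1
    · have hp' : (0 : ℝ) < p := by exact_mod_cast hp
      have : (√(p : ℝ))⁻¹ ^ 4 = ((p : ℝ) ^ 2)⁻¹ := by
        rw [inv_pow]; congr 1
        calc √(p : ℝ) ^ 4 = (√(p : ℝ) ^ 2) ^ 2 := by ring
          _ = _ := by rw [Real.sq_sqrt hp'.le]
      rw [this, inv_mul_le_iff₀ (by positivity), mul_comm]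
      exact hC p
  · have : (fun x => normSum φ p x - normSum ψ p x) = normSum ρ p := by
      ext x
      simp only [normSum, blockSum, ← mul_sub, ← Finset.sum_sub_distrib]
      congr 1
      refine Finset.sum_congr rfl fun t _ => ?_
      simp only [hψ, hρ]; ring
    rw [this]
    exact hρs.eLpNorm_normSum_le hρ0 (by positivity) hρn hε.le hτε p

end UniformIntegrability

/-! ### Transfer of convergence between probability spaces -/

section Transfer

/-- Convergence in distribution depends on the laws alone, so it may be proved on the space of
copies, where the couplings live. -/
lemma tendstoInDistribution_comp_iff {α β γ : Type*} [MeasurableSpace α] [MeasurableSpace β]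
    [MeasurableSpace γ] {Q : Measure α} {ν : Measure β} {ρ : Measure γ} [IsProbabilityMeasure Q]
    [IsProbabilityMeasure ν] [IsProbabilityMeasure ρ] {T : α → β} (hT : MeasurePreserving T Q ν)
    {F : ℕ → β → ℝ} (hF : ∀ n, Measurable (F n)) {Z : γ → ℝ} :
    TendstoInDistribution (fun n x => F n (T x)) atTop Z (fun _ => Q) ρ ↔
      TendstoInDistribution F atTop Z (fun _ => ν) ρ := by
  have hmap : ∀ n, Q.map (fun x => F n (T x)) = ν.map (F n) := fun n => by
    rw [← hT.map_eq, Measure.map_map (hF n) hT.measurable]; rfl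
  constructor
  · intro h
    refine ⟨fun n => (hF n).aemeasurable, h.aemeasurable_limit, ?_⟩
    have := h.tendsto
    simp only [hmap] at this
    exact this
  · intro h
    refine ⟨fun n => ((hF n).comp hT.measurable).aemeasurable, h.aemeasurable_limit, ?_⟩
    have := h.tendsto
    simp only [← hmap] at this
    exact this

lemma tendstoInMeasure_zero_of_eLpNorm_le {α : Type*} [MeasurableSpace α] {Q : Measure α}
    {f : ℕ → α → ℝ} {p : ℝ≥0∞} (hp : p ≠ 0) (hf : ∀ n, AEStronglyMeasurable (f n) Q) {u : ℕ → ℝ}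
    (hu : Tendsto u atTop (𝓝 0)) (h : ∀ᶠ n in atTop, eLpNorm (f n) p Q ≤ ENNReal.ofReal (u n)) :
    TendstoInMeasure Q f atTop 0 := by
  refine tendstoInMeasure_of_tendsto_eLpNorm hp hf aestronglyMeasurable_zero ?_
  have hu' : Tendsto (fun n => ENNReal.ofReal (u n)) atTop (𝓝 0) := by
    simpa using ENNReal.tendsto_ofReal hu
  refine tendsto_of_tendsto_of_tendsto_of_le_of_le' tendsto_const_nhds hu'
    (Eventually.of_forall fun _ => zero_le) ?_
  filter_upwards [h] with n hn
  simpa using hn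

end Transfer

/-! ### Blocks with separate outside noise -/

section Blocks

/-- The time before the `j`-th block of length `p`. -/
def blockStart (p j : ℕ) : ℤ := ((j : ℤ) - 1) * p

/-- The noise with the copy number `0` inside the `j`-th block of length `p` and with the copy
number `j + 1` outside of it. -/
def blockCopy (p j : ℕ) (i : ℤ) : ℕ :=
  if blockStart p j < i ∧ i ≤ blockStart p j + p then 0 else j + 1

lemma blockCopy_of_mem {p j : ℕ} {i : ℤ} (h : blockStart p j < i) (h' : i ≤ blockStart p j + p) :
    blockCopy p j i = 0 := if_pos ⟨h, h'⟩

/-- The blocks are disjoint, so at a given time at most one of them reads copy `0`; the others read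
the distinct copies `j + 1`. -/
lemma blockCopy_injective (p : ℕ) (i : ℤ) : Function.Injective fun j => blockCopy p j i := by
  have key : ∀ j k : ℕ, j < k → blockCopy p j i ≠ blockCopy p k i := by
    intro j k hjk
    unfold blockCopy blockStart
    split_ifs with h1 h2 h2
    · exfalso
      have : (j : ℤ) ≤ (k : ℤ) - 1 := by lia
      have := mul_le_mul_of_nonneg_right this (Int.natCast_nonneg p)
      linarith [h1.2, h2.1]
    · lia
    · lia
    · lia
  intro j k hjk
  rcases lt_trichotomy j k with h | h | h
  · exact absurd hjk (key j k h)
  · exact h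
  · exact absurd hjk.symm (key k j h)

lemma iIndepFun_blockCopy {μ : Measure ℝ} [IsProbabilityMeasure μ] (p : ℕ) :
    iIndepFun (fun j => select (blockCopy p j) (blockStart p j)) (copiesLaw μ) :=
  iIndepFun_select _ _ (blockCopy_injective p)

lemma blockSum_add (φ : (ℤ → ℝ) → ℝ) (p r : ℕ) (x : ℤ → ℝ) :
    blockSum φ (p + r) x = blockSum φ p x + blockSum φ r (shift p x) := by
  simp only [blockSum, shift_shift, Finset.sum_range_add]
  push_cast
  simp only [add_assoc]

lemma blockSum_mul (φ : (ℤ → ℝ) → ℝ) (p q : ℕ) (x : ℤ → ℝ) :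
    blockSum φ (q * p) x = ∑ j ∈ Finset.Icc 1 q, blockSum φ p (shift (blockStart p j) x) := by
  induction q with
  | zero => simp [blockSum]
  | succ q ih =>
    rw [Finset.sum_Icc_succ_top (by lia), ← ih, add_mul, one_mul, blockSum_add]
    simp [blockStart]

end Blocks

/-! ### Central limit theorem for one long block -/

section SingleBlockCLT

variable {μ : Measure ℝ} [IsProbabilityMeasure μ] {φ : (ℤ → ℝ) → ℝ} {D : ℝ}

/-- The number of blocks into which `n` observations are divided. -/
def numBlocks (n : ℕ) : ℕ := n.sqrt.sqrt

lemma numBlocks_pow_four_le (n : ℕ) : numBlocks n ^ 4 ≤ n := by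
  have h1 : numBlocks n * numBlocks n ≤ n.sqrt := Nat.sqrt_le _
  have h2 : n.sqrt * n.sqrt ≤ n := Nat.sqrt_le _
  calc numBlocks n ^ 4 = (numBlocks n * numBlocks n) * (numBlocks n * numBlocks n) := by ring
    _ ≤ n.sqrt * n.sqrt := Nat.mul_le_mul h1 h1
    _ ≤ n := h2

lemma tendsto_numBlocks : Tendsto numBlocks atTop atTop := by
  refine tendsto_atTop.2 fun k => ?_
  filter_upwards [eventually_ge_atTop ((k * k) * (k * k))] with n hn
  exact Nat.le_sqrt.2 (Nat.le_sqrt.2 hn)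

lemma tendsto_div_numBlocks : Tendsto (fun n => n / numBlocks n) atTop atTop := by
  refine tendsto_atTop_mono' _ ?_ tendsto_numBlocks
  filter_upwards [tendsto_numBlocks.eventually_ge_atTop 1] with n hn
  rw [Nat.le_div_iff_mul_le hn]
  calc numBlocks n * numBlocks n = numBlocks n ^ 2 := (sq _).symm
    _ ≤ numBlocks n ^ 4 := Nat.pow_le_pow_right hn (by norm_num)
    _ ≤ n := numBlocks_pow_four_le n

/-- An error `O(1)` per piece adds up to `O(numBlocks n / √n)`, which is negligible because
`numBlocks n` is about `n^(1/4)`. -/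
lemma inv_sqrt_mul_numBlocks_le {n : ℕ} (hn : 1 ≤ numBlocks n) :
    (√(n : ℝ))⁻¹ * numBlocks n ≤ (numBlocks n : ℝ)⁻¹ := by
  have hq : (0 : ℝ) < numBlocks n := by exact_mod_cast hn
  have h4 : (numBlocks n : ℝ) ^ 4 ≤ n := by exact_mod_cast numBlocks_pow_four_le n
  have h2 : (numBlocks n : ℝ) ^ 2 ≤ √(n : ℝ) :=
    Real.le_sqrt_of_sq_le (by rw [← pow_mul]; exact h4)
  have hs : 0 < √(n : ℝ) := lt_of_lt_of_le (by positivity) h2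
  rw [inv_mul_le_iff₀ hs, ← div_eq_mul_inv, le_div_iff₀ hq]
  nlinarith

lemma tendsto_inv_numBlocks : Tendsto (fun n => (numBlocks n : ℝ)⁻¹) atTop (𝓝 0) :=
  tendsto_inv_atTop_zero.comp (tendsto_natCast_atTop_atTop.comp tendsto_numBlocks)

lemma tendsto_numBlocks_mul_div :
    Tendsto (fun n : ℕ => (numBlocks n : ℝ) / n * ((n / numBlocks n : ℕ) : ℝ)) atTop (𝓝 1) := by
  have hle : ∀ᶠ n in atTop, 1 - (numBlocks n : ℝ)⁻¹ ≤
      (numBlocks n : ℝ) / n * ((n / numBlocks n : ℕ) : ℝ) ∧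
      (numBlocks n : ℝ) / n * ((n / numBlocks n : ℕ) : ℝ) ≤ 1 := by
    filter_upwards [tendsto_numBlocks.eventually_ge_atTop 1, eventually_ge_atTop 1] with n hn hn1
    have hq : (0 : ℝ) < numBlocks n := by exact_mod_cast hn
    have hn0 : (0 : ℝ) < n := by exact_mod_cast hn1
    have hdm : (numBlocks n : ℝ) * ((n / numBlocks n : ℕ) : ℝ) + ((n % numBlocks n : ℕ) : ℝ) = n := by
      exact_mod_cast Nat.div_add_mod n (numBlocks n)
    have hr : ((n % numBlocks n : ℕ) : ℝ) ≤ numBlocks n := by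
      exact_mod_cast (Nat.mod_lt n hn).le
    have h2 : (numBlocks n : ℝ) ^ 2 ≤ n := by
      exact_mod_cast (Nat.pow_le_pow_right hn (by norm_num : 2 ≤ 4)).trans (numBlocks_pow_four_le n)
    rw [div_mul_eq_mul_div, le_div_iff₀ hn0, div_le_one hn0]
    constructor
    · have : (numBlocks n : ℝ) ≤ (numBlocks n : ℝ)⁻¹ * n := by
        rw [← div_eq_inv_mul, le_div_iff₀ hq]; nlinarith
      nlinarith
    · have : (0 : ℝ) ≤ ((n % numBlocks n : ℕ) : ℝ) := by positivity
      linarith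
  refine tendsto_of_tendsto_of_tendsto_of_le_of_le' (by simpa using tendsto_inv_numBlocks.const_sub 1)
    tendsto_const_nhds (hle.mono fun n h => h.1) (hle.mono fun n h => h.2)

lemma ShortRange.eLpNorm_blockSum_le (h : ShortRange μ φ D) (p : ℕ) :
    eLpNorm (blockSum φ p) 2 (noiseLaw μ) ≤
      ENNReal.ofReal (p * (eLpNorm φ 2 (noiseLaw μ)).toReal) := by
  have hφ := h.measurable
  have h1 : blockSum φ p = ∑ t ∈ Finset.range p, fun x => φ (shift ((t : ℤ) + 1) x) := by
    ext x; simp [blockSum]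
  rw [h1]
  refine (eLpNorm_sum_le (fun t _ => Measurable.aestronglyMeasurable (by fun_prop))
    (by norm_num)).trans ?_
  have h2 : ∀ t : ℤ, eLpNorm (fun x => φ (shift t x)) 2 (noiseLaw μ) = eLpNorm φ 2 (noiseLaw μ) :=
    fun t => eLpNorm_comp_measurePreserving h.memLp.1 (measurePreserving_shift t)
  simp_rw [h2]
  rw [Finset.sum_const, Finset.card_range, ENNReal.ofReal_mul (by positivity),
    ENNReal.ofReal_toReal h.memLp.2.ne]
  simp

/-- Each of the `q` pieces has coupling error at most `2 * D * zetaTwo`, and fewer than `q` times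
are left over, each contributing the norm of `φ`. -/
lemma ShortRange.eLpNorm_normSum_sub_blocks_le (h : ShortRange μ φ D) {n : ℕ}
    (hn : 1 ≤ numBlocks n) :
    eLpNorm (fun ω => normSum φ n (select (fun _ => 0) 0 ω) -
      (√(n : ℝ))⁻¹ * ∑ j ∈ Finset.Icc 1 (numBlocks n), blockSum φ (n / numBlocks n)
        (select (blockCopy (n / numBlocks n) j) (blockStart (n / numBlocks n) j) ω)) 2
      (copiesLaw μ) ≤ ENNReal.ofReal ((numBlocks n : ℝ)⁻¹ *
        (2 * D * zetaTwo + (eLpNorm φ 2 (noiseLaw μ)).toReal)) := by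
  have hS := fun p => measurable_blockSum h.measurable p
  have hD := h.nonneg
  have hζ := zetaTwo_nonneg
  have hle := inv_sqrt_mul_numBlocks_le hn
  have hn' : n = numBlocks n * (n / numBlocks n) + n % numBlocks n :=
    (Nat.div_add_mod n (numBlocks n)).symm
  have hmod : ((n % numBlocks n : ℕ) : ℝ) ≤ numBlocks n := by exact_mod_cast (Nat.mod_lt n hn).le
  generalize n / numBlocks n = p at *
  generalize n % numBlocks n = r at *
  generalize numBlocks n = q at *
  set τ := (eLpNorm φ 2 (noiseLaw μ)).toReal with hτ
  have hτ0 : 0 ≤ τ := ENNReal.toReal_nonneg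
  set B : ℕ → (ℕ × ℤ → ℝ) → ℝ := fun j ω => blockSum φ p (select (fun _ => 0) (blockStart p j) ω) -
    blockSum φ p (select (blockCopy p j) (blockStart p j) ω) with hB
  set R : (ℕ × ℤ → ℝ) → ℝ := fun ω =>
    blockSum φ r (select (fun _ => 0) ((q * p : ℕ) : ℤ) ω) with hR
  have hBm : ∀ j, Measurable (B j) := fun j => by have := hS p; fun_prop
  have hRm : Measurable R := by have := hS r; fun_prop
  have heq : (fun ω => normSum φ n (select (fun _ => 0) 0 ω) -
      (√(n : ℝ))⁻¹ * ∑ j ∈ Finset.Icc 1 q, blockSum φ p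
        (select (blockCopy p j) (blockStart p j) ω)) =
      (√(n : ℝ))⁻¹ • ((∑ j ∈ Finset.Icc 1 q, B j) + R) := by
    ext ω
    simp only [Pi.smul_apply, Pi.add_apply, Finset.sum_apply, smul_eq_mul]
    have h1 : blockSum φ n (select (fun _ => 0) 0 ω) =
        ∑ j ∈ Finset.Icc 1 q, blockSum φ p (select (fun _ => 0) (blockStart p j) ω) + R ω := by
      rw [hn', blockSum_add, blockSum_mul]
      simp only [shift_select, zero_add, hR]
    rw [normSum, h1]
    simp only [hB, Finset.sum_sub_distrib]
    ring
  rw [heq]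
  refine eLpNorm_const_smul_le.trans ?_
  have hnormB : ∀ j ∈ Finset.Icc 1 q, eLpNorm (B j) 2 (copiesLaw μ) ≤
      ENNReal.ofReal (2 * D * zetaTwo) := fun j _ =>
    h.eLpNorm_blockSum_sub_le p _ fun i hi hi' => (blockCopy_of_mem hi hi').symm
  have hnormR : eLpNorm R 2 (copiesLaw μ) ≤ ENNReal.ofReal (q * τ) := by
    refine ((eLpNorm_comp_measurePreserving (hS r).aestronglyMeasurable
      (measurePreserving_select (fun _ => 0) _)).le.trans (h.eLpNorm_blockSum_le _)).trans
      (ENNReal.ofReal_le_ofReal ?_)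
    gcongr
  have hsum : eLpNorm ((∑ j ∈ Finset.Icc 1 q, B j) + R) 2 (copiesLaw μ) ≤
      ENNReal.ofReal (q * (2 * D * zetaTwo + τ)) := by
    rw [mul_add, ENNReal.ofReal_add (by positivity) (by positivity)]
    refine (eLpNorm_add_le (Finset.aestronglyMeasurable_sum _ fun j _ => (hBm j).aestronglyMeasurable)
      hRm.aestronglyMeasurable (by norm_num)).trans (add_le_add ?_ hnormR)
    refine (eLpNorm_sum_le (fun j _ => (hBm j).aestronglyMeasurable) (by norm_num)).trans ?_
    refine (Finset.sum_le_sum hnormB).trans (le_of_eq ?_)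
    rw [Finset.sum_const, ENNReal.ofReal_mul (p := (q : ℝ)) (by positivity), Nat.card_Icc,
      add_tsub_cancel_right, ENNReal.ofReal_natCast, nsmul_eq_mul]
  calc _ ≤ ENNReal.ofReal (√(n : ℝ))⁻¹ * ENNReal.ofReal (q * (2 * D * zetaTwo + τ)) := by
        rw [← ofReal_norm, Real.norm_of_nonneg (by positivity)]
        gcongr
    _ = ENNReal.ofReal (((√(n : ℝ))⁻¹ * q) * (2 * D * zetaTwo + τ)) := by
        rw [← ENNReal.ofReal_mul (by positivity), ← mul_assoc]
    _ ≤ _ := by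
        refine ENNReal.ofReal_le_ofReal ?_
        gcongr

/-- The central limit theorem for the sums over a single block. -/
theorem ShortRange.tendstoInDistribution_normSum (h : ShortRange μ φ D)
    (h0 : ∫ x, φ x ∂(noiseLaw μ) = 0) {v : ℝ≥0} (hv : ∑' d, autocov μ φ d = v) :
    TendstoInDistribution (normSum φ) atTop (id : ℝ → ℝ) (fun _ => noiseLaw μ)
      (gaussianReal 0 v) := by
  have hφ := h.measurable
  have hS := fun p => measurable_blockSum hφ p
  rw [← tendstoInDistribution_comp_iff (measurePreserving_select (μ := μ) (fun _ => 0) 0)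
    (measurable_normSum hφ)]
  set q := numBlocks with hq
  set p : ℕ → ℕ := fun n => n / numBlocks n with hp
  -- Scaled so that `(√q)⁻¹` times the sum of the pieces is `(√n)⁻¹` times the sum of their block
  -- sums. As `q * p ≤ n`, `|Z n|` is at most the absolute normalised sum of length `p n`.
  set Z : ℕ → (ℤ → ℝ) → ℝ := fun n x => √((q n : ℝ) / n) * blockSum φ (p n) x with hZ
  set ξ : ℕ → ℕ → (ℕ × ℤ → ℝ) → ℝ := fun n j ω =>
    Z n (select (blockCopy (p n) j) (blockStart (p n) j) ω) with hξ
  have hZm : ∀ n, Measurable (Z n) := fun n => (hS _).const_mul _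
  have hZmem : ∀ n, MemLp (Z n) 2 (noiseLaw μ) := fun n => (h.memLp_blockSum _).const_mul _
  have hZUI : SqUnifIntegrable Z (noiseLaw μ) := by
    have h1 : SqUnifIntegrable (fun n => normSum φ (p n)) (noiseLaw μ) :=
      (h.sqUnifIntegrable_normSum h0).comp (σ := p) fun n =>
        IdentDistrib.refl (measurable_normSum hφ _).aemeasurable
    refine h1.mono fun n x => ?_
    rw [hZ, normSum, abs_mul, abs_mul]
    rcases Nat.eq_zero_or_pos (p n) with hpn | hpn
    · simp [hpn, blockSum]
    · have hpn' : (0 : ℝ) < p n := by exact_mod_cast hpn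
      have hn : (0 : ℝ) < n := by
        rcases Nat.eq_zero_or_pos n with rfl | hn
        · simp [hp] at hpn
        · exact_mod_cast hn
      rw [abs_of_nonneg (Real.sqrt_nonneg _), abs_of_nonneg (a := (√(p n : ℝ))⁻¹) (by positivity),
        ← Real.sqrt_inv]
      gcongr
      rw [div_le_iff₀ hn, ← div_eq_inv_mul, le_div_iff₀ hpn']
      exact_mod_cast Nat.mul_div_le n (numBlocks n)
  have hZ2 : Tendsto (fun n => ∫ x, Z n x ^ 2 ∂(noiseLaw μ)) atTop (𝓝 v) := by
    have h1 := tendsto_numBlocks_mul_div.mul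
      ((h.tendsto_integral_blockSum_sq h0).comp tendsto_div_numBlocks)
    rw [one_mul, hv] at h1
    refine h1.congr' ?_
    filter_upwards [tendsto_div_numBlocks.eventually_ge_atTop 1] with n hn
    have hpn : (0 : ℝ) < ((n / numBlocks n : ℕ) : ℝ) := by exact_mod_cast hn
    simp_rw [hZ, mul_pow, Real.sq_sqrt (show (0 : ℝ) ≤ (q n : ℝ) / n by positivity)]
    rw [integral_const_mul, Function.comp_apply, mul_assoc, mul_inv_cancel_left₀ hpn.ne']
  have hrow := tendstoInDistribution_rows (Q := copiesLaw μ) (ν := noiseLaw μ)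
    (J := fun n => Finset.Icc 1 (q n)) (by simpa using tendsto_numBlocks) hZmem
    (fun n => by
      simp only [hZ]
      rw [integral_const_mul, h.integral_blockSum h0, mul_zero]) hZUI hZ2 (ξ := ξ)
    (fun n => (iIndepFun_blockCopy (p n)).comp (fun _ => Z n) (fun _ => hZm n))
    (fun n j => ⟨((hZm n).comp (measurable_select _ _)).aemeasurable, (hZm n).aemeasurable, by
      rw [← (measurePreserving_select (μ := μ) (blockCopy (p n) j) (blockStart (p n) j)).map_eq,
        Measure.map_map (hZm n) (measurable_select _ _)]
      rfl⟩)
  refine tendstoInDistribution_of_tendstoInMeasure_sub _ _ hrow ?_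
    (fun n => ((measurable_normSum hφ n).comp (measurable_select _ _)).aemeasurable)
  refine tendstoInMeasure_zero_of_eLpNorm_le (p := 2) (by norm_num) (fun n => ?_)
    (u := fun n => (numBlocks n : ℝ)⁻¹ *
      (2 * D * zetaTwo + (eLpNorm φ 2 (noiseLaw μ)).toReal))
    (by simpa only [zero_mul] using tendsto_inv_numBlocks.mul_const _) ?_
  · refine AEStronglyMeasurable.sub ?_ (hrow.forall_aemeasurable n).aestronglyMeasurable
    exact ((measurable_normSum hφ n).comp (measurable_select _ _)).aestronglyMeasurable
  · filter_upwards [tendsto_numBlocks.eventually_ge_atTop 1] with n hn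
    refine (eLpNorm_congr_ae (ae_of_all _ fun ω => ?_)).trans_le (h.eLpNorm_normSum_sub_blocks_le hn)
    have hqn : (0 : ℝ) < numBlocks n := by exact_mod_cast hn
    simp only [Pi.sub_apply, hξ, hZ, hp, hq, Nat.card_Icc, add_tsub_cancel_right]
    rw [← Finset.mul_sum, ← mul_assoc, Real.sqrt_div (Nat.cast_nonneg _), ← mul_div_assoc,
      inv_mul_cancel₀ (Real.sqrt_pos.2 hqn).ne', one_div]

end SingleBlockCLT

/-! ### Orthogonality in degenerate U-statistics -/

section DegenerateSums

variable {Ω : Type*} [MeasurableSpace Ω] {Q : Measure Ω} [IsProbabilityMeasure Q]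
  {ξ : ℕ → Ω → ℝ} {ρ : Measure ℝ} [IsProbabilityMeasure ρ] {r : ℝ × ℝ → ℝ}

omit [IsProbabilityMeasure ρ] in
lemma measurePreserving_pair (hind : iIndepFun ξ Q) (hξ : ∀ j, MeasurePreserving (ξ j) Q ρ)
    {j k : ℕ} (hjk : j ≠ k) : MeasurePreserving (fun ω => (ξ j ω, ξ k ω)) Q (ρ.prod ρ) := by
  refine ⟨(hξ j).measurable.prodMk (hξ k).measurable, ?_⟩
  rw [(indepFun_iff_map_prod_eq_prod_map_map (hξ j).measurable.aemeasurable
    (hξ k).measurable.aemeasurable).1 (hind.indepFun hjk), (hξ j).map_eq, (hξ k).map_eq]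

/-- The index `j` occurs only once in the product, so integrating over `ξ j` with the other
variables fixed gives `0`. -/
lemma integral_degenerate_mul_eq_zero (hind : iIndepFun ξ Q)
    (hξ : ∀ j, MeasurePreserving (ξ j) Q ρ) (hr : Measurable r) (hr2 : MemLp r 2 (ρ.prod ρ))
    (hr0 : ∀ y, ∫ x, r (x, y) ∂ρ = 0) {j k j' k' : ℕ} (hjk : j ≠ k) (hjk' : j' ≠ k')
    (hj : j ≠ j') (hj' : j ≠ k') :
    ∫ ω, r (ξ j ω, ξ k ω) * r (ξ j' ω, ξ k' ω) ∂Q = 0 := by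
  have hm := fun j => (hξ j).measurable
  set U : Ω → ℝ × ℝ × ℝ := fun ω => (ξ k ω, ξ j' ω, ξ k' ω) with hU
  have hUm : Measurable U := by fun_prop
  have hindU : IndepFun (ξ j) U Q := by
    have h1 := hind.indepFun_finset {j} {k, j', k'} (by simp [hjk, hj, hj']) hm
    exact h1.comp (φ := fun y : ({j} : Finset ℕ) → ℝ => y ⟨j, by simp⟩)
      (ψ := fun y : ({k, j', k'} : Finset ℕ) → ℝ =>
        (y ⟨k, by simp⟩, y ⟨j', by simp⟩, y ⟨k', by simp⟩)) (by fun_prop) (by fun_prop)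
  set F : ℝ × (ℝ × ℝ × ℝ) → ℝ := fun q => r (q.1, q.2.1) * r q.2.2 with hF
  have hFm : Measurable F := by fun_prop
  have hmp : MeasurePreserving (fun ω => (ξ j ω, U ω)) Q (ρ.prod (Q.map U)) := by
    refine ⟨(hm j).prodMk hUm, ?_⟩
    rw [(indepFun_iff_map_prod_eq_prod_map_map (hm j).aemeasurable hUm.aemeasurable).1 hindU,
      (hξ j).map_eq]
  have : IsProbabilityMeasure (Q.map U) := Measure.isProbabilityMeasure_map hUm.aemeasurable
  have hint : Integrable F (ρ.prod (Q.map U)) := by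
    rw [← hmp.integrable_comp hFm.aestronglyMeasurable]
    exact (hr2.comp_measurePreserving (measurePreserving_pair hind hξ hjk)).integrable_mul
      (hr2.comp_measurePreserving (measurePreserving_pair hind hξ hjk'))
  calc ∫ ω, r (ξ j ω, ξ k ω) * r (ξ j' ω, ξ k' ω) ∂Q = ∫ q, F q ∂(ρ.prod (Q.map U)) :=
        integral_comp_of_measurePreserving hmp hFm.aestronglyMeasurable
    _ = ∫ u, ∫ x, F (x, u) ∂ρ ∂(Q.map U) := integral_prod_symm _ hint
    _ = 0 := by simp [hF, integral_mul_const, hr0]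

/-- The second moment of a degenerate `U`-statistic. -/
lemma integral_degenerate_sum_sq_le (hind : iIndepFun ξ Q)
    (hξ : ∀ j, MeasurePreserving (ξ j) Q ρ) (hr : Measurable r) (hsymm : ∀ x y, r (x, y) = r (y, x))
    (hr0 : ∀ y, ∫ x, r (x, y) ∂ρ = 0) {c : ℝ} (hc : 0 ≤ c)
    (hrc : eLpNorm r 2 (ρ.prod ρ) ≤ ENNReal.ofReal c) (s : Finset ℕ) :
    ∫ ω, (∑ p ∈ s.offDiag, r (ξ p.1 ω, ξ p.2 ω)) ^ 2 ∂Q ≤ s.offDiag.card * (2 * c ^ 2) := by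
  have hr2 : MemLp r 2 (ρ.prod ρ) := memLp_of_eLpNorm_le_ofReal hr.aestronglyMeasurable hrc
  have hmem : ∀ p ∈ s.offDiag, MemLp (fun ω => r (ξ p.1 ω, ξ p.2 ω)) 2 Q := fun p hp =>
    hr2.comp_measurePreserving (measurePreserving_pair hind hξ (Finset.mem_offDiag.1 hp).2.2)
  have hnorm : ∀ p ∈ s.offDiag, eLpNorm (fun ω => r (ξ p.1 ω, ξ p.2 ω)) 2 Q ≤ ENNReal.ofReal c :=
    fun p hp => (eLpNorm_comp_measurePreserving hr2.1
      (measurePreserving_pair hind hξ (Finset.mem_offDiag.1 hp).2.2)).le.trans hrc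
  simp_rw [sq (Finset.sum _ _), Finset.sum_mul_sum]
  have hint : ∀ p ∈ s.offDiag, ∀ q ∈ s.offDiag,
      Integrable (fun ω => r (ξ p.1 ω, ξ p.2 ω) * r (ξ q.1 ω, ξ q.2 ω)) Q := fun p hp q hq =>
    (hmem p hp).integrable_mul (hmem q hq)
  rw [integral_finsetSum _ fun p hp => integrable_finsetSum _ fun q hq => hint p hp q hq,
    ← nsmul_eq_mul, ← Finset.sum_const]
  refine Finset.sum_le_sum fun p hp => ?_
  rw [integral_finsetSum _ fun q hq => hint p hp q hq]
  have hp' := (Finset.mem_offDiag.1 hp).2.2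
  have hzero : ∀ q ∈ s.offDiag, q ∉ ({p, p.swap} : Finset (ℕ × ℕ)) →
      ∫ ω, r (ξ p.1 ω, ξ p.2 ω) * r (ξ q.1 ω, ξ q.2 ω) ∂Q = 0 := by
    intro q hq hqp
    have hq' := (Finset.mem_offDiag.1 hq).2.2
    simp only [Finset.mem_insert, Finset.mem_singleton, not_or] at hqp
    -- Some entry of `p` does not occur in `q`. If `p.1` occurs, this entry is `p.2`, and the
    -- symmetry of `r` moves it to the front.
    by_cases h1 : p.1 = q.1 ∨ p.1 = q.2
    · have h2 : p.2 ≠ q.1 ∧ p.2 ≠ q.2 := by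
        constructor
        · rintro h2
          rcases h1 with h1 | h1
          · exact hp' (h1.trans h2.symm)
          · exact hqp.2 (Prod.ext h2.symm h1.symm)
        · rintro h2
          rcases h1 with h1 | h1
          · exact hqp.1 (Prod.ext h1.symm h2.symm)
          · exact hp' (h1.trans h2.symm)
      simp_rw [fun ω => hsymm (ξ p.1 ω) (ξ p.2 ω)]
      exact integral_degenerate_mul_eq_zero hind hξ hr hr2 hr0 hp'.symm hq' h2.1 h2.2
    · push Not at h1
      exact integral_degenerate_mul_eq_zero hind hξ hr hr2 hr0 hp' hq' h1.1 h1.2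
  calc ∑ q ∈ s.offDiag, ∫ ω, r (ξ p.1 ω, ξ p.2 ω) * r (ξ q.1 ω, ξ q.2 ω) ∂Q
      ≤ ∑ q ∈ s.offDiag, if q ∈ ({p, p.swap} : Finset (ℕ × ℕ)) then c ^ 2 else 0 := by
        refine Finset.sum_le_sum fun q hq => ?_
        split_ifs with hqp
        · rw [sq]
          exact (le_abs_self _).trans (abs_integral_mul_le (hmem p hp).1 (hmem q hq).1 hc hc
            (hnorm p hp) (hnorm q hq))
        · exact (hzero q hq hqp).le
    _ ≤ 2 * c ^ 2 := by
        rw [← Finset.sum_filter, Finset.sum_const, nsmul_eq_mul]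
        gcongr
        have : (s.offDiag.filter fun q => q ∈ ({p, p.swap} : Finset (ℕ × ℕ))).card ≤ 2 :=
          (Finset.card_le_card fun q hq => (Finset.mem_filter.1 hq).2).trans Finset.card_le_two
        exact_mod_cast this

end DegenerateSums

/-! ### Projections of Lipschitz kernels -/

section Hoeffding

lemma sum_offDiag_fst (s : Finset ℕ) (f : ℕ → ℝ) :
    ∑ p ∈ s.offDiag, f p.1 = ((s.card : ℝ) - 1) * ∑ j ∈ s, f j := by
  have h1 : ∑ p ∈ s ×ˢ s, f p.1 = s.card * ∑ j ∈ s, f j := by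
    rw [Finset.sum_product]; simp [Finset.mul_sum]
  rw [← Finset.diag_union_offDiag, Finset.sum_union (Finset.disjoint_diag_offDiag s),
    Finset.sum_diag] at h1
  linarith

lemma sum_offDiag_snd (s : Finset ℕ) (f : ℕ → ℝ) :
    ∑ p ∈ s.offDiag, f p.2 = ((s.card : ℝ) - 1) * ∑ j ∈ s, f j := by
  have h1 : ∑ p ∈ s ×ˢ s, f p.2 = s.card * ∑ j ∈ s, f j := by
    rw [Finset.sum_product]; simp
  rw [← Finset.diag_union_offDiag, Finset.sum_union (Finset.disjoint_diag_offDiag s),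
    Finset.sum_diag] at h1
  linarith

/-- A Lipschitz kernel, with respect to the sum of the coordinate distances. -/
def LipKernel (h : ℝ × ℝ → ℝ) (K : ℝ) : Prop :=
  ∀ x y x' y', |h (x, y) - h (x', y')| ≤ K * (|x - x'| + |y - y'|)

variable {Ω' : Type*} [MeasurableSpace Ω'] {ν : Measure Ω'} [IsProbabilityMeasure ν]
  {h : ℝ × ℝ → ℝ} {K C : ℝ} {Z : Ω' → ℝ}

lemma LipKernel.of_lipschitzWith {K : ℝ≥0} (hK : LipschitzWith K h) : LipKernel h K := by
  intro x y x' y'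
  have := hK.dist_le_mul (x, y) (x', y')
  rw [Real.dist_eq, Prod.dist_eq, Real.dist_eq, Real.dist_eq] at this
  refine this.trans ?_
  gcongr
  exact max_le (by linarith [abs_nonneg (y - y')]) (by linarith [abs_nonneg (x - x')])

lemma LipKernel.continuous (hh : LipKernel h K) (hK : 0 ≤ K) : Continuous h := by
  have : LipschitzWith (2 * K).toNNReal h := LipschitzWith.of_dist_le_mul fun p q => by
    rw [Real.coe_toNNReal _ (by positivity), Real.dist_eq, Prod.dist_eq, Real.dist_eq, Real.dist_eq]
    refine (hh p.1 p.2 q.1 q.2).trans ?_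
    rw [mul_comm 2 K, mul_assoc]
    gcongr
    linarith [le_max_left |p.1 - q.1| |p.2 - q.2|, le_max_right |p.1 - q.1| |p.2 - q.2|]
  exact this.continuous

/-- The projection of the kernel: the expectation of `h (x, Z)`. -/
noncomputable def kernelProj (h : ℝ × ℝ → ℝ) (ν : Measure Ω') (Z : Ω' → ℝ) (x : ℝ) : ℝ :=
  ∫ w, h (x, Z w) ∂ν

/-- The expectation of `h (Z, Z')` for an independent copy `Z'` of `Z`. -/
noncomputable def kernelMean (h : ℝ × ℝ → ℝ) (ν : Measure Ω') (Z : Ω' → ℝ) : ℝ :=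
  ∫ u, kernelProj h ν Z (Z u) ∂ν

/-- The degenerate part of the kernel. -/
noncomputable def kernelDegenerate (h : ℝ × ℝ → ℝ) (ν : Measure Ω') (Z : Ω' → ℝ) (p : ℝ × ℝ) : ℝ :=
  h p - kernelProj h ν Z p.1 - kernelProj h ν Z p.2 + kernelMean h ν Z

lemma LipKernel.integrable_right (hh : LipKernel h K) (hK : 0 ≤ K) (hZ : Integrable Z ν) (x : ℝ) :
    Integrable (fun w => h (x, Z w)) ν := by
  have hc := hh.continuous hK
  refine ((hZ.norm.const_mul K).add (integrable_const |h (x, 0)|)).mono'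
    (((hc.comp (by fun_prop : Continuous fun y : ℝ => (x, y))).measurable.comp_aemeasurable
      hZ.1.aemeasurable).aestronglyMeasurable) (ae_of_all _ fun w => ?_)
  have := hh x (Z w) x 0
  simp only [sub_self, abs_zero, zero_add, sub_zero] at this
  have h2 := abs_sub_abs_le_abs_sub (h (x, Z w)) (h (x, 0))
  change |_| ≤ K * |Z w| + |_|
  linarith

lemma LipKernel.abs_kernelProj_sub_le (hh : LipKernel h K) (hK : 0 ≤ K) (hZ : Integrable Z ν)
    (x y : ℝ) : |kernelProj h ν Z x - kernelProj h ν Z y| ≤ K * |x - y| := by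
  unfold kernelProj
  rw [← integral_sub (hh.integrable_right hK hZ x) (hh.integrable_right hK hZ y)]
  rw [← Real.norm_eq_abs]
  refine (norm_integral_le_of_norm_le_const (C := K * |x - y|) (ae_of_all _ fun w => ?_)).trans_eq
    (by rw [probReal_univ, mul_one])
  rw [Real.norm_eq_abs]
  simpa only [sub_self, abs_zero, add_zero] using hh x (Z w) y (Z w)

lemma LipKernel.measurable_kernelProj (hh : LipKernel h K) (hK : 0 ≤ K) (hZ : Integrable Z ν) :
    Measurable (kernelProj h ν Z) := by
  have : LipschitzWith K.toNNReal (kernelProj h ν Z) := LipschitzWith.of_dist_le_mul fun x y => by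
    rw [Real.coe_toNNReal _ hK]; exact hh.abs_kernelProj_sub_le hK hZ x y
  exact this.continuous.measurable

lemma LipKernel.integrable_kernelProj (hh : LipKernel h K) (hK : 0 ≤ K) (hZ : Integrable Z ν) :
    Integrable (fun u => kernelProj h ν Z (Z u)) ν := by
  refine ((hZ.norm.const_mul K).add (integrable_const |kernelProj h ν Z 0|)).mono'
    (((hh.measurable_kernelProj hK hZ).comp_aemeasurable hZ.1.aemeasurable).aestronglyMeasurable)
    (ae_of_all _ fun w => ?_)
  have := hh.abs_kernelProj_sub_le hK hZ (Z w) 0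
  rw [sub_zero] at this
  have h2 := abs_sub_abs_le_abs_sub (kernelProj h ν Z (Z w)) (kernelProj h ν Z 0)
  change |_| ≤ K * |Z w| + |_|
  linarith

lemma LipKernel.abs_sub_kernelProj_le (hh : LipKernel h K) (hK : 0 ≤ K) (hZ : Integrable Z ν)
    (hC : ∫ w, |Z w| ∂ν ≤ C) (x y : ℝ) : |h (x, y) - kernelProj h ν Z x| ≤ K * (|y| + C) := by
  have h1 : h (x, y) - kernelProj h ν Z x = ∫ w, (h (x, y) - h (x, Z w)) ∂ν := by
    rw [integral_sub (integrable_const _) (hh.integrable_right hK hZ x)]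
    simp [kernelProj]
  have hZa : Integrable (fun w => |Z w|) ν := hZ.norm
  rw [h1]
  calc |∫ w, (h (x, y) - h (x, Z w)) ∂ν| ≤ ∫ w, K * (|y| + |Z w|) ∂ν := by
        rw [← Real.norm_eq_abs]
        refine norm_integral_le_of_norm_le (((integrable_const |y|).add hZa).const_mul K)
          (ae_of_all _ fun w => ?_)
        have := hh x y x (Z w)
        simp only [sub_self, abs_zero, zero_add] at this
        refine this.trans ?_
        gcongr
        exact abs_sub _ _
    _ = K * (|y| + ∫ w, |Z w| ∂ν) := by
        rw [integral_const_mul, integral_add (integrable_const _) hZa]; simp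
    _ ≤ _ := by gcongr

lemma LipKernel.abs_kernelProj_sub_kernelMean_le (hh : LipKernel h K) (hK : 0 ≤ K)
    (hZ : Integrable Z ν) (hC : ∫ w, |Z w| ∂ν ≤ C) (y : ℝ) :
    |kernelProj h ν Z y - kernelMean h ν Z| ≤ K * (|y| + C) := by
  have h1 : kernelProj h ν Z y - kernelMean h ν Z =
      ∫ w, (kernelProj h ν Z y - kernelProj h ν Z (Z w)) ∂ν := by
    rw [integral_sub (integrable_const _) (hh.integrable_kernelProj hK hZ)]
    simp [kernelMean]
  have hZa : Integrable (fun w => |Z w|) ν := hZ.norm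
  rw [h1]
  calc |∫ w, (kernelProj h ν Z y - kernelProj h ν Z (Z w)) ∂ν| ≤ ∫ w, K * (|y| + |Z w|) ∂ν := by
        rw [← Real.norm_eq_abs]
        refine norm_integral_le_of_norm_le (((integrable_const |y|).add hZa).const_mul K)
          (ae_of_all _ fun w => ?_)
        refine (hh.abs_kernelProj_sub_le hK hZ y (Z w)).trans ?_
        gcongr
        exact abs_sub _ _
    _ = K * (|y| + ∫ w, |Z w| ∂ν) := by
        rw [integral_const_mul, integral_add (integrable_const _) hZa]; simp
    _ ≤ _ := by gcongr

/-- Grouped into two differences, each comparing a value at `p.2` with an average over `Z`; the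
bound therefore does not involve `p.1`. -/
lemma LipKernel.abs_kernelDegenerate_le (hh : LipKernel h K) (hK : 0 ≤ K) (hZ : Integrable Z ν)
    (hC : ∫ w, |Z w| ∂ν ≤ C) (p : ℝ × ℝ) :
    |kernelDegenerate h ν Z p| ≤ 2 * K * (|p.2| + C) := by
  have h1 := hh.abs_sub_kernelProj_le hK hZ hC p.1 p.2
  have h2 := hh.abs_kernelProj_sub_kernelMean_le hK hZ hC p.2
  have h3 : kernelDegenerate h ν Z p =
      (h (p.1, p.2) - kernelProj h ν Z p.1) - (kernelProj h ν Z p.2 - kernelMean h ν Z) := by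
    simp only [kernelDegenerate]; ring
  rw [h3]
  refine (abs_sub _ _).trans ?_
  linarith

lemma LipKernel.integral_kernelDegenerate (hh : LipKernel h K) (hK : 0 ≤ K) (hZ : Integrable Z ν)
    (hZm : Measurable Z) (hsymm : ∀ x y, h (x, y) = h (y, x)) (y : ℝ) :
    ∫ x, kernelDegenerate h ν Z (x, y) ∂(ν.map Z) = 0 := by
  have hm := hh.measurable_kernelProj hK hZ
  have hhm := (hh.continuous hK).measurable
  rw [integral_map hZm.aemeasurable
    (by unfold kernelDegenerate; exact Measurable.aestronglyMeasurable (by fun_prop))]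
  simp only [kernelDegenerate]
  simp_rw [fun u => hsymm (Z u) y]
  have i1 := hh.integrable_right hK hZ y
  have i2 := hh.integrable_kernelProj hK hZ
  have i3 := i1.sub i2
  rw [integral_add (by exact i3.sub (integrable_const _)) (integrable_const _),
    integral_sub (by exact i3) (integrable_const _), integral_sub i1 i2]
  simp [kernelProj, kernelMean]

lemma LipKernel.eLpNorm_kernelDegenerate_le (hh : LipKernel h K) (hK : 0 ≤ K)
    (hZm : Measurable Z) (hC0 : 0 ≤ C) (hC : eLpNorm Z 2 ν ≤ ENNReal.ofReal C) :
    eLpNorm (kernelDegenerate h ν Z) 2 ((ν.map Z).prod (ν.map Z)) ≤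
      ENNReal.ofReal (2 * K * (C + C)) := by
  have hZ2 : MemLp Z 2 ν := memLp_of_eLpNorm_le_ofReal hZm.aestronglyMeasurable hC
  have hZ : Integrable Z ν := hZ2.integrable (by norm_num)
  have hC1 := integral_abs_le hZm.aestronglyMeasurable hC0 hC
  have : IsProbabilityMeasure (ν.map Z) := Measure.isProbabilityMeasure_map hZm.aemeasurable
  have h1 : eLpNorm (fun p : ℝ × ℝ => |p.2|) 2 ((ν.map Z).prod (ν.map Z)) ≤ ENNReal.ofReal C := by
    have h2 : MeasurePreserving (Prod.snd : ℝ × ℝ → ℝ) ((ν.map Z).prod (ν.map Z)) (ν.map Z) :=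
      measurePreserving_snd
    have h3 := eLpNorm_comp_measurePreserving (g := fun y : ℝ => |y|) (p := 2)
      (by fun_prop : AEStronglyMeasurable (fun y : ℝ => |y|) (ν.map Z)) h2
    have h4 : eLpNorm (fun y : ℝ => |y|) 2 (ν.map Z) = eLpNorm Z 2 ν := by
      rw [eLpNorm_map_measure (by fun_prop) hZm.aemeasurable]
      exact eLpNorm_norm Z
    exact (h3.trans h4).le.trans hC
  calc eLpNorm (kernelDegenerate h ν Z) 2 ((ν.map Z).prod (ν.map Z))
      ≤ eLpNorm ((2 * K) • ((fun p : ℝ × ℝ => |p.2|) + fun _ => C)) 2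
          ((ν.map Z).prod (ν.map Z)) :=
        eLpNorm_mono_real fun p => hh.abs_kernelDegenerate_le hK hZ hC1 p
    _ ≤ ENNReal.ofReal (2 * K) * (ENNReal.ofReal C + ENNReal.ofReal C) := by
        refine eLpNorm_const_smul_le.trans ?_
        rw [← ofReal_norm, Real.norm_of_nonneg (by positivity)]
        gcongr
        refine (eLpNorm_add_le (by fun_prop) (by fun_prop) (by norm_num)).trans
          (add_le_add h1 ?_)
        rw [eLpNorm_const _ (by simp) (NeZero.ne _), ← ofReal_norm, Real.norm_of_nonneg hC0]
        simp
    _ = _ := by rw [← ENNReal.ofReal_add hC0 hC0, ← ENNReal.ofReal_mul (by positivity)]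

end Hoeffding

/-! ### Variance of the projection as a three-variable integral -/

section SharedArgument

variable {ρ : Measure ℝ} [IsProbabilityMeasure ρ] {h h₁ h₂ : ℝ × ℝ → ℝ} {K H C c ε : ℝ}

/-- The expectation of `h₁ (x, y) * h₂ (x, z)` for independent `x`, `y`, `z` with law `ρ`. -/
noncomputable def sharedIntegral (h₁ h₂ : ℝ × ℝ → ℝ) (ρ : Measure ℝ) : ℝ :=
  ∫ p : ℝ × ℝ × ℝ, h₁ (p.1, p.2.1) * h₂ (p.1, p.2.2) ∂(ρ.prod (ρ.prod ρ))

/-- The kernel evaluated at the truncated arguments. -/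
noncomputable def truncKernel (h : ℝ × ℝ → ℝ) (c : ℝ) (p : ℝ × ℝ) : ℝ :=
  h (truncate c p.1, truncate c p.2)

lemma LipKernel.truncKernel (hh : LipKernel h K) (hK : 0 ≤ K) (c : ℝ) :
    LipKernel (truncKernel h c) K := fun x y x' y' => (hh _ _ _ _).trans <| by
  exact mul_le_mul_of_nonneg_left
    (add_le_add (abs_truncate_sub_le _ _ _) (abs_truncate_sub_le _ _ _)) hK

lemma LipKernel.abs_le (hh : LipKernel h K) (h0 : |h (0, 0)| ≤ H) (x y : ℝ) :
    |h (x, y)| ≤ K * (|x| + |y|) + H := by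
  have := hh x y 0 0
  rw [sub_zero, sub_zero] at this
  linarith [abs_sub_abs_le_abs_sub (h (x, y)) (h (0, 0))]

lemma LipKernel.abs_sub_truncKernel_le (hh : LipKernel h K) (hc : 0 ≤ c) (x y : ℝ) :
    |h (x, y) - BlockUStat.truncKernel h c (x, y)| ≤ K * (excess c x + excess c y) := by
  rw [← abs_sub_truncate hc, ← abs_sub_truncate hc]
  exact hh _ _ _ _

omit [IsProbabilityMeasure ρ] in
lemma eLpNorm_le_of_abs_le_pair {M : Type*} [MeasurableSpace M] {κ : Measure M}
    [IsProbabilityMeasure κ] {u v w : M → ℝ} {ψ : ℝ → ℝ} {d : ℝ} (hu : MeasurePreserving u κ ρ)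
    (hv : MeasurePreserving v κ ρ) (hψ : Measurable ψ) (hd : 0 ≤ d) (hK : 0 ≤ K) (hH : 0 ≤ H)
    (hψd : eLpNorm ψ 2 ρ ≤ ENNReal.ofReal d) (hw : ∀ p, |w p| ≤ K * (ψ (u p) + ψ (v p)) + H) :
    eLpNorm w 2 κ ≤ ENNReal.ofReal (K * (d + d) + H) := by
  have h1 : ∀ {u : M → ℝ}, MeasurePreserving u κ ρ →
      eLpNorm (fun p => ψ (u p)) 2 κ ≤ ENNReal.ofReal d := fun hu =>
    (eLpNorm_comp_measurePreserving hψ.aestronglyMeasurable hu).le.trans hψd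
  have hum := hu.measurable
  have hvm := hv.measurable
  calc eLpNorm w 2 κ
      ≤ eLpNorm (K • ((fun p => ψ (u p)) + fun p => ψ (v p)) + fun _ => H) 2 κ :=
        eLpNorm_mono_real hw
    _ ≤ ENNReal.ofReal K * (ENNReal.ofReal d + ENNReal.ofReal d) + ENNReal.ofReal H := by
        refine (eLpNorm_add_le (Measurable.aestronglyMeasurable (by fun_prop)) (by fun_prop)
          (by norm_num)).trans (add_le_add (eLpNorm_const_smul_le.trans ?_) ?_)
        · rw [← ofReal_norm, Real.norm_of_nonneg hK]
          gcongr
          exact (eLpNorm_add_le (hψ.comp hum).aestronglyMeasurable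
            (hψ.comp hvm).aestronglyMeasurable (by norm_num)).trans (add_le_add (h1 hu) (h1 hv))
        · rw [eLpNorm_const _ (by simp) (NeZero.ne _), ← ofReal_norm, Real.norm_of_nonneg hH]
          simp
    _ = _ := by
        rw [← ENNReal.ofReal_add hd hd, ← ENNReal.ofReal_mul hK,
          ← ENNReal.ofReal_add (by positivity) hH]

lemma measurePreserving_first : MeasurePreserving (fun p : ℝ × ℝ × ℝ => p.1)
    (ρ.prod (ρ.prod ρ)) ρ := measurePreserving_fst

lemma measurePreserving_second : MeasurePreserving (fun p : ℝ × ℝ × ℝ => p.2.1)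
    (ρ.prod (ρ.prod ρ)) ρ := measurePreserving_fst.comp measurePreserving_snd

lemma measurePreserving_third : MeasurePreserving (fun p : ℝ × ℝ × ℝ => p.2.2)
    (ρ.prod (ρ.prod ρ)) ρ := measurePreserving_snd.comp measurePreserving_snd

lemma LipKernel.eLpNorm_pair_le (hh : LipKernel h K) (hK : 0 ≤ K) (h0 : |h (0, 0)| ≤ H)
    (hC : 0 ≤ C) (hρ : eLpNorm (id : ℝ → ℝ) 2 ρ ≤ ENNReal.ofReal C) {v : ℝ × ℝ × ℝ → ℝ}
    (hv : MeasurePreserving v (ρ.prod (ρ.prod ρ)) ρ) :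
    eLpNorm (fun p : ℝ × ℝ × ℝ => h (p.1, v p)) 2 (ρ.prod (ρ.prod ρ)) ≤
      ENNReal.ofReal (K * (C + C) + H) :=
  eLpNorm_le_of_abs_le_pair (ψ := fun x => |x|) measurePreserving_first hv (by fun_prop) hC hK
    ((abs_nonneg _).trans h0) ((eLpNorm_norm (id : ℝ → ℝ)).le.trans hρ)
    fun p => hh.abs_le h0 _ _

lemma LipKernel.eLpNorm_pair_sub_truncKernel_le (hh : LipKernel h K) (hK : 0 ≤ K) (hc : 0 ≤ c)
    (hε : 0 ≤ ε) (hρ : eLpNorm (excess c) 2 ρ ≤ ENNReal.ofReal ε) {v : ℝ × ℝ × ℝ → ℝ}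
    (hv : MeasurePreserving v (ρ.prod (ρ.prod ρ)) ρ) :
    eLpNorm (fun p : ℝ × ℝ × ℝ => h (p.1, v p) - BlockUStat.truncKernel h c (p.1, v p)) 2
      (ρ.prod (ρ.prod ρ)) ≤ ENNReal.ofReal (K * (ε + ε)) := by
  simpa using eLpNorm_le_of_abs_le_pair (H := 0) (ψ := excess c) measurePreserving_first hv
    (by fun_prop) hε hK le_rfl hρ
    fun p => by simpa using hh.abs_sub_truncKernel_le hc p.1 (v p)

/-- The factors are truncated one at a time, and Cauchy–Schwarz pairs the small truncation error
with the bounded norm of the other factor. -/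
lemma abs_sharedIntegral_sub_le (hh₁ : LipKernel h₁ K) (hh₂ : LipKernel h₂ K) (hK : 0 ≤ K)
    (h1 : |h₁ (0, 0)| ≤ H) (h2 : |h₂ (0, 0)| ≤ H) (hC : 0 ≤ C)
    (hρC : eLpNorm (id : ℝ → ℝ) 2 ρ ≤ ENNReal.ofReal C) (hc : 0 ≤ c) (hε : 0 ≤ ε)
    (hρ : eLpNorm (excess c) 2 ρ ≤ ENNReal.ofReal ε) :
    |sharedIntegral h₁ h₂ ρ - sharedIntegral (truncKernel h₁ c) (truncKernel h₂ c) ρ| ≤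
      2 * (K * (ε + ε) * (K * (C + C) + H)) := by
  have hH : 0 ≤ H := (abs_nonneg _).trans h1
  have hm₁ := (hh₁.continuous hK).measurable
  have hm₂ := (hh₂.continuous hK).measurable
  have hm₃ := ((hh₁.truncKernel hK c).continuous hK).measurable
  have hm₄ := ((hh₂.truncKernel hK c).continuous hK).measurable
  have h3 : |truncKernel h₁ c (0, 0)| ≤ H := by
    simpa [truncKernel, truncate, hc] using h1
  have n1 := hh₁.eLpNorm_pair_le hK h1 hC hρC measurePreserving_second
  have n2 := hh₂.eLpNorm_pair_le hK h2 hC hρC measurePreserving_third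
  have n3 := (hh₁.truncKernel hK c).eLpNorm_pair_le hK h3 hC hρC measurePreserving_second
  have d1 := hh₁.eLpNorm_pair_sub_truncKernel_le hK hc hε hρ measurePreserving_second
  have d2 := hh₂.eLpNorm_pair_sub_truncKernel_le hK hc hε hρ measurePreserving_third
  have L1 := memLp_of_eLpNorm_le_ofReal (Measurable.aestronglyMeasurable (by fun_prop)) n1
  have L2 := memLp_of_eLpNorm_le_ofReal (Measurable.aestronglyMeasurable (by fun_prop)) n2
  have L3 := memLp_of_eLpNorm_le_ofReal (Measurable.aestronglyMeasurable (by fun_prop)) n3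
  have E1 := memLp_of_eLpNorm_le_ofReal (Measurable.aestronglyMeasurable (by fun_prop)) d1
  have E2 := memLp_of_eLpNorm_le_ofReal (Measurable.aestronglyMeasurable (by fun_prop)) d2
  have L4 : MemLp (fun p : ℝ × ℝ × ℝ => truncKernel h₂ c (p.1, p.2.2)) 2
      (ρ.prod (ρ.prod ρ)) :=
    (L2.sub E2).ae_eq (ae_of_all _ fun p => sub_sub_cancel _ _)
  have key : sharedIntegral h₁ h₂ ρ - sharedIntegral (truncKernel h₁ c) (truncKernel h₂ c) ρ =
      (∫ p : ℝ × ℝ × ℝ, (h₁ (p.1, p.2.1) - truncKernel h₁ c (p.1, p.2.1)) * h₂ (p.1, p.2.2)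
        ∂(ρ.prod (ρ.prod ρ))) +
      ∫ p : ℝ × ℝ × ℝ, (h₂ (p.1, p.2.2) - truncKernel h₂ c (p.1, p.2.2)) *
        truncKernel h₁ c (p.1, p.2.1) ∂(ρ.prod (ρ.prod ρ)) := by
    rw [← integral_add (by exact E1.integrable_mul L2) (by exact E2.integrable_mul L3),
      sharedIntegral, sharedIntegral,
      ← integral_sub (by exact L1.integrable_mul L2) (by exact L3.integrable_mul L4)]
    exact integral_congr_ae (ae_of_all _ fun p => by ring)
  rw [key, two_mul]
  exact (abs_add_le _ _).trans (add_le_add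
    (abs_integral_mul_le E1.1 L2.1 (by positivity) (by positivity) d1 n2)
    (abs_integral_mul_le E2.1 L3.1 (by positivity) (by positivity) d2 n3))

lemma LipKernel.memLp_pair (hh : LipKernel h K) (hK : 0 ≤ K) (hρ : MemLp (id : ℝ → ℝ) 2 ρ)
    {v : ℝ × ℝ × ℝ → ℝ} (hv : MeasurePreserving v (ρ.prod (ρ.prod ρ)) ρ) :
    MemLp (fun p : ℝ × ℝ × ℝ => h (p.1, v p)) 2 (ρ.prod (ρ.prod ρ)) := by
  have hm := (hh.continuous hK).measurable
  have hvm := hv.measurable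
  exact memLp_of_eLpNorm_le_ofReal (Measurable.aestronglyMeasurable (by fun_prop)) (hh.eLpNorm_pair_le hK le_rfl
    ENNReal.toReal_nonneg (ENNReal.ofReal_toReal hρ.2.ne).ge hv)

lemma sharedIntegral_eq (hh₁ : LipKernel h₁ K) (hh₂ : LipKernel h₂ K) (hK : 0 ≤ K)
    (hρ : MemLp (id : ℝ → ℝ) 2 ρ) :
    sharedIntegral h₁ h₂ ρ = ∫ x, kernelProj h₁ ρ id x * kernelProj h₂ ρ id x ∂ρ := by
  have hi : Integrable (fun p : ℝ × ℝ × ℝ => h₁ (p.1, p.2.1) * h₂ (p.1, p.2.2))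
      (ρ.prod (ρ.prod ρ)) := (hh₁.memLp_pair hK hρ measurePreserving_second).integrable_mul
    (hh₂.memLp_pair hK hρ measurePreserving_third)
  rw [sharedIntegral, integral_prod _ hi]
  refine integral_congr_ae (ae_of_all _ fun x => ?_)
  exact integral_prod_mul (fun y => h₁ (x, y)) fun z => h₂ (x, z)

lemma LipKernel.one (hK : 0 ≤ K) : LipKernel (fun _ => 1) K := fun x y x' y' => by
  simp only [sub_self, abs_zero]; positivity

lemma LipKernel.memLp_kernelProj (hh : LipKernel h K) (hK : 0 ≤ K)
    (hρ : MemLp (id : ℝ → ℝ) 2 ρ) : MemLp (kernelProj h ρ id) 2 ρ := by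
  have hi := hρ.integrable (by norm_num)
  have hm := hh.measurable_kernelProj hK hi
  refine MemLp.of_le (g := fun x => K * |x| + |kernelProj h ρ id 0|)
    ((hρ.norm.const_mul K).add (memLp_const _)) hm.aestronglyMeasurable (ae_of_all _ fun x => ?_)
  have h1 := hh.abs_kernelProj_sub_le hK hi x 0
  rw [sub_zero] at h1
  rw [Real.norm_eq_abs, Real.norm_of_nonneg (by positivity)]
  linarith [abs_sub_abs_le_abs_sub (kernelProj h ρ id x) (kernelProj h ρ id 0)]

lemma LipKernel.kernelMean_eq (hh : LipKernel h K) (hK : 0 ≤ K) (hρ : MemLp (id : ℝ → ℝ) 2 ρ) :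
    kernelMean h ρ id = sharedIntegral h (fun _ => 1) ρ := by
  rw [sharedIntegral_eq hh (LipKernel.one hK) hK hρ]
  simp [kernelMean, kernelProj]

/-- The projection itself varies with the law. On the right the integrands are fixed functions of
three independent variables, so weak convergence of product laws applies. -/
lemma LipKernel.integral_kernelProj_sub_sq (hh : LipKernel h K) (hK : 0 ≤ K)
    (hρ : MemLp (id : ℝ → ℝ) 2 ρ) :
    ∫ x, (kernelProj h ρ id x - kernelMean h ρ id) ^ 2 ∂ρ =
      sharedIntegral h h ρ - sharedIntegral h (fun _ => 1) ρ ^ 2 := by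
  have hm := hh.memLp_kernelProj hK hρ
  have h1 : ∀ x, (kernelProj h ρ id x - kernelMean h ρ id) ^ 2 =
      kernelProj h ρ id x * kernelProj h ρ id x -
        (2 * kernelMean h ρ id * kernelProj h ρ id x - kernelMean h ρ id ^ 2) := fun x => by ring
  have i1 : Integrable (fun x => kernelProj h ρ id x * kernelProj h ρ id x) ρ :=
    hm.integrable_mul hm
  have i2 : Integrable (fun x => 2 * kernelMean h ρ id * kernelProj h ρ id x) ρ :=
    (hm.integrable (by norm_num)).const_mul _
  simp_rw [h1]
  rw [integral_sub i1 (by exact i2.sub (integrable_const _)),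
    integral_sub i2 (integrable_const _), integral_const_mul, ← sharedIntegral_eq hh hh hK hρ,
    ← hh.kernelMean_eq hK hρ]
  have : ∫ x, kernelProj h ρ id x ∂ρ = kernelMean h ρ id := rfl
  rw [this]
  simp
  ring

/-- Convergence of the expectations of Lipschitz kernels along a weakly convergent sequence of laws
with uniformly integrable squares. -/
lemma tendsto_sharedIntegral {ρ : ℕ → ProbabilityMeasure ℝ} {ρ' : ProbabilityMeasure ℝ}
    (hρ : Tendsto ρ atTop (𝓝 ρ'))
    (hUI : ∀ ε : ℝ, 0 < ε → ∃ c : ℝ, 0 ≤ c ∧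
      ∀ n, eLpNorm (excess c) 2 (ρ n : Measure ℝ) ≤ ENNReal.ofReal ε)
    {C : ℝ} (hC : 0 ≤ C) (hρC : ∀ n, eLpNorm (id : ℝ → ℝ) 2 (ρ n : Measure ℝ) ≤ ENNReal.ofReal C)
    (hρ' : MemLp (id : ℝ → ℝ) 2 (ρ' : Measure ℝ))
    (hh₁ : LipKernel h₁ K) (hh₂ : LipKernel h₂ K) (hK : 0 ≤ K) :
    Tendsto (fun n => sharedIntegral h₁ h₂ (ρ n)) atTop (𝓝 (sharedIntegral h₁ h₂ ρ')) := by
  set H := max |h₁ (0, 0)| |h₂ (0, 0)| with hH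
  have hH0 : 0 ≤ H := (abs_nonneg _).trans (le_max_left _ _)
  set C' := max C (eLpNorm (id : ℝ → ℝ) 2 (ρ' : Measure ℝ)).toReal with hC'
  have hC'0 : 0 ≤ C' := hC.trans (le_max_left _ _)
  rw [Metric.tendsto_atTop]
  intro δ hδ
  set A := 2 * (2 * K * (K * (C' + C') + H)) with hA
  have hA0 : 0 ≤ A := by positivity
  -- Three errors below `δ / 3`: truncation under `ρ n`, truncation under `ρ'`, and weak convergence
  -- tested on the bounded truncated kernels.
  set ε := δ / (3 * (A + 1)) with hε_def
  have hε : 0 < ε := by positivity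
  have hAε : A * ε < δ / 3 := by
    rw [hε_def, mul_div_assoc', div_lt_div_iff₀ (by positivity) (by norm_num)]
    nlinarith
  obtain ⟨c₁, hc₁, H₁⟩ := hUI ε hε
  obtain ⟨k, hk⟩ := ((tendsto_eLpNorm_excess hρ').eventually_le_const
    (ENNReal.ofReal_pos.2 hε)).exists
  set c := max c₁ k with hc_def
  have hc : 0 ≤ c := hc₁.trans (le_max_left _ _)
  have hanti : ∀ {d : ℝ} {κ : Measure ℝ}, d ≤ c → eLpNorm (excess d) 2 κ ≤ ENNReal.ofReal ε →
      eLpNorm (excess c) 2 κ ≤ ENNReal.ofReal ε := fun hd hκ =>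
    (eLpNorm_mono_real fun x => by
      rw [Real.norm_of_nonneg (excess_nonneg _ _)]; exact excess_anti hd x).trans hκ
  have happrox : ∀ κ : ProbabilityMeasure ℝ,
      eLpNorm (id : ℝ → ℝ) 2 (κ : Measure ℝ) ≤ ENNReal.ofReal C' →
      eLpNorm (excess c) 2 (κ : Measure ℝ) ≤ ENNReal.ofReal ε →
      |sharedIntegral h₁ h₂ κ - sharedIntegral (truncKernel h₁ c) (truncKernel h₂ c) κ| < δ / 3 :=
    fun κ h1 h2 => (abs_sharedIntegral_sub_le hh₁ hh₂ hK (le_max_left _ _) (le_max_right _ _) hC'0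
      h1 hc hε.le h2).trans_lt (by rw [hA] at hAε; linarith)
  have hlim : Tendsto (fun n => sharedIntegral (truncKernel h₁ c) (truncKernel h₂ c) (ρ n)) atTop
      (𝓝 (sharedIntegral (truncKernel h₁ c) (truncKernel h₂ c) ρ')) := by
    have hprod : Tendsto (fun n => (ρ n).prod ((ρ n).prod (ρ n))) atTop
        (𝓝 (ρ'.prod (ρ'.prod ρ'))) := by
      have h2 : Tendsto (fun n => (ρ n).prod (ρ n)) atTop (𝓝 (ρ'.prod ρ')) :=
        (ProbabilityMeasure.continuous_prod.tendsto (ρ', ρ')).comp (hρ.prodMk_nhds hρ)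
      exact (ProbabilityMeasure.continuous_prod.tendsto (ρ', ρ'.prod ρ')).comp (hρ.prodMk_nhds h2)
    rw [ProbabilityMeasure.tendsto_iff_forall_integral_tendsto] at hprod
    have hc₁' := (hh₁.truncKernel hK c).continuous hK
    have hc₂' := (hh₂.truncKernel hK c).continuous hK
    have hb : ∀ {h : ℝ × ℝ → ℝ}, LipKernel h K → |h (0, 0)| ≤ H → ∀ q,
        |truncKernel h c q| ≤ K * (c + c) + H := fun hh h0 q =>
      (hh.abs_le h0 _ _).trans (by gcongr <;> exact abs_truncate_le hc _)
    exact hprod (BoundedContinuousFunction.ofNormedAddCommGroup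
      (fun p : ℝ × ℝ × ℝ => truncKernel h₁ c (p.1, p.2.1) * truncKernel h₂ c (p.1, p.2.2))
      (by fun_prop) ((K * (c + c) + H) * (K * (c + c) + H)) fun p => by
        rw [norm_mul]
        gcongr
        · exact hb hh₁ (le_max_left _ _) _
        · exact hb hh₂ (le_max_right _ _) _)
  obtain ⟨N, hN⟩ := Metric.tendsto_atTop.1 hlim (δ / 3) (by positivity)
  refine ⟨N, fun n hn => ?_⟩
  have a1 := happrox (ρ n) ((hρC n).trans (ENNReal.ofReal_le_ofReal (le_max_left _ _)))
    (hanti (le_max_left _ _) (H₁ n))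
  have a2 := happrox ρ' ((ENNReal.ofReal_toReal hρ'.2.ne).ge.trans
    (ENNReal.ofReal_le_ofReal (le_max_right _ _))) (hanti (le_max_right _ _) hk)
  have a3 := hN n hn
  rw [Real.dist_eq, abs_lt] at a3
  rw [Real.dist_eq, abs_lt]
  rw [abs_lt] at a1 a2
  constructor <;> linarith [a1.1, a1.2, a2.1, a2.2, a3.1, a3.2]

end SharedArgument

/-! ### The Gaussian kernel covariance -/

section GaussianLimit

variable {h : ℝ × ℝ → ℝ} {K : ℝ}

/-- Moves the coordinate shared by the two factors of `gaussianKernelCov` to the front. -/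
lemma measurePreserving_piThree (ρ : Measure ℝ) [IsProbabilityMeasure ρ] :
    MeasurePreserving (fun z : Fin 3 → ℝ => (z 1, z 0, z 2)) (Measure.pi fun _ : Fin 3 => ρ)
      (ρ.prod (ρ.prod ρ)) := by
  have h1 := measurePreserving_piFinSuccAbove (fun _ : Fin 3 => ρ) 1
  have h2 := (MeasurePreserving.id ρ).prod (measurePreserving_piFinTwo (fun _ : Fin 2 => ρ))
  exact h2.comp h1

lemma LipKernel.gaussianKernelCov_eq (hh : LipKernel h K) (hK : 0 ≤ K)
    (hsymm : ∀ x y, h (x, y) = h (y, x)) {σ : ℝ} {s : ℝ≥0} (hs : (s : ℝ) = σ ^ 2) :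
    gaussianKernelCov h σ =
      sharedIntegral h h (gaussianReal 0 s) - sharedIntegral h (fun _ => 1) (gaussianReal 0 s) ^ 2 := by
  obtain ⟨ρ, hρ_def⟩ : ∃ ρ, ρ = gaussianReal 0 s := ⟨_, rfl⟩
  have : IsProbabilityMeasure ρ := by rw [hρ_def]; infer_instance
  rw [← hρ_def]
  have hρ : MemLp (id : ℝ → ℝ) 2 ρ := by rw [hρ_def]; exact memLp_id_gaussianReal 2
  have hσ : MeasurePreserving (fun x : ℝ => σ * x) (gaussianReal 0 1) ρ :=
    ⟨by fun_prop, by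
      rw [gaussianReal_map_const_mul, mul_zero, mul_one, hρ_def]; congr 1; exact NNReal.eq hs.symm⟩
  have hT : MeasurePreserving (fun z : Fin 3 → ℝ => (σ * z 1, σ * z 0, σ * z 2))
      (Measure.pi fun _ : Fin 3 => gaussianReal 0 1) (ρ.prod (ρ.prod ρ)) :=
    (hσ.prod (hσ.prod hσ)).comp (measurePreserving_piThree _)
  have hm := (hh.continuous hK).measurable
  have L1 := hh.memLp_pair hK hρ measurePreserving_second
  have L2 := hh.memLp_pair hK hρ measurePreserving_third
  rw [gaussianKernelCov]
  simp_rw [fun z : Fin 3 → ℝ => hsymm (σ * z 0) (σ * z 1)]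
  rw [covariance_eq_sub (by exact L1.comp_measurePreserving hT)
    (by exact L2.comp_measurePreserving hT), sq]
  congr 1
  · exact integral_comp_of_measurePreserving (g := fun p : ℝ × ℝ × ℝ =>
      h (p.1, p.2.1) * h (p.1, p.2.2)) hT
      (Measurable.aestronglyMeasurable (by fun_prop))
  · congr 1
    · rw [sharedIntegral]
      simp only [mul_one]
      exact integral_comp_of_measurePreserving (g := fun p : ℝ × ℝ × ℝ => h (p.1, p.2.1)) hT
        (Measurable.aestronglyMeasurable (by fun_prop))
    · rw [sharedIntegral_eq hh (LipKernel.one hK) hK hρ]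
      rw [integral_comp_of_measurePreserving (g := fun p : ℝ × ℝ × ℝ => h (p.1, p.2.2)) hT
        (Measurable.aestronglyMeasurable (by fun_prop))]
      have := sharedIntegral_eq (LipKernel.one hK) hh hK hρ
      simp only [sharedIntegral, one_mul] at this
      rw [this]
      exact integral_congr_ae (ae_of_all _ fun x => mul_comm _ _)

/-- Given the shared argument, the two factors are independent with the same conditional mean, so
their covariance is the variance of the projection. -/
lemma LipKernel.gaussianKernelCov_nonneg (hh : LipKernel h K) (hK : 0 ≤ K)
    (hsymm : ∀ x y, h (x, y) = h (y, x)) (σ : ℝ) : 0 ≤ gaussianKernelCov h σ := by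
  rw [hh.gaussianKernelCov_eq hK hsymm (Real.coe_toNNReal _ (sq_nonneg σ)), ← hh.integral_kernelProj_sub_sq hK (memLp_id_gaussianReal 2)]
  exact integral_nonneg fun x => sq_nonneg _

end GaussianLimit

/-! ### U-statistics of independent rows -/

section IndependentRows

variable {Ω Ω' : Type*} [MeasurableSpace Ω] {Q : Measure Ω} [IsProbabilityMeasure Q]
  [MeasurableSpace Ω'] {ν : Measure Ω'} [IsProbabilityMeasure ν] {h : ℝ × ℝ → ℝ} {K : ℝ}

omit [IsProbabilityMeasure ν] in
lemma LipKernel.kernelProj_map (hh : LipKernel h K) (hK : 0 ≤ K) {Z : Ω' → ℝ} (hZ : Measurable Z)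
    (x : ℝ) : kernelProj h (ν.map Z) id x = kernelProj h ν Z x := by
  have hm := (hh.continuous hK).measurable
  exact integral_map hZ.aemeasurable (Measurable.aestronglyMeasurable (by fun_prop))

lemma LipKernel.kernelMean_map (hh : LipKernel h K) (hK : 0 ≤ K) {Z : Ω' → ℝ} (hZ : Measurable Z)
    (hZi : Integrable Z ν) : kernelMean h (ν.map Z) id = kernelMean h ν Z := by
  simp only [kernelMean, hh.kernelProj_map hK hZ, id]
  exact integral_map hZ.aemeasurable (hh.measurable_kernelProj hK hZi).aestronglyMeasurable

/-- The variance of the projections converges along a weakly convergent sequence with uniformly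
integrable squares. -/
lemma LipKernel.tendsto_integral_kernelProj_sq (hh : LipKernel h K) (hK : 0 ≤ K)
    (hsymm : ∀ x y, h (x, y) = h (y, x)) {Z : ℕ → Ω' → ℝ} (hZ : ∀ n, Measurable (Z n))
    (hUI : SqUnifIntegrable Z ν) {σ : ℝ} {s : ℝ≥0} (hs : (s : ℝ) = σ ^ 2)
    (hlim : TendstoInDistribution Z atTop (id : ℝ → ℝ) (fun _ => ν) (gaussianReal 0 s)) :
    Tendsto (fun n => ∫ u, (kernelProj h ν (Z n) (Z n u) - kernelMean h ν (Z n)) ^ 2 ∂ν) atTop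
      (𝓝 (gaussianKernelCov h σ)) := by
  obtain ⟨C, hC, hZC⟩ := hUI.exists_bound fun n => (hZ n).aestronglyMeasurable
  have hZ2 : ∀ n, MemLp (Z n) 2 ν := fun n =>
    memLp_of_eLpNorm_le_ofReal (hZ n).aestronglyMeasurable (hZC n)
  set ρ : ℕ → ProbabilityMeasure ℝ := fun n =>
    ⟨ν.map (Z n), Measure.isProbabilityMeasure_map (hZ n).aemeasurable⟩ with hρ
  set ρ' : ProbabilityMeasure ℝ := ⟨gaussianReal 0 s, inferInstance⟩ with hρ'
  have hρlim : Tendsto ρ atTop (𝓝 ρ') := by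
    have := hlim.tendsto
    simpa only [Measure.map_id] using this
  have hUI' : ∀ ε : ℝ, 0 < ε → ∃ c : ℝ, 0 ≤ c ∧
      ∀ n, eLpNorm (excess c) 2 (ρ n : Measure ℝ) ≤ ENNReal.ofReal ε := fun ε hε => by
    obtain ⟨c, hc, H⟩ := hUI ε hε
    refine ⟨c, hc, fun n => ?_⟩
    have := eLpNorm_map_measure (p := 2) (measurable_excess c).aestronglyMeasurable
      (hZ n).aemeasurable (μ := ν)
    exact this.le.trans (H n)
  have hρC : ∀ n, eLpNorm (id : ℝ → ℝ) 2 (ρ n : Measure ℝ) ≤ ENNReal.ofReal C := fun n => by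
    have := eLpNorm_map_measure (p := 2) (g := (id : ℝ → ℝ)) (by fun_prop)
      (hZ n).aemeasurable (μ := ν)
    exact this.le.trans (hZC n)
  have hρ'2 : MemLp (id : ℝ → ℝ) 2 (ρ' : Measure ℝ) := memLp_id_gaussianReal 2
  have h1 := tendsto_sharedIntegral hρlim hUI' hC hρC hρ'2 hh hh hK
  have h2 := tendsto_sharedIntegral hρlim hUI' hC hρC hρ'2 hh (LipKernel.one hK) hK
  rw [hh.gaussianKernelCov_eq hK hsymm hs]
  refine (h1.sub (h2.pow 2)).congr fun n => ?_
  have hn : MemLp (id : ℝ → ℝ) 2 (ρ n : Measure ℝ) :=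
    memLp_of_eLpNorm_le_ofReal (by fun_prop) (hρC n)
  rw [← hh.integral_kernelProj_sub_sq hK hn]
  have hi := (hZ2 n).integrable (by norm_num)
  have hm := hh.measurable_kernelProj hK hi
  change ∫ x, (kernelProj h (ν.map (Z n)) id x - kernelMean h (ν.map (Z n)) id) ^ 2
    ∂(ν.map (Z n)) = _
  simp only [hh.kernelProj_map hK (hZ n), hh.kernelMean_map hK (hZ n) hi]
  exact integral_map (hZ n).aemeasurable (Measurable.aestronglyMeasurable (by fun_prop))

lemma offDiagAverage_add (b : ℕ) (c d : ℕ → ℕ → ℝ) :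
    offDiagAverage b (fun j k => c j k + d j k) = offDiagAverage b c + offDiagAverage b d := by
  simp only [offDiagAverage, Finset.sum_add_distrib, mul_add]

lemma offDiagAverage_congr {b : ℕ} {c d : ℕ → ℕ → ℝ}
    (h : ∀ j ∈ Finset.Icc 1 b, ∀ k ∈ Finset.Icc 1 b, j ≠ k → c j k = d j k) :
    offDiagAverage b c = offDiagAverage b d := by
  unfold offDiagAverage
  rw [Finset.sum_congr rfl fun p hp => ?_]
  obtain ⟨h1, h2, h3⟩ := Finset.mem_offDiag.1 hp
  exact h _ h1 _ h2 h3

lemma card_offDiag_Icc (b : ℕ) :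
    ((Finset.Icc 1 b).offDiag.card : ℝ) = (b : ℝ) * ((b : ℝ) - 1) := by
  rw [Finset.offDiag_card, Nat.card_Icc, Nat.add_sub_cancel,
    Nat.cast_sub (Nat.le_mul_self b)]
  push_cast; ring

/-- Every index is the first entry of `b - 1` pairs and the second entry of as many; `2 ≤ b` allows
cancelling `b - 1`. -/
lemma offDiagAverage_fst_add_snd {b : ℕ} (hb : 2 ≤ b) (f : ℕ → ℝ) (θ : ℝ) :
    offDiagAverage b (fun j k => f j + f k + θ) =
      2 / (b : ℝ) * (∑ j ∈ Finset.Icc 1 b, f j) + θ := by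
  have hb' : (2 : ℝ) ≤ b := by exact_mod_cast hb
  have hb1 : (b : ℝ) - 1 ≠ 0 := by linarith
  simp only [offDiagAverage, Finset.sum_add_distrib, sum_offDiag_fst, sum_offDiag_snd,
    Finset.sum_const, nsmul_eq_mul, card_offDiag_Icc, Nat.card_Icc, Nat.add_sub_cancel]
  field_simp
  ring

omit [MeasurableSpace Ω] [IsProbabilityMeasure ν] in
/-- Hoeffding's decomposition. -/
lemma sqrt_mul_uStat_sub_eq {b : ℕ} (hb : 2 ≤ b) (Z : Ω' → ℝ) (ξ : ℕ → Ω → ℝ) (ω : Ω) :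
    √b * (uStat h b ξ ω - kernelMean h ν Z) =
      (√((Finset.Icc 1 b).card : ℝ))⁻¹ *
        ∑ j ∈ Finset.Icc 1 b, 2 * (kernelProj h ν Z (ξ j ω) - kernelMean h ν Z) +
      √b * offDiagAverage b fun j k => kernelDegenerate h ν Z (ξ j ω, ξ k ω) := by
  have hb' : (2 : ℝ) ≤ b := by exact_mod_cast hb
  have h1 : uStat h b ξ ω =
      offDiagAverage b (fun j k => kernelDegenerate h ν Z (ξ j ω, ξ k ω)) +
      (2 / (b : ℝ) * (∑ j ∈ Finset.Icc 1 b, (kernelProj h ν Z (ξ j ω) - kernelMean h ν Z)) +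
        kernelMean h ν Z) := by
    rw [← offDiagAverage_fst_add_snd hb, ← offDiagAverage_add]
    refine offDiagAverage_congr fun j _ k _ _ => ?_
    simp only [kernelDegenerate]; ring
  have h2 : √(b : ℝ) * (2 / b) = 2 * (√(b : ℝ))⁻¹ := by
    have : √(b : ℝ) ≠ 0 := by positivity
    have h3 : √(b : ℝ) * √b = b := Real.mul_self_sqrt (by positivity)
    field_simp
    rw [sq, h3]
  rw [h1, ← Finset.mul_sum, Nat.card_Icc, Nat.add_sub_cancel]
  linear_combination
    (∑ j ∈ Finset.Icc 1 b, (kernelProj h ν Z (ξ j ω) - kernelMean h ν Z)) * h2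

lemma LipKernel.uStatMean_eq (hh : LipKernel h K) (hK : 0 ≤ K) {b : ℕ} (hb : 2 ≤ b) {Z : Ω' → ℝ}
    (hZm : Measurable Z) (hZ : MemLp Z 2 ν) {ξ : ℕ → Ω → ℝ} (hind : iIndepFun ξ Q)
    (hξ : ∀ j, MeasurePreserving (ξ j) Q (ν.map Z)) :
    uStatMean Q h b ξ = kernelMean h ν Z := by
  have : IsProbabilityMeasure (ν.map Z) := Measure.isProbabilityMeasure_map hZm.aemeasurable
  have hm := (hh.continuous hK).measurable
  have hρ : MemLp (id : ℝ → ℝ) 2 (ν.map Z) := (memLp_map_measure_iff (by fun_prop)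
    hZm.aemeasurable).2 hZ
  have hi : Integrable h ((ν.map Z).prod (ν.map Z)) := by
    refine MemLp.integrable (q := 2) (by norm_num) (memLp_of_eLpNorm_le_ofReal
      (c := K * ((eLpNorm (id : ℝ → ℝ) 2 (ν.map Z)).toReal +
        (eLpNorm (id : ℝ → ℝ) 2 (ν.map Z)).toReal) + |h (0, 0)|) hm.aestronglyMeasurable ?_)
    exact eLpNorm_le_of_abs_le_pair (ψ := fun x => |x|) measurePreserving_fst
      measurePreserving_snd (by fun_prop) ENNReal.toReal_nonneg hK (abs_nonneg _)
      ((eLpNorm_norm (id : ℝ → ℝ)).le.trans (ENNReal.ofReal_toReal hρ.2.ne).ge)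
      fun p => hh.abs_le le_rfl p.1 p.2
  have h1 : uStatMean Q h b ξ = offDiagAverage b fun _ _ => 0 + 0 + kernelMean h ν Z := by
    refine offDiagAverage_congr fun j _ k _ hjk => ?_
    rw [integral_comp_of_measurePreserving (measurePreserving_pair hind hξ hjk)
      hm.aestronglyMeasurable, integral_prod _ hi,
      ← hh.kernelMean_map hK hZm (hZ.integrable (by norm_num))]
    simp [kernelMean, kernelProj]
  rw [h1, offDiagAverage_fst_add_snd hb fun _ => 0]
  simp

/-- Central limit theorem for `U`-statistics of triangular arrays with independent, identically
distributed rows. -/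
theorem LipKernel.tendstoInDistribution_uStat (hh : LipKernel h K) (hK : 0 ≤ K)
    (hsymm : ∀ x y, h (x, y) = h (y, x)) {Z : ℕ → Ω' → ℝ} (hZ : ∀ n, Measurable (Z n))
    (hUI : SqUnifIntegrable Z ν) {σ : ℝ} {s : ℝ≥0} (hs : (s : ℝ) = σ ^ 2)
    (hlim : TendstoInDistribution Z atTop (id : ℝ → ℝ) (fun _ => ν) (gaussianReal 0 s))
    {b : ℕ → ℕ} (hb : Tendsto b atTop atTop) {ξ : ℕ → ℕ → Ω → ℝ}
    (hξm : ∀ n j, Measurable (ξ n j)) (hind : ∀ n, iIndepFun (ξ n) Q)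
    (hid : ∀ n j, IdentDistrib (ξ n j) (Z n) Q ν) {v : ℝ≥0}
    (hv : (v : ℝ) = 4 * gaussianKernelCov h σ) :
    TendstoInDistribution
      (fun n ω => √(b n : ℝ) * (uStat h (b n) (ξ n) ω - uStatMean Q h (b n) (ξ n))) atTop
      (id : ℝ → ℝ) (fun _ => Q) (gaussianReal 0 v) := by
  obtain ⟨C, hC, hZC⟩ := hUI.exists_bound fun n => (hZ n).aestronglyMeasurable
  have hZ2 : ∀ n, MemLp (Z n) 2 ν := fun n =>
    memLp_of_eLpNorm_le_ofReal (hZ n).aestronglyMeasurable (hZC n)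
  have hZi : ∀ n, Integrable (Z n) ν := fun n => (hZ2 n).integrable (by norm_num)
  have hhm := (hh.continuous hK).measurable
  have hpm : ∀ n, Measurable (kernelProj h ν (Z n)) := fun n => hh.measurable_kernelProj hK (hZi n)
  have hξ : ∀ n j, MeasurePreserving (ξ n j) Q (ν.map (Z n)) := fun n j =>
    ⟨hξm n j, (hid n j).map_eq⟩
  set V : ℕ → ℝ → ℝ := fun n x => 2 * (kernelProj h ν (Z n) x - kernelMean h ν (Z n)) with hV
  have hVm : ∀ n, Measurable (V n) := fun n => by have := hpm n; fun_prop
  -- The projection is Lipschitz, so the linear terms grow at most linearly in `Z n` and inherit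
  -- uniform integrability.
  have hVUI : SqUnifIntegrable (fun n u => V n (Z n u)) ν := by
    have h1 : SqUnifIntegrable (fun n u => (2 * K) * (|Z n u| + C)) ν := by
      refine SqUnifIntegrable.const_mul ?_ _
      exact (hUI.mono (Y := fun n u => |Z n u|) fun n u => (abs_abs _).le).add
        (SqUnifIntegrable.const (w := fun _ => C) (C := C) fun _ => (abs_of_nonneg hC).le)
        (fun n => ((hZ n).abs).aestronglyMeasurable) fun n => by fun_prop
    refine h1.mono fun n u => ?_
    have h2 := hh.abs_kernelProj_sub_kernelMean_le hK (hZi n)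
      (integral_abs_le (hZ n).aestronglyMeasurable hC (hZC n)) (Z n u)
    rw [hV, abs_mul, abs_two, abs_of_nonneg (by positivity : 0 ≤ 2 * K * (|Z n u| + C))]
    linarith
  obtain ⟨D, hD, hVD⟩ := hVUI.exists_bound fun n => ((hVm n).comp (hZ n)).aestronglyMeasurable
  have hrow := tendstoInDistribution_rows (Q := Q) (ν := ν) (J := fun n => Finset.Icc 1 (b n))
    (by simpa using hb) (Z := fun n u => V n (Z n u))
    (fun n => memLp_of_eLpNorm_le_ofReal ((hVm n).comp (hZ n)).aestronglyMeasurable (hVD n))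
    (fun n => by
      rw [integral_const_mul, integral_sub (hh.integrable_kernelProj hK (hZi n))
        (integrable_const _)]
      simp [kernelMean]) hVUI (v := v)
    (by
      rw [hv]
      refine ((hh.tendsto_integral_kernelProj_sq hK hsymm hZ hUI hs hlim).const_mul 4).congr
        fun n => ?_
      rw [← integral_const_mul]
      exact integral_congr_ae (ae_of_all _ fun u => by simp only [hV]; ring))
    (ξ := fun n j ω => V n (ξ n j ω))
    (fun n => (hind n).comp (fun _ => V n) fun _ => hVm n)
    (fun n j => (hid n j).comp (hVm n))
  have hUm : ∀ n, Measurable (uStat h (b n) (ξ n)) := fun n =>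
    (Finset.measurable_fun_sum _ fun p _ => hhm.comp
      ((hξm n p.1).prodMk (hξm n p.2))).const_mul _
  refine tendstoInDistribution_of_tendstoInMeasure_sub _ _ hrow ?_ fun n =>
    (((hUm n).sub_const _).const_mul _).aemeasurable
  set c := 2 * K * (C + C) with hc
  have hc0 : 0 ≤ c := by positivity
  have hbR : Tendsto (fun n => (b n : ℝ) - 1) atTop atTop :=
    tendsto_atTop_add_const_right _ (-1) (tendsto_natCast_atTop_atTop.comp hb)
  -- The degenerate average times `√b` has second moment at most `b * (b (b - 1))⁻² * b (b - 1) * 2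
  -- c² = 2 c² / (b - 1)`.
  have hu : Tendsto (fun n => √(2 * c ^ 2 / ((b n : ℝ) - 1))) atTop (𝓝 0) := by
    simpa using (Tendsto.const_div_atTop hbR (2 * c ^ 2)).sqrt
  refine tendstoInMeasure_zero_of_eLpNorm_le (p := 2) (by norm_num) (fun n => ?_) hu ?_
  · have := hUm n
    refine Measurable.aestronglyMeasurable (Measurable.sub (by fun_prop) ?_)
    exact (Finset.measurable_fun_sum _ fun j _ => (hVm n).comp (hξm n j)).const_mul _
  filter_upwards [hb.eventually_ge_atTop 2] with n hn
  have hn' : (2 : ℝ) ≤ b n := by exact_mod_cast hn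
  have hn1 : (0 : ℝ) < (b n : ℝ) - 1 := by linarith
  have : IsProbabilityMeasure (ν.map (Z n)) :=
    Measure.isProbabilityMeasure_map (hZ n).aemeasurable
  have hdm : Measurable (kernelDegenerate h ν (Z n)) := by
    have := hpm n
    unfold kernelDegenerate; fun_prop
  have hdeg := integral_degenerate_sum_sq_le (hind n) (hξ n) hdm
    (fun x y => by simp only [kernelDegenerate, hsymm x y]; ring)
    (hh.integral_kernelDegenerate hK (hZi n) (hZ n) hsymm) hc0
    (hh.eLpNorm_kernelDegenerate_le hK (hZ n) hC (hZC n)) (Finset.Icc 1 (b n))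
  have hdL : MemLp (kernelDegenerate h ν (Z n)) 2 ((ν.map (Z n)).prod (ν.map (Z n))) :=
    memLp_of_eLpNorm_le_ofReal hdm.aestronglyMeasurable
      (hh.eLpNorm_kernelDegenerate_le hK (hZ n) hC (hZC n))
  have heq : ((fun ω => √(b n : ℝ) * (uStat h (b n) (ξ n) ω - kernelMean h ν (Z n))) -
      fun ω => (√((Finset.Icc 1 (b n)).card : ℝ))⁻¹ * ∑ j ∈ Finset.Icc 1 (b n), V n (ξ n j ω)) =
      fun ω => √(b n : ℝ) * (1 / ((b n : ℝ) * ((b n : ℝ) - 1)) *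
        ∑ p ∈ (Finset.Icc 1 (b n)).offDiag, kernelDegenerate h ν (Z n) (ξ n p.1 ω, ξ n p.2 ω)) := by
    funext ω
    rw [Pi.sub_apply, sqrt_mul_uStat_sub_eq (ν := ν) hn (Z n), hV]
    simp only [add_sub_cancel_left, offDiagAverage]
  change eLpNorm ((fun ω => √(b n : ℝ) * (uStat h (b n) (ξ n) ω - uStatMean Q h (b n) (ξ n))) -
      fun ω => (√((Finset.Icc 1 (b n)).card : ℝ))⁻¹ * ∑ j ∈ Finset.Icc 1 (b n), V n (ξ n j ω))
    2 Q ≤ _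
  rw [hh.uStatMean_eq hK hn (hZ n) (hZ2 n) (hind n) (hξ n), heq, eLpNorm_two_le_ofReal_iff _ (Real.sqrt_nonneg _), Real.sq_sqrt (by positivity)]
  · simp_rw [mul_pow, integral_const_mul, Real.sq_sqrt (Nat.cast_nonneg (b n))]
    rw [card_offDiag_Icc] at hdeg
    calc _ ≤ (b n : ℝ) * ((1 / ((b n : ℝ) * ((b n : ℝ) - 1))) ^ 2 *
          ((b n : ℝ) * ((b n : ℝ) - 1) * (2 * c ^ 2))) := by gcongr
      _ = _ := by field_simp
  · exact ((memLp_finsetSum _ fun p hp => hdL.comp_measurePreserving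
      (measurePreserving_pair (hind n) (hξ n) (Finset.mem_offDiag.1 hp).2.2)).const_mul _).const_mul _

end IndependentRows

lemma eLpNorm_one_le_ofReal {α : Type*} [MeasurableSpace α] {κ : Measure α} {f g : α → ℝ} {c : ℝ}
    (hg : Integrable g κ) (hfg : ∀ x, |f x| ≤ g x) (hc : ∫ x, g x ∂κ ≤ c) :
    eLpNorm f 1 κ ≤ ENNReal.ofReal c := by
  refine (eLpNorm_mono_real hfg).trans ?_
  rw [eLpNorm_one_eq_lintegral_enorm, ← ofReal_integral_norm_eq_lintegral_enorm hg]
  refine ENNReal.ofReal_le_ofReal (le_trans (le_of_eq ?_) hc)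
  exact integral_congr_ae (ae_of_all _ fun x => Real.norm_of_nonneg ((abs_nonneg _).trans (hfg x)))

/-! ### Lipschitz functions of block means and the delta method -/

section BlockValue

variable {m : ℕ}

lemma norm_toLp_le_sum (w : Fin m → ℝ) : ‖WithLp.toLp 2 w‖ ≤ ∑ k, |w k| := by
  rw [EuclideanSpace.norm_eq]
  refine Real.sqrt_le_iff.2 ⟨Finset.sum_nonneg fun _ _ => abs_nonneg _, ?_⟩
  exact Finset.sum_sq_le_sq_sum_of_nonneg fun _ _ => abs_nonneg _

/-- The vector of the averages of the functions `φ k` over the times `1, …, p`. -/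
noncomputable def blockMean (φ : Fin m → (ℤ → ℝ) → ℝ) (p : ℕ) (x : ℤ → ℝ) :
    EuclideanSpace ℝ (Fin m) :=
  WithLp.toLp 2 (fun k => (p : ℝ)⁻¹ * blockSum (φ k) p x)

/-- The function `G` of the averages, scaled by the square root of the length of the block. -/
noncomputable def blockValue (G : EuclideanSpace ℝ (Fin m) → ℝ) (φ : Fin m → (ℤ → ℝ) → ℝ) (p : ℕ)
    (x : ℤ → ℝ) : ℝ :=
  √(p : ℝ) * G (blockMean φ p x)

variable {μ : Measure ℝ} [IsProbabilityMeasure μ] {φ : Fin m → (ℤ → ℝ) → ℝ} {D : Fin m → ℝ}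
  {G : EuclideanSpace ℝ (Fin m) → ℝ} {G' : EuclideanSpace ℝ (Fin m) →L[ℝ] ℝ} {L : ℝ}

lemma sqrt_mul_norm_blockMean_le (φ : Fin m → (ℤ → ℝ) → ℝ) (p : ℕ) (x : ℤ → ℝ) :
    √(p : ℝ) * ‖blockMean φ p x‖ ≤ ∑ k, |normSum (φ k) p x| := by
  calc √(p : ℝ) * ‖blockMean φ p x‖ ≤ √(p : ℝ) * ∑ k, |(p : ℝ)⁻¹ * blockSum (φ k) p x| := by
        gcongr; exact norm_toLp_le_sum _
    _ = _ := by
        rw [Finset.mul_sum]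
        refine Finset.sum_congr rfl fun k _ => ?_
        rw [normSum, ← Real.sqrt_div_self, div_eq_mul_inv, mul_assoc, abs_mul √(p : ℝ),
          abs_of_nonneg (Real.sqrt_nonneg _)]

lemma measurable_blockMean (hφ : ∀ k, Measurable (φ k)) (p : ℕ) : Measurable (blockMean φ p) :=
  (WithLp.measurable_toLp 2 _).comp
    (measurable_pi_lambda _ fun k => (measurable_blockSum (hφ k) p).const_mul _)

lemma continuous_of_abs_sub_le (hL0 : 0 ≤ L) (hL : ∀ y z, |G y - G z| ≤ L * ‖y - z‖) :
    Continuous G :=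
  (LipschitzWith.of_dist_le_mul (K := L.toNNReal) fun y z => by
    rw [Real.coe_toNNReal _ hL0, Real.dist_eq, dist_eq_norm]; exact hL y z).continuous

lemma measurable_blockValue (hφ : ∀ k, Measurable (φ k)) (hG : Measurable G) (p : ℕ) :
    Measurable (blockValue G φ p) :=
  (hG.comp (measurable_blockMean hφ p)).const_mul _

lemma abs_blockValue_le (hL0 : 0 ≤ L) (hL : ∀ y z, |G y - G z| ≤ L * ‖y - z‖) (hG0 : G 0 = 0)
    (p : ℕ) (x : ℤ → ℝ) : |blockValue G φ p x| ≤ L * ∑ k, |normSum (φ k) p x| := by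
  have h1 := hL (blockMean φ p x) 0
  rw [hG0, sub_zero, sub_zero] at h1
  rw [blockValue, abs_mul, abs_of_nonneg (Real.sqrt_nonneg _)]
  calc √(p : ℝ) * |G (blockMean φ p x)| ≤ √(p : ℝ) * (L * ‖blockMean φ p x‖) := by gcongr
    _ = L * (√(p : ℝ) * ‖blockMean φ p x‖) := by ring
    _ ≤ _ := by gcongr; exact sqrt_mul_norm_blockMean_le φ p x

lemma sqUnifIntegrable_sum_abs_normSum (hφ : ∀ k, ShortRange μ (φ k) (D k))
    (h0 : ∀ k, ∫ x, φ k x ∂(noiseLaw μ) = 0) :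
    SqUnifIntegrable (fun p x => ∑ k, |normSum (φ k) p x|) (noiseLaw μ) :=
  SqUnifIntegrable.sum Finset.univ (Z := fun k p x => |normSum (φ k) p x|)
    (fun k _ => ((hφ k).sqUnifIntegrable_normSum (h0 k)).mono fun _ _ => (abs_abs _).le)
    fun k _ p => (measurable_normSum (hφ k).measurable p).abs.aestronglyMeasurable

lemma sqUnifIntegrable_blockValue (hφ : ∀ k, ShortRange μ (φ k) (D k))
    (h0 : ∀ k, ∫ x, φ k x ∂(noiseLaw μ) = 0) (hL0 : 0 ≤ L)
    (hL : ∀ y z, |G y - G z| ≤ L * ‖y - z‖) (hG0 : G 0 = 0) :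
    SqUnifIntegrable (blockValue G φ) (noiseLaw μ) :=
  ((sqUnifIntegrable_sum_abs_normSum hφ h0).const_mul L).mono fun p x => by
    rw [abs_mul, abs_of_nonneg hL0, Finset.abs_sum_of_nonneg fun _ _ => abs_nonneg _]
    exact abs_blockValue_le hL0 hL hG0 p x

/-- The first-order expansion at `0`, with a quadratic remainder away from `0`. -/
lemma exists_abs_sub_fderiv_le (hL0 : 0 ≤ L) (hL : ∀ y z, |G y - G z| ≤ L * ‖y - z‖) (hG0 : G 0 = 0)
    (hG' : HasFDerivAt G G' 0) {ε : ℝ} (hε : 0 < ε) :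
    ∃ B : ℝ, 0 ≤ B ∧ ∀ y, |G y - G' y| ≤ ε * ‖y‖ + B * ‖y‖ ^ 2 := by
  have h1 := hasFDerivAt_iff_isLittleO_nhds_zero.1 hG'
  obtain ⟨r, hr, H⟩ := Metric.eventually_nhds_iff.1 (h1.def hε)
  refine ⟨(L + ‖G'‖) / r, by positivity, fun y => ?_⟩
  -- Outside radius `r`, linear growth is absorbed by `‖y‖ ≤ ‖y‖² / r`, which makes the expansion
  -- global.
  by_cases hy : ‖y‖ < r
  · have := H (y := y) (by simpa using hy)
    simp only [zero_add, hG0, sub_zero, Real.norm_eq_abs] at this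
    refine this.trans (le_add_of_nonneg_right (by positivity))
  · have h2 := hL y 0
    rw [hG0, sub_zero, sub_zero] at h2
    have h3 : |G' y| ≤ ‖G'‖ * ‖y‖ := G'.le_opNorm y
    calc |G y - G' y| ≤ (L + ‖G'‖) * ‖y‖ := (abs_sub _ _).trans (by linarith)
      _ ≤ (L + ‖G'‖) * (‖y‖ * (‖y‖ / r)) := by
          gcongr
          exact le_mul_of_one_le_right (norm_nonneg _) ((one_le_div hr).2 (not_lt.1 hy))
      _ = (L + ‖G'‖) / r * ‖y‖ ^ 2 := by ring
      _ ≤ _ := le_add_of_nonneg_left (by positivity)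

lemma sqrt_mul_fderiv_blockMean (G' : EuclideanSpace ℝ (Fin m) →L[ℝ] ℝ)
    (φ : Fin m → (ℤ → ℝ) → ℝ) (p : ℕ) (x : ℤ → ℝ) :
    √(p : ℝ) * G' (blockMean φ p x) =
      normSum (fun x => ∑ k, G' (EuclideanSpace.single k 1) * φ k x) p x := by
  have h1 : blockMean φ p x =
      ∑ k, ((p : ℝ)⁻¹ * blockSum (φ k) p x) • EuclideanSpace.single k (1 : ℝ) := by
    ext k
    simp [blockMean, Finset.sum_apply, Pi.single_apply]
  rw [h1, map_sum, normSum, ← Real.sqrt_div_self, div_eq_mul_inv, mul_assoc]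
  congr 1
  simp only [blockSum, map_smul, smul_eq_mul, Finset.mul_sum]
  rw [Finset.sum_comm]
  refine Finset.sum_congr rfl fun k _ => Eq.trans (by rw [Finset.sum_mul])
    (Finset.sum_congr rfl fun t _ => by ring)

/-- Delta method in `L¹`: after scaling, the remainder is at most `ε N + (B / √p) N²`, where `N`,
the sum of the absolute normalised sums, is bounded in `L²`. -/
theorem tendstoInDistribution_blockValue (hφ : ∀ k, ShortRange μ (φ k) (D k))
    (h0 : ∀ k, ∫ x, φ k x ∂(noiseLaw μ) = 0) (hL0 : 0 ≤ L)
    (hL : ∀ y z, |G y - G z| ≤ L * ‖y - z‖) (hG0 : G 0 = 0) (hG' : HasFDerivAt G G' 0) {s : ℝ≥0}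
    (hs : ∑' d, autocov μ (fun x => ∑ k, G' (EuclideanSpace.single k 1) * φ k x) d = s) :
    TendstoInDistribution (blockValue G φ) atTop (id : ℝ → ℝ) (fun _ => noiseLaw μ)
      (gaussianReal 0 s) := by
  set N : ℕ → (ℤ → ℝ) → ℝ := fun p x => ∑ k, |normSum (φ k) p x| with hN
  have hNm : ∀ p, Measurable (N p) := fun p =>
    Finset.measurable_fun_sum _ fun k _ => (measurable_normSum (hφ k).measurable p).abs
  have hlinS := ShortRange.finset_sum Finset.univ
    fun k _ => (hφ k).const_mul (G' (EuclideanSpace.single k 1))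
  have hlin := hlinS.tendstoInDistribution_normSum (by
    rw [integral_finsetSum _ fun k _ => ((hφ k).memLp.integrable (by norm_num)).const_mul _]
    simp [integral_const_mul, h0]) hs
  have hGm : Measurable G := (continuous_of_abs_sub_le hL0 hL).measurable
  have hbm := measurable_blockValue (fun k => (hφ k).measurable) hGm
  refine tendstoInDistribution_of_tendstoInMeasure_sub _ _ hlin ?_ fun p => (hbm p).aemeasurable
  obtain ⟨C, hC, hNC⟩ := (sqUnifIntegrable_sum_abs_normSum hφ h0).exists_bound
    fun p => (hNm p).aestronglyMeasurable
  have hN2 : ∀ p, MemLp (N p) 2 (noiseLaw μ) := fun p =>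
    memLp_of_eLpNorm_le_ofReal (hNm p).aestronglyMeasurable (hNC p)
  refine tendstoInMeasure_of_tendsto_eLpNorm (p := 1) one_ne_zero
    (fun p => ((hbm p).sub (measurable_normSum hlinS.measurable p)).aestronglyMeasurable)
    aestronglyMeasurable_zero ?_
  simp only [sub_zero]
  refine ENNReal.tendsto_nhds_zero.2 fun δ hδ => ?_
  obtain ⟨δ', hδ'0, hδ'⟩ : ∃ δ' : ℝ, 0 < δ' ∧ ENNReal.ofReal δ' ≤ δ := by
    rcases eq_or_ne δ ∞ with rfl | hδt
    · exact ⟨1, one_pos, le_top⟩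
    · exact ⟨δ.toReal, ENNReal.toReal_pos hδ.ne' hδt, (ENNReal.ofReal_toReal hδt).le⟩
  set ε := δ' / (2 * (C + 1)) with hε
  obtain ⟨B, hB, HB⟩ := exists_abs_sub_fderiv_le hL0 hL hG0 hG' (by positivity : 0 < ε)
  have hεC : ε * C ≤ δ' / 2 := by
    rw [hε, div_mul_eq_mul_div, div_le_div_iff₀ (by positivity) (by norm_num)]
    nlinarith
  have hlim : Tendsto (fun p : ℕ => B * C ^ 2 / √(p : ℝ)) atTop (𝓝 0) :=
    Tendsto.const_div_atTop (Real.tendsto_sqrt_atTop.comp tendsto_natCast_atTop_atTop) _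
  filter_upwards [hlim.eventually_le_const (half_pos hδ'0), eventually_ge_atTop 1] with p hp hp1
  refine le_trans ?_ hδ'
  have hpR : (0 : ℝ) < √(p : ℝ) := Real.sqrt_pos.2 (by exact_mod_cast hp1)
  refine eLpNorm_one_le_ofReal (g := fun x => ε * N p x + B / √(p : ℝ) * N p x ^ 2)
    (((hN2 p).integrable (by norm_num)).const_mul _ |>.add ((hN2 p).integrable_sq.const_mul _))
    (fun x => ?_) ?_
  · rw [Pi.sub_apply, Pi.sub_apply, ← sqrt_mul_fderiv_blockMean, blockValue, ← mul_sub, abs_mul,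
      abs_of_pos hpR]
    have h2 := sqrt_mul_norm_blockMean_le φ p x
    calc √(p : ℝ) * |G (blockMean φ p x) - G' (blockMean φ p x)|
        ≤ √(p : ℝ) * (ε * ‖blockMean φ p x‖ + B * ‖blockMean φ p x‖ ^ 2) := by
          gcongr; exact HB _
      _ = ε * (√(p : ℝ) * ‖blockMean φ p x‖) +
          B / √(p : ℝ) * (√(p : ℝ) * ‖blockMean φ p x‖) ^ 2 := by field_simp
      _ ≤ _ := by gcongr
  · have h1 : ∫ x, N p x ∂(noiseLaw μ) ≤ C :=
      (integral_mono_of_nonneg (ae_of_all _ fun x => Finset.sum_nonneg fun _ _ => abs_nonneg _)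
        ((hN2 p).integrable (by norm_num)).abs (ae_of_all _ fun x => le_abs_self _)).trans
        (integral_abs_le (hNm p).aestronglyMeasurable hC (hNC p))
    have h2 := (eLpNorm_two_le_ofReal_iff (hN2 p) hC).1 (hNC p)
    rw [integral_add (((hN2 p).integrable (by norm_num)).const_mul _)
      ((hN2 p).integrable_sq.const_mul _), integral_const_mul, integral_const_mul]
    calc _ ≤ ε * C + B / √(p : ℝ) * C ^ 2 := by gcongr
      _ = ε * C + B * C ^ 2 / √(p : ℝ) := by ring
      _ ≤ δ' := by linarith

lemma abs_blockValue_sub_le (hL0 : 0 ≤ L) (hL : ∀ y z, |G y - G z| ≤ L * ‖y - z‖) (p : ℕ)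
    (x y : ℤ → ℝ) : |blockValue G φ p x - blockValue G φ p y| ≤
      L * (√(p : ℝ))⁻¹ * ∑ k, |blockSum (φ k) p x - blockSum (φ k) p y| := by
  have h1 : blockMean φ p x - blockMean φ p y =
      WithLp.toLp 2 (fun k => (p : ℝ)⁻¹ * (blockSum (φ k) p x - blockSum (φ k) p y)) := by
    ext k; simp [blockMean, mul_sub]
  have h2 : ‖blockMean φ p x - blockMean φ p y‖ ≤
      (p : ℝ)⁻¹ * ∑ k, |blockSum (φ k) p x - blockSum (φ k) p y| := by
    rw [h1]
    refine (norm_toLp_le_sum _).trans_eq ?_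
    simp only [abs_mul, ← Finset.mul_sum, abs_inv, Nat.abs_cast]
  rw [blockValue, blockValue, ← mul_sub, abs_mul, abs_of_nonneg (Real.sqrt_nonneg _),
    ← Real.sqrt_div_self, div_eq_mul_inv]
  calc _ ≤ √(p : ℝ) * (L * ((p : ℝ)⁻¹ * ∑ k, |blockSum (φ k) p x - blockSum (φ k) p y|)) := by
        gcongr
        exact (hL _ _).trans (by gcongr)
    _ = _ := by ring

omit [IsProbabilityMeasure μ] in
/-- Replacing the noise outside of a block changes the statistic of the block by `O(1 / √p)`. -/
lemma eLpNorm_blockValue_sub_le (hφ : ∀ k, ShortRange μ (φ k) (D k)) (hL0 : 0 ≤ L)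
    (hL : ∀ y z, |G y - G z| ≤ L * ‖y - z‖) (p : ℕ) (a : ℤ) {s s' : ℤ → ℕ}
    (hs : ∀ i, a < i → i ≤ a + p → s i = s' i) :
    eLpNorm (fun ω => blockValue G φ p (select s a ω) - blockValue G φ p (select s' a ω)) 2
      (copiesLaw μ) ≤ ENNReal.ofReal (L * (√(p : ℝ))⁻¹ * ∑ k, 2 * D k * zetaTwo) := by
  set d : Fin m → (ℕ × ℤ → ℝ) → ℝ := fun k ω =>
    |blockSum (φ k) p (select s a ω) - blockSum (φ k) p (select s' a ω)| with hd
  have hm : ∀ k, AEStronglyMeasurable (d k) (copiesLaw μ) := fun k => by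
    have := measurable_blockSum (hφ k).measurable p
    exact Measurable.aestronglyMeasurable (by fun_prop)
  have hdk : ∀ k, eLpNorm (d k) 2 (copiesLaw μ) ≤ ENNReal.ofReal (2 * D k * zetaTwo) := by
    intro k
    have h1 := (hφ k).eLpNorm_blockSum_sub_le p a hs
    rw [← eLpNorm_norm] at h1
    exact h1
  have hD : ∀ k ∈ Finset.univ, 0 ≤ 2 * D k * zetaTwo := fun k _ =>
    mul_nonneg (mul_nonneg zero_le_two (hφ k).nonneg) zetaTwo_nonneg
  have hc : 0 ≤ L * (√(p : ℝ))⁻¹ := by positivity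
  calc _ ≤ eLpNorm ((L * (√(p : ℝ))⁻¹) • ∑ k, d k) 2 (copiesLaw μ) := by
        refine eLpNorm_mono_real fun ω => ?_
        rw [Pi.smul_apply, Finset.sum_apply, smul_eq_mul]
        exact abs_blockValue_sub_le hL0 hL p _ _
    _ ≤ ENNReal.ofReal (L * (√(p : ℝ))⁻¹) * ∑ k, ENNReal.ofReal (2 * D k * zetaTwo) := by
        refine eLpNorm_const_smul_le.trans ?_
        rw [← ofReal_norm, Real.norm_of_nonneg hc]
        gcongr
        exact (eLpNorm_sum_le (fun k _ => hm k) (by norm_num)).trans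
          (Finset.sum_le_sum fun k _ => hdk k)
    _ = _ := by rw [← ENNReal.ofReal_sum_of_nonneg hD, ← ENNReal.ofReal_mul hc]

/-- Chebyshev's inequality for the averages over a block. -/
lemma exists_measureReal_norm_blockMean_le (hφ : ∀ k, ShortRange μ (φ k) (D k))
    (h0 : ∀ k, ∫ x, φ k x ∂(noiseLaw μ) = 0) :
    ∃ C : ℝ, ∀ a : ℝ, 0 < a → ∀ p : ℕ, 1 ≤ p →
      (noiseLaw μ).real {x | a < ‖blockMean φ p x‖} ≤ C / (p * a ^ 2) := by
  set N : ℕ → (ℤ → ℝ) → ℝ := fun p x => ∑ k, |normSum (φ k) p x| with hN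
  have hNm : ∀ p, Measurable (N p) := fun p =>
    Finset.measurable_fun_sum _ fun k _ => (measurable_normSum (hφ k).measurable p).abs
  obtain ⟨C, hC, hNC⟩ := (sqUnifIntegrable_sum_abs_normSum hφ h0).exists_bound
    fun p => (hNm p).aestronglyMeasurable
  have hN2 : ∀ p, MemLp (N p) 2 (noiseLaw μ) := fun p =>
    memLp_of_eLpNorm_le_ofReal (hNm p).aestronglyMeasurable (hNC p)
  refine ⟨C ^ 2, fun a ha p hp => ?_⟩
  have hp0 : (0 : ℝ) < p := by exact_mod_cast hp
  rw [le_div_iff₀' (by positivity)]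
  calc p * a ^ 2 * (noiseLaw μ).real {x | a < ‖blockMean φ p x‖}
      ≤ p * a ^ 2 * (noiseLaw μ).real {x | p * a ^ 2 ≤ N p x ^ 2} := by
        refine mul_le_mul_of_nonneg_left (measureReal_mono fun x hx => ?_) (by positivity)
        have h1 := sqrt_mul_norm_blockMean_le φ p x
        calc (p : ℝ) * a ^ 2 = (√(p : ℝ) * a) ^ 2 := by rw [mul_pow, Real.sq_sqrt hp0.le]
          _ ≤ N p x ^ 2 := by
            gcongr
            exact le_trans (by gcongr; exact (show a < _ from hx).le) h1
    _ ≤ ∫ x, N p x ^ 2 ∂(noiseLaw μ) :=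
        mul_meas_ge_le_integral_of_nonneg (ae_of_all _ fun x => sq_nonneg _)
          (hN2 p).integrable_sq _
    _ ≤ C ^ 2 := (eLpNorm_two_le_ofReal_iff (hN2 p) hC).1 (hNC p)

end BlockValue

/-! ### Stability of U-statistics under perturbation -/

section Comparison

variable {Ω : Type*} [MeasurableSpace Ω] {Q : Measure Ω} [IsProbabilityMeasure Q] {h : ℝ × ℝ → ℝ}
  {K d : ℝ} {b : ℕ} {W V : ℕ → Ω → ℝ}

omit [MeasurableSpace Ω] in
-- Each index enters `2 (b - 1)` ordered pairs, which leaves the weight `2 / b`. The bound is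
-- pointwise and needs no independence.
lemma LipKernel.abs_uStat_sub_le (hh : LipKernel h K) (hb : 2 ≤ b) (ω : Ω) :
    |uStat h b W ω - uStat h b V ω| ≤
      2 / (b : ℝ) * ∑ j ∈ Finset.Icc 1 b, K * |W j ω - V j ω| := by
  have hb' : (2 : ℝ) ≤ b := by exact_mod_cast hb
  have h1 := offDiagAverage_fst_add_snd hb (fun j => K * |W j ω - V j ω|) 0
  rw [add_zero] at h1
  rw [← h1, uStat, uStat, offDiagAverage, offDiagAverage, offDiagAverage, ← mul_sub,
    ← Finset.sum_sub_distrib, abs_mul,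
    abs_of_nonneg (one_div_nonneg.2 (mul_nonneg (by linarith) (by linarith)))]
  have hb1 : (0 : ℝ) ≤ 1 / ((b : ℝ) * ((b : ℝ) - 1)) :=
    one_div_nonneg.2 (mul_nonneg (by linarith) (by linarith))
  refine mul_le_mul_of_nonneg_left ((Finset.abs_sum_le_sum_abs _ _).trans
    (Finset.sum_le_sum fun p _ => ?_)) hb1
  rw [add_zero, ← mul_add]
  exact hh _ _ _ _

omit [IsProbabilityMeasure Q] in
lemma measurable_uStat (hh : Measurable h) (hW : ∀ j, Measurable (W j)) :
    Measurable (uStat h b W) :=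
  (Finset.measurable_fun_sum _ fun p _ => hh.comp ((hW p.1).prodMk (hW p.2))).const_mul _

omit [IsProbabilityMeasure Q] in
lemma LipKernel.eLpNorm_uStat_sub_le (hh : LipKernel h K) (hK : 0 ≤ K) (hb : 2 ≤ b)
    (hW : ∀ j, Measurable (W j)) (hV : ∀ j, Measurable (V j)) (hd : 0 ≤ d)
    (hWV : ∀ j, eLpNorm (fun ω => W j ω - V j ω) 2 Q ≤ ENNReal.ofReal d) :
    eLpNorm (fun ω => uStat h b W ω - uStat h b V ω) 2 Q ≤ ENNReal.ofReal (2 * K * d) := by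
  have hb' : (2 : ℝ) ≤ b := by exact_mod_cast hb
  have hc : 0 ≤ 2 * K / (b : ℝ) := by positivity
  have hD : ∀ j, eLpNorm (fun ω => |W j ω - V j ω|) 2 Q ≤ ENNReal.ofReal d := fun j => by
    have h1 := hWV j
    rw [← eLpNorm_norm] at h1
    exact h1
  calc _ ≤ eLpNorm ((2 * K / (b : ℝ)) •
        ∑ j ∈ Finset.Icc 1 b, fun ω => |W j ω - V j ω|) 2 Q := by
        refine eLpNorm_mono_real fun ω => ?_
        rw [Pi.smul_apply, Finset.sum_apply, smul_eq_mul]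
        refine (hh.abs_uStat_sub_le hb ω).trans_eq ?_
        rw [← Finset.mul_sum]; ring
    _ ≤ ENNReal.ofReal (2 * K / (b : ℝ)) * ∑ j ∈ Finset.Icc 1 b, ENNReal.ofReal d := by
        refine eLpNorm_const_smul_le.trans ?_
        rw [← ofReal_norm, Real.norm_of_nonneg hc]
        gcongr
        refine (eLpNorm_sum_le (fun j _ => ?_) (by norm_num)).trans
          (Finset.sum_le_sum fun j _ => hD j)
        exact ((hW j).sub (hV j)).abs.aestronglyMeasurable
    _ = _ := by
        rw [← ENNReal.ofReal_sum_of_nonneg fun _ _ => hd, ← ENNReal.ofReal_mul hc,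
          Finset.sum_const, Nat.card_Icc, Nat.add_sub_cancel, nsmul_eq_mul]
        congr 1
        field_simp

omit [IsProbabilityMeasure Q] in
lemma uStatMean_eq_integral (hi : ∀ j k, Integrable (fun ω => h (W j ω, W k ω)) Q) :
    uStatMean Q h b W = ∫ ω, uStat h b W ω ∂Q := by
  simp only [uStatMean, uStat, offDiagAverage]
  rw [integral_const_mul, integral_finsetSum _ fun p _ => hi p.1 p.2]

lemma LipKernel.memLp_comp (hh : LipKernel h K) (hK : 0 ≤ K) {X Y : Ω → ℝ} (hX : MemLp X 2 Q)
    (hY : MemLp Y 2 Q) : MemLp (fun ω => h (X ω, Y ω)) 2 Q := by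
  refine MemLp.of_le (g := fun ω => K * (|X ω| + |Y ω|) + |h (0, 0)|)
    (((hX.abs.add hY.abs).const_mul K).add (memLp_const _))
    (((hh.continuous hK).comp_aestronglyMeasurable (hX.1.prodMk hY.1))) (ae_of_all _ fun ω => ?_)
  rw [Real.norm_eq_abs, Real.norm_of_nonneg (by positivity)]
  exact hh.abs_le le_rfl _ _

/-- The means differ by at most the `L²` distance of the statistics, so centring only doubles the
bound `2 * K * d`. -/
lemma LipKernel.eLpNorm_centred_uStat_sub_le (hh : LipKernel h K) (hK : 0 ≤ K) (hb : 2 ≤ b)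
    (hW : ∀ j, Measurable (W j)) (hV : ∀ j, Measurable (V j)) (hW2 : ∀ j, MemLp (W j) 2 Q)
    (hV2 : ∀ j, MemLp (V j) 2 Q) (hd : 0 ≤ d)
    (hWV : ∀ j, eLpNorm (fun ω => W j ω - V j ω) 2 Q ≤ ENNReal.ofReal d) :
    eLpNorm (fun ω => (uStat h b W ω - uStatMean Q h b W) - (uStat h b V ω - uStatMean Q h b V)) 2 Q
      ≤ ENNReal.ofReal (4 * K * d) := by
  have hhm := (hh.continuous hK).measurable
  have hUW := measurable_uStat (b := b) hhm hW
  have hUV := measurable_uStat (b := b) hhm hV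
  have hdiff := hh.eLpNorm_uStat_sub_le hK hb hW hV hd hWV
  have hi : ∀ {W : ℕ → Ω → ℝ}, (∀ j, MemLp (W j) 2 Q) →
      ∀ j k, Integrable (fun ω => h (W j ω, W k ω)) Q := fun hW2 j k =>
    (hh.memLp_comp hK (hW2 j) (hW2 k)).integrable (by norm_num)
  have hiU : ∀ {W : ℕ → Ω → ℝ}, (∀ j, MemLp (W j) 2 Q) → Integrable (uStat h b W) Q := fun hW2 =>
    (integrable_finsetSum _ fun p _ => hi hW2 p.1 p.2).const_mul _
  have hmean : |uStatMean Q h b W - uStatMean Q h b V| ≤ 2 * K * d := by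
    rw [uStatMean_eq_integral (hi hW2), uStatMean_eq_integral (hi hV2),
      ← integral_sub (hiU hW2) (hiU hV2)]
    exact (abs_integral_le_integral_abs).trans
      (integral_abs_le (hUW.sub hUV).aestronglyMeasurable (by positivity) hdiff)
  have h1 : (fun ω => (uStat h b W ω - uStatMean Q h b W) - (uStat h b V ω - uStatMean Q h b V)) =
      (fun ω => uStat h b W ω - uStat h b V ω) -
        fun _ => uStatMean Q h b W - uStatMean Q h b V := by
    ext ω; simp only [Pi.sub_apply]; ring
  rw [h1]
  refine (eLpNorm_sub_le (hUW.sub hUV).aestronglyMeasurable (by fun_prop) (by norm_num)).trans ?_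
  have h2 : eLpNorm (fun _ : Ω => uStatMean Q h b W - uStatMean Q h b V) 2 Q ≤
      ENNReal.ofReal (2 * K * d) := by
    rw [eLpNorm_const _ (by simp) (NeZero.ne _), measure_univ, ENNReal.one_rpow, mul_one,
      ← ofReal_norm]
    exact ENNReal.ofReal_le_ofReal hmean
  refine (add_le_add hdiff h2).trans_eq ?_
  rw [← ENNReal.ofReal_add (by positivity) (by positivity)]
  ring_nf

end Comparison

/-! ### From independent to dependent blocks -/

section DependentBlocks

variable {m : ℕ} {μ : Measure ℝ} [IsProbabilityMeasure μ] {φ : Fin m → (ℤ → ℝ) → ℝ} {D : Fin m → ℝ}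
  {G : EuclideanSpace ℝ (Fin m) → ℝ} {G' : EuclideanSpace ℝ (Fin m) →L[ℝ] ℝ} {L K : ℝ}
  {h : ℝ × ℝ → ℝ}

/-- The statistic of the `j`-th block of length `p`. -/
noncomputable def shiftedBlockValue (G : EuclideanSpace ℝ (Fin m) → ℝ)
    (φ : Fin m → (ℤ → ℝ) → ℝ) (p j : ℕ) (x : ℤ → ℝ) : ℝ :=
  blockValue G φ p (shift (blockStart p j) x)

/-- Central limit theorem for `U`-statistics of the block statistics of a short-range dependent
process. -/
theorem LipKernel.tendstoInDistribution_uStat_blocks (hh : LipKernel h K) (hK : 0 ≤ K)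
    (hsymm : ∀ x y, h (x, y) = h (y, x)) (hφ : ∀ k, ShortRange μ (φ k) (D k))
    (h0 : ∀ k, ∫ x, φ k x ∂(noiseLaw μ) = 0) (hL0 : 0 ≤ L)
    (hL : ∀ y z, |G y - G z| ≤ L * ‖y - z‖) (hG0 : G 0 = 0) (hG' : HasFDerivAt G G' 0) {σ : ℝ}
    (hσ : ∑' d, autocov μ (fun x => ∑ k, G' (EuclideanSpace.single k 1) * φ k x) d = σ ^ 2)
    {b ℓ : ℕ → ℕ} (hb : Tendsto b atTop atTop) (hℓ : Tendsto ℓ atTop atTop)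
    (hbℓ : Tendsto (fun n => (b n : ℝ) / (ℓ n : ℝ)) atTop (𝓝 0)) {v : ℝ≥0}
    (hv : (v : ℝ) = 4 * gaussianKernelCov h σ) :
    TendstoInDistribution
      (fun n x => √(b n : ℝ) * (uStat h (b n) (shiftedBlockValue G φ (ℓ n)) x -
        uStatMean (noiseLaw μ) h (b n) (shiftedBlockValue G φ (ℓ n)))) atTop
      (id : ℝ → ℝ) (fun _ => noiseLaw μ) (gaussianReal 0 v) := by
  have hhm := (hh.continuous hK).measurable
  have hGm : Measurable G := (continuous_of_abs_sub_le hL0 hL).measurable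
  have hbm := measurable_blockValue (fun k => (hφ k).measurable) hGm
  have hUI := sqUnifIntegrable_blockValue hφ h0 hL0 hL hG0
  obtain ⟨C, hC, hBC⟩ := hUI.exists_bound fun p => (hbm p).aestronglyMeasurable
  have hb2 : ∀ p, MemLp (blockValue G φ p) 2 (noiseLaw μ) := fun p =>
    memLp_of_eLpNorm_le_ofReal (hbm p).aestronglyMeasurable (hBC p)
  have hlim := tendstoInDistribution_blockValue hφ h0 hL0 hL hG0 hG' (s := (σ ^ 2).toNNReal)
    (by rw [hσ, Real.coe_toNNReal _ (sq_nonneg σ)])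
  set W : ℕ → ℕ → (ℤ → ℝ) → ℝ := fun n => shiftedBlockValue G φ (ℓ n) with hW
  have hWm : ∀ n j, Measurable (W n j) := fun n j => (hbm (ℓ n)).comp (measurable_shift _)
  -- Independent substitutes: block `j` keeps the common noise inside and receives its own copy
  -- outside.
  set ξ : ℕ → ℕ → (ℕ × ℤ → ℝ) → ℝ := fun n j ω =>
    blockValue G φ (ℓ n) (select (blockCopy (ℓ n) j) (blockStart (ℓ n) j) ω) with hξ
  have hξm : ∀ n j, Measurable (ξ n j) := fun n j => (hbm (ℓ n)).comp (measurable_select _ _)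
  have hξid : ∀ n j, IdentDistrib (ξ n j) (blockValue G φ (ℓ n)) (copiesLaw μ) (noiseLaw μ) :=
    fun n j => ⟨(hξm n j).aemeasurable, (hbm _).aemeasurable, by
      rw [← (measurePreserving_select (μ := μ) (blockCopy (ℓ n) j) (blockStart (ℓ n) j)).map_eq,
        Measure.map_map (hbm _) (measurable_select _ _)]
      rfl⟩
  have hind := hh.tendstoInDistribution_uStat hK hsymm (fun n => hbm (ℓ n))
    (fun ε hε => let ⟨c, hc, H⟩ := hUI ε hε; ⟨c, hc, fun n => H (ℓ n)⟩)
    (Real.coe_toNNReal _ (sq_nonneg σ))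
    ⟨fun n => hlim.forall_aemeasurable (ℓ n), hlim.aemeasurable_limit, hlim.tendsto.comp hℓ⟩
    hb hξm (fun n => (iIndepFun_blockCopy (ℓ n)).comp (fun _ => blockValue G φ (ℓ n))
      fun _ => hbm _) hξid hv
  have hT := measurePreserving_select (μ := μ) (fun _ => 0) 0
  rw [← tendstoInDistribution_comp_iff hT fun n =>
    ((measurable_uStat hhm (hWm n)).sub_const _).const_mul _]
  set W' : ℕ → ℕ → (ℕ × ℤ → ℝ) → ℝ := fun n j ω => W n j (select (fun _ => 0) 0 ω) with hW'
  have hW'm : ∀ n j, Measurable (W' n j) := fun n j => (hWm n j).comp (measurable_select _ _)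
  have hmean : ∀ n, uStatMean (noiseLaw μ) h (b n) (W n) =
      uStatMean (copiesLaw μ) h (b n) (W' n) := fun n => by
    refine offDiagAverage_congr fun j _ k _ _ => ?_
    exact (integral_comp_of_measurePreserving (g := fun x => h (W n j x, W n k x)) hT
      (hhm.comp ((hWm n j).prodMk (hWm n k))).aestronglyMeasurable).symm
  refine tendstoInDistribution_of_tendstoInMeasure_sub _ _ hind ?_ fun n =>
    ((((measurable_uStat hhm (hWm n)).sub_const _).const_mul _).comp
      (measurable_select _ _)).aemeasurable
  set M := L * ∑ k, 2 * D k * zetaTwo with hM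
  have hD := fun k => (hφ k).nonneg
  have hz := zetaTwo_nonneg
  have hM0 : 0 ≤ M := mul_nonneg hL0 (Finset.sum_nonneg fun k _ => by have := hD k; positivity)
  have hclose : ∀ n j, eLpNorm (fun ω => W' n j ω - ξ n j ω) 2 (copiesLaw μ) ≤
      ENNReal.ofReal (M * (√(ℓ n : ℝ))⁻¹) := fun n j => by
    have h1 := eLpNorm_blockValue_sub_le hφ hL0 hL (ℓ n) (blockStart (ℓ n) j) (s := fun _ => 0)
      (s' := blockCopy (ℓ n) j) fun i hi hi' => (blockCopy_of_mem hi hi').symm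
    have h2 : ∀ ω, W' n j ω = blockValue G φ (ℓ n) (select (fun _ => 0) (blockStart (ℓ n) j) ω) :=
      fun ω => by
        change blockValue G φ (ℓ n) (shift (blockStart (ℓ n) j) (select _ 0 ω)) = _
        rw [shift_select, zero_add]
    simp_rw [h2]
    exact h1.trans_eq (by rw [hM, mul_right_comm])
  -- The factor `√b` meets a coupling error of order `1 / √ℓ`; this is where `b / ℓ → 0` is
  -- required.
  have hu : Tendsto (fun n => 4 * K * M * √((b n : ℝ) / ℓ n)) atTop (𝓝 0) := by
    simpa using hbℓ.sqrt.const_mul (4 * K * M)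
  refine tendstoInMeasure_zero_of_eLpNorm_le (p := 2) (by norm_num) (fun n => ?_) hu ?_
  · exact (((((measurable_uStat hhm (hWm n)).sub_const _).const_mul _).comp
      (measurable_select _ _)).sub
      (((measurable_uStat hhm (hξm n)).sub_const _).const_mul _)).aestronglyMeasurable
  filter_upwards [hb.eventually_ge_atTop 2] with n hn
  have h1 := hh.eLpNorm_centred_uStat_sub_le hK hn (hW'm n) (hξm n)
    (fun j => (hb2 (ℓ n)).comp_measurePreserving ((measurePreserving_shift _).comp hT))
    (fun j => (hb2 (ℓ n)).comp_measurePreserving (measurePreserving_select _ _)) (by positivity)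
    (hclose n)
  calc _ = eLpNorm (√(b n : ℝ) • fun ω => (uStat h (b n) (W' n) ω -
        uStatMean (copiesLaw μ) h (b n) (W' n)) -
        (uStat h (b n) (ξ n) ω - uStatMean (copiesLaw μ) h (b n) (ξ n))) 2 (copiesLaw μ) := by
        congr 1
        ext ω
        rw [← hmean]
        simp only [Pi.sub_apply, Pi.smul_apply, smul_eq_mul, mul_sub]
        rfl
    _ ≤ ENNReal.ofReal √(b n : ℝ) * ENNReal.ofReal (4 * K * (M * (√(ℓ n : ℝ))⁻¹)) := by
        refine eLpNorm_const_smul_le.trans ?_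
        rw [← ofReal_norm, Real.norm_of_nonneg (Real.sqrt_nonneg _)]
        gcongr
    _ = _ := by
        rw [← ENNReal.ofReal_mul (Real.sqrt_nonneg _), Real.sqrt_div (Nat.cast_nonneg _)]
        congr 1
        ring

end DependentBlocks

/-! ### The cut-off function -/

section Cutoff

variable {m : ℕ} {g η : EuclideanSpace ℝ (Fin m) → ℝ} {v₀ : EuclideanSpace ℝ (Fin m)} {a : ℝ}

lemma ball_subset_openCube (v₀ : EuclideanSpace ℝ (Fin m)) (r : ℝ) :
    Metric.ball v₀ r ⊆ openCube v₀ r := by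
  intro x hx k
  have h1 : |x k - v₀ k| < r := (PiLp.norm_apply_le (x - v₀) k).trans_lt (mem_ball_iff_norm.1 hx)
  rw [abs_lt] at h1
  exact ⟨by linarith [h1.1], by linarith [h1.2]⟩

/-- Continuity along the ray from `v₀` through `x` adds the sphere of radius `2 * a`; thus `η`
vanishes off the open ball, on which `g` is controlled. -/
lemma eq_zero_of_le_norm_sub (ha : 0 < a) (hη : Continuous η)
    (hη_zero : ∀ x, 2 * a < ‖x - v₀‖ → η x = 0) {x : EuclideanSpace ℝ (Fin m)}
    (hx : 2 * a ≤ ‖x - v₀‖) : η x = 0 := by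
  have hc : Continuous fun t : ℝ => η (v₀ + t • (x - v₀)) := by fun_prop
  have h1 : Tendsto (fun t : ℝ => η (v₀ + t • (x - v₀))) (𝓝[>] 1) (𝓝 (η x)) := by
    have := (hc.tendsto 1).mono_left (nhdsWithin_le_nhds (s := Set.Ioi 1))
    simpa using this
  refine tendsto_nhds_unique (h1.congr' ?_) tendsto_const_nhds
  filter_upwards [self_mem_nhdsWithin] with t ht
  refine hη_zero _ ?_
  have ht' : (1 : ℝ) < t := ht
  rw [add_sub_cancel_left, norm_smul, Real.norm_of_nonneg (by linarith)]
  nlinarith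

/-- The product of a function that is Lipschitz near `v₀` and a smooth cut-off is Lipschitz. -/
lemma exists_abs_mul_cutoff_sub_le (ha : 0 < a) (hg_zero : g v₀ = 0)
    (hg_diff : ∀ x ∈ openCube v₀ (2 * a), DifferentiableAt ℝ g x)
    (hg_grad : ∃ C : ℝ, ∀ x ∈ openCube v₀ (2 * a), ‖gradient g x‖ ≤ C)
    (hη_smooth : ContDiff ℝ (⊤ : ℕ∞) η) (hη_range : ∀ x, η x ∈ Set.Icc (0 : ℝ) 1)
    (hη_zero : ∀ x, 2 * a < ‖x - v₀‖ → η x = 0) :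
    ∃ L : ℝ, 0 ≤ L ∧ ∀ x y, |g x * η x - g y * η y| ≤ L * ‖x - y‖ := by
  obtain ⟨C, hC⟩ := hg_grad
  have hsub := ball_subset_openCube v₀ (2 * a)
  have hv : v₀ ∈ Metric.ball v₀ (2 * a) := Metric.mem_ball_self (by positivity)
  have hC0 : 0 ≤ C := (norm_nonneg _).trans (hC v₀ (hsub hv))
  have hg : ∀ x ∈ Metric.ball v₀ (2 * a), ∀ y ∈ Metric.ball v₀ (2 * a),
      |g x - g y| ≤ C * ‖x - y‖ := fun x hx y hy =>
    Convex.norm_image_sub_le_of_norm_fderiv_le (𝕜 := ℝ) (fun z hz => hg_diff z (hsub hz))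
      (fun z hz => by
        have := hC z (hsub hz)
        rwa [gradient, LinearIsometryEquiv.norm_map] at this) (convex_ball v₀ (2 * a)) hy hx
  have hgb : ∀ x ∈ Metric.ball v₀ (2 * a), |g x| ≤ C * (2 * a) := fun x hx => by
    have h1 := hg x hx v₀ hv
    rw [hg_zero, sub_zero] at h1
    exact h1.trans (by gcongr; exact (mem_ball_iff_norm.1 hx).le)
  obtain ⟨B, hB⟩ := ContDiff.lipschitzWith_of_hasCompactSupport (𝕂 := ℝ)
    (HasCompactSupport.intro (isCompact_closedBall v₀ (2 * a)) fun x hx =>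
      hη_zero x (by simpa [dist_eq_norm] using hx)) hη_smooth (by simp)
  have hη : ∀ x y, |η x - η y| ≤ B * ‖x - y‖ := fun x y => by
    simpa [Real.dist_eq, dist_eq_norm] using hB.dist_le_mul x y
  have hout : ∀ x, x ∉ Metric.ball v₀ (2 * a) → η x = 0 := fun x hx =>
    eq_zero_of_le_norm_sub ha hη_smooth.continuous hη_zero
      (by simpa [dist_eq_norm] using hx)
  have hmix : ∀ x ∈ Metric.ball v₀ (2 * a), ∀ y,
      |g x| * |η x - η y| ≤ C * (2 * a) * B * ‖x - y‖ := fun x hx y => by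
    rw [mul_assoc]
    exact mul_le_mul (hgb x hx) (hη x y) (abs_nonneg _) (by positivity)
  have hone : ∀ x ∈ Metric.ball v₀ (2 * a), ∀ y,
      |g x * η x - g y * η y| ≤ (C * (2 * a) * B + C) * ‖x - y‖ := by
    intro x hx y
    by_cases hy : y ∈ Metric.ball v₀ (2 * a)
    · have h1 : g x * η x - g y * η y = g x * (η x - η y) + (g x - g y) * η y := by ring
      have h2 : |η y| ≤ 1 := abs_le.2 ⟨by linarith [(hη_range y).1], (hη_range y).2⟩
      rw [h1, add_mul]
      refine (abs_add_le _ _).trans (add_le_add ?_ ?_)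
      · rw [abs_mul]; exact hmix x hx y
      · rw [abs_mul]
        exact (mul_le_of_le_one_right (abs_nonneg _) h2).trans (hg x hx y hy)
    -- Nothing is known about `g y` here, but `η y = 0` turns `g x * η x` into `g x * (η x - η y)`.
    · have h1 := hmix x hx y
      rw [hout y hy, sub_zero, ← abs_mul] at h1
      rw [hout y hy, mul_zero, sub_zero, add_mul]
      exact h1.trans (le_add_of_nonneg_right (by positivity))
  refine ⟨C * (2 * a) * B + C, by positivity, fun x y => ?_⟩
  by_cases hx : x ∈ Metric.ball v₀ (2 * a)
  · exact hone x hx y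
  by_cases hy : y ∈ Metric.ball v₀ (2 * a)
  · rw [abs_sub_comm, norm_sub_rev]; exact hone y hy x
  · rw [hout x hx, hout y hy]; simp; positivity

lemma hasFDerivAt_mul_cutoff (ha : 0 < a) (hg : DifferentiableAt ℝ g v₀)
    (hη_one : ∀ x, ‖x - v₀‖ ≤ a → η x = 1) :
    HasFDerivAt (fun y => g (v₀ + y) * η (v₀ + y)) (fderiv ℝ g v₀) 0 := by
  rw [hasFDerivAt_comp_add_left (f := fun x => g x * η x), add_zero]
  refine hg.hasFDerivAt.congr_of_eventuallyEq ?_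
  filter_upwards [Metric.ball_mem_nhds v₀ ha] with x hx
  rw [hη_one x (mem_ball_iff_norm.1 hx).le, mul_one]

end Cutoff

/-! ### Block statistics as functionals of the noise -/

section MomentFunctional

lemma sum_block (u : ℤ → ℝ) (ℓ j : ℕ) :
    ∑ t ∈ block ℓ j, u t = ∑ i ∈ Finset.range ℓ, u (blockStart ℓ j + ((i : ℤ) + 1)) := by
  have h1 : (j : ℤ) * ℓ = blockStart ℓ j + ℓ := by unfold blockStart; ring
  have h2 : block ℓ j = Finset.Icc (blockStart ℓ j + 1) (blockStart ℓ j + ℓ) := by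
    rw [block, h1]; rfl
  rw [h2]
  refine Finset.sum_nbij' (fun t => (t - blockStart ℓ j - 1).toNat)
    (fun i => blockStart ℓ j + ((i : ℤ) + 1)) ?_ ?_ ?_ ?_ ?_
  · intro t ht; simp only [Finset.mem_Icc, Finset.mem_range] at ht ⊢; omega
  · intro i hi; simp only [Finset.mem_Icc, Finset.mem_range] at hi ⊢; omega
  · intro t ht; simp only [Finset.mem_Icc] at ht; omega
  · intro i hi; omega
  · intro t ht; simp only [Finset.mem_Icc] at ht; congr 1; omega

/-- The centred power of order `k + 1` of the process at time `0`, as a function of the noise. -/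
def centredPower {m : ℕ} (f : (ℤ → ℝ) → ℝ) (v : EuclideanSpace ℝ (Fin m)) (k : Fin m)
    (x : ℤ → ℝ) : ℝ :=
  f (fun u => x (-u)) ^ ((k : ℕ) + 1) - v k

variable {Ω : Type*} [MeasurableSpace Ω] {P : Measure Ω} {ε : ℤ → Ω → ℝ} {f : (ℤ → ℝ) → ℝ} {m : ℕ}

omit [MeasurableSpace Ω] in
lemma bernoulliShift_pow_eq (v : EuclideanSpace ℝ (Fin m)) (k : Fin m) (t : ℤ) (ω : Ω) :
    bernoulliShift f ε t ω ^ ((k : ℕ) + 1) =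
      centredPower f v k (shift t fun u => ε u ω) + v k := by
  rw [centredPower, sub_add_cancel]
  simp only [shift, bernoulliShift, sub_eq_add_neg]

omit [MeasurableSpace Ω] in
lemma blockMoments_eq (v : EuclideanSpace ℝ (Fin m)) {ℓ : ℕ} (hℓ : ℓ ≠ 0) (j : ℕ) (ω : Ω) :
    blockMoments (bernoulliShift f ε) m ℓ j ω =
      v + blockMean (centredPower f v) ℓ (shift (blockStart ℓ j) fun u => ε u ω) := by
  have hℓ' : (ℓ : ℝ) ≠ 0 := by exact_mod_cast hℓ
  ext k
  simp only [blockMoments, blockMean, PiLp.add_apply]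
  rw [sum_block fun t => bernoulliShift f ε t ω ^ ((k : ℕ) + 1)]
  simp only [bernoulliShift_pow_eq v, blockSum, shift_shift, Finset.sum_add_distrib,
    Finset.sum_const, Finset.card_range, nsmul_eq_mul]
  field_simp
  ring

omit [MeasurableSpace Ω] in
lemma blockStat_eq (g : EuclideanSpace ℝ (Fin m) → ℝ) (v : EuclideanSpace ℝ (Fin m)) (ℓ j : ℕ)
    (ω : Ω) : blockStat g (bernoulliShift f ε) ℓ j ω =
      shiftedBlockValue (fun y => g (v + y)) (centredPower f v) ℓ j fun u => ε u ω := by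
  -- An empty block has average `0`, so `blockMoments_eq` is not available for `ℓ = 0`; there both
  -- sides vanish through the factor `√ℓ`.
  rcases eq_or_ne ℓ 0 with rfl | hℓ
  · simp [blockStat, shiftedBlockValue, blockValue]
  · rw [blockStat, blockMoments_eq v hℓ, shiftedBlockValue, blockValue]

variable [IsProbabilityMeasure P]

lemma memLp_pow_of_integrable {α : Type*} [MeasurableSpace α] {κ : Measure α}
    [IsFiniteMeasure κ] {F : α → ℝ} (hF : Measurable F) {m k : ℕ}
    (hi : Integrable (fun x => F x ^ (2 * m)) κ) (hk : k ≤ m) : MemLp (fun x => F x ^ k) 2 κ := by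
  rw [memLp_two_iff_integrable_sq (hF.pow_const k).aestronglyMeasurable]
  refine ((integrable_const (1 : ℝ)).add hi).mono'
    ((hF.pow_const k).pow_const 2).aestronglyMeasurable (ae_of_all _ fun x => ?_)
  rw [Real.norm_of_nonneg (sq_nonneg _), Pi.add_apply, pow_mul, ← pow_mul, mul_comm k 2, pow_mul]
  have h0 := sq_nonneg (F x)
  rcases le_total (F x ^ 2) 1 with h1 | h1
  · exact (pow_le_one₀ h0 h1).trans (le_add_of_nonneg_right (by positivity))
  · exact (pow_le_pow_right₀ h1 hk).trans (le_add_of_nonneg_left zero_le_one)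

/-- The centred powers of a Bernoulli shift with summable physical dependence. -/
lemma exists_shortRange_centredPower (hε_meas : ∀ u, Measurable (ε u)) (hε_indep : iIndepFun ε P)
    (hε_ident : ∀ u, IdentDistrib (ε u) (ε 0) P P) (hf : Measurable f)
    (hX_moment : Integrable (fun ω => bernoulliShift f ε 1 ω ^ (2 * m)) P)
    (hX_dep : ∑' i : ℤ, ∑ k ∈ Finset.Icc 1 m,
      ENNReal.ofReal ((i : ℝ) ^ 2) * physicalDependence P (fun s => f s ^ k) ε i < ∞) :
    (∀ k, ∃ D, ShortRange (P.map (ε 0))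
      (centredPower f (momentVector P (bernoulliShift f ε) m) k) D) ∧
    ∀ k, ∫ x, centredPower f (momentVector P (bernoulliShift f ε) m) k x
      ∂(noiseLaw (P.map (ε 0))) = 0 := by
  have : IsProbabilityMeasure (P.map (ε 0)) :=
    Measure.isProbabilityMeasure_map (hε_meas 0).aemeasurable
  set F : (ℤ → ℝ) → ℝ := fun x => f (fun u => x (-u)) with hF
  have hFm : Measurable F := by fun_prop
  have hN1 : MeasurePreserving (fun ω => shift 1 fun u => ε u ω) P (noiseLaw (P.map (ε 0))) :=
    (measurePreserving_shift 1).comp (measurePreserving_noise hε_meas hε_indep hε_ident)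
  have hX1 : ∀ ω, bernoulliShift f ε 1 ω = F (shift 1 fun u => ε u ω) := fun ω => by
    simp only [hF, shift, bernoulliShift, sub_eq_add_neg]
  have hi : Integrable (fun x => F x ^ (2 * m)) (noiseLaw (P.map (ε 0))) := by
    rw [← hN1.integrable_comp (hFm.pow_const _).aestronglyMeasurable]
    simpa only [hX1, Function.comp_def] using hX_moment
  have hmem : ∀ k : Fin m, MemLp (fun x => F x ^ ((k : ℕ) + 1)) 2 (noiseLaw (P.map (ε 0))) :=
    fun k => memLp_pow_of_integrable hFm hi k.2
  refine ⟨fun k => ?_, fun k => ?_⟩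
  · have h1 := singleSiteBound_physicalDependence hε_meas hε_indep hε_ident
      (F := fun s => f s ^ ((k : ℕ) + 1)) (hf.pow_const _)
    refine ⟨_, (h1.shortRange (hFm.pow_const _) (hmem k) ?_).sub_const _⟩
    refine ((ENNReal.tsum_le_tsum fun i => ?_).trans_lt hX_dep).ne
    exact Finset.single_le_sum (f := fun k => ENNReal.ofReal ((i : ℝ) ^ 2) *
      physicalDependence P (fun s => f s ^ k) ε i) (fun _ _ => zero_le)
      (Finset.mem_Icc.2 ⟨by omega, k.2⟩)
  · have h1 : ∫ x, F x ^ ((k : ℕ) + 1) ∂(noiseLaw (P.map (ε 0))) =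
        momentVector P (bernoulliShift f ε) m k := by
      rw [← integral_comp_of_measurePreserving hN1 (hFm.pow_const _).aestronglyMeasurable]
      simp only [momentVector, hX1]
    change ∫ x, (F x ^ ((k : ℕ) + 1) - _) ∂_ = 0
    rw [integral_sub ((hmem k).integrable (by norm_num)) (integrable_const _), h1]
    simp

/-- The linearised process is the centred linear functional of the shifted noise plus the constant
`κ`, which the covariance ignores. -/
lemma covariance_linearised (hε_meas : ∀ u, Measurable (ε u)) (hε_indep : iIndepFun ε P)
    (hε_ident : ∀ u, IdentDistrib (ε u) (ε 0) P P) {v : EuclideanSpace ℝ (Fin m)} {D : Fin m → ℝ}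
    (hφ : ∀ k, ShortRange (P.map (ε 0)) (centredPower f v k) (D k))
    (h0 : ∀ k, ∫ x, centredPower f v k x ∂(noiseLaw (P.map (ε 0))) = 0)
    (g : EuclideanSpace ℝ (Fin m) → ℝ) (t : ℤ) :
    cov[linearised g v (bernoulliShift f ε) 0, linearised g v (bernoulliShift f ε) t; P] =
      autocov (P.map (ε 0)) (fun x => ∑ k, partialDeriv g v k * centredPower f v k x) t := by
  have : IsProbabilityMeasure (P.map (ε 0)) :=
    Measure.isProbabilityMeasure_map (hε_meas 0).aemeasurable
  have hN := measurePreserving_noise hε_meas hε_indep hε_ident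
  set lin : (ℤ → ℝ) → ℝ := fun x => ∑ k, partialDeriv g v k * centredPower f v k x with hlin
  have hφm := fun k => (hφ k).measurable
  have hm : Measurable lin := by fun_prop
  have hli : Integrable lin (noiseLaw (P.map (ε 0))) := integrable_finsetSum _ fun k _ =>
    ((hφ k).memLp.integrable (by norm_num)).const_mul _
  set κ : ℝ := ∑ k, partialDeriv g v k * v k with hκ
  have hY : ∀ t ω, linearised g v (bernoulliShift f ε) t ω =
      lin (shift t fun u => ε u ω) + κ := fun t ω => by
    simp only [linearised, bernoulliShift_pow_eq v, hlin, hκ, ← Finset.sum_add_distrib, mul_add]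
  have hmean : ∀ t, ∫ ω, linearised g v (bernoulliShift f ε) t ω ∂P = κ := fun t => by
    have hT : MeasurePreserving (fun ω => shift t fun u => ε u ω) P
        (noiseLaw (P.map (ε 0))) := (measurePreserving_shift t).comp hN
    simp_rw [hY]
    rw [integral_add (by exact hT.integrable_comp_of_integrable hli) (integrable_const _),
      integral_comp_of_measurePreserving (g := lin) hT hm.aestronglyMeasurable]
    simp only [hlin]
    rw [integral_finsetSum _ fun k _ => ((hφ k).memLp.integrable (by norm_num)).const_mul _]
    simp [integral_const_mul, h0]
  rw [covariance, hmean, hmean, autocov]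
  simp only [hY, add_sub_cancel_right]
  have h1 : ∀ x : ℤ → ℝ, shift 0 x = x := fun x => by ext v; simp [shift]
  simp only [h1]
  exact integral_comp_of_measurePreserving (g := fun x => lin x * lin (shift t x)) hN
    (hm.mul (hm.comp (measurable_shift t))).aestronglyMeasurable

end MomentFunctional

/-- No moments are involved: without the cut-off the block statistics contain uncontrolled values of
`g` and need not be integrable, so the comparison rests on an event alone. -/
lemma tendstoInMeasure_zero_of_measureReal {α : Type*} [MeasurableSpace α] {Q : Measure α}
    [IsFiniteMeasure Q] {f : ℕ → α → ℝ} {S : ℕ → Set α} {u : ℕ → ℝ} (hu : Tendsto u atTop (𝓝 0))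
    (hS : ∀ᶠ n in atTop, Q.real (S n) ≤ u n) (hf : ∀ᶠ n in atTop, ∀ x ∉ S n, f n x = 0) :
    TendstoInMeasure Q f atTop 0 := by
  intro ε hε
  have hu' : Tendsto (fun n => ENNReal.ofReal (u n)) atTop (𝓝 0) := by
    simpa using ENNReal.tendsto_ofReal hu
  refine tendsto_of_tendsto_of_tendsto_of_le_of_le' tendsto_const_nhds hu'
    (Eventually.of_forall fun _ => zero_le) ?_
  filter_upwards [hS, hf] with n h1 h2
  calc Q {x | ε ≤ edist (f n x) ((0 : α → ℝ) x)} ≤ Q (S n) := by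
        refine measure_mono fun x hx => ?_
        by_contra hxS
        have hx' : ε ≤ edist (f n x) ((0 : α → ℝ) x) := hx
        rw [h2 x hxS, Pi.zero_apply, edist_self] at hx'
        exact hε.not_ge hx'
    _ ≤ ENNReal.ofReal (u n) := by
        rw [← ofReal_measureReal]
        exact ENNReal.ofReal_le_ofReal h1

end BlockUStat

/-! ### Assembly on the original space and removal of the cut-off -/

theorem theorem2 {Ω : Type*} [MeasurableSpace Ω] (P : Measure Ω) [IsProbabilityMeasure P]
    -- the i.i.d. noise and the Bernoulli shift
    (ε : ℤ → Ω → ℝ) (hε_meas : ∀ u, Measurable (ε u)) (hε_indep : iIndepFun ε P)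
    (hε_ident : ∀ u, IdentDistrib (ε u) (ε 0) P P)
    (f : (ℤ → ℝ) → ℝ) (hf : Measurable f)
    (X : ℤ → Ω → ℝ) (hX : X = bernoulliShift f ε)
    -- the kernel
    (h : ℝ × ℝ → ℝ) (h_symm : ∀ x y, h (x, y) = h (y, x)) (h_lip : ∃ K : ℝ≥0, LipschitzWith K h)
    -- moments and weak dependence
    (m : ℕ) (hX_moment : Integrable (fun ω => X 1 ω ^ (2 * m)) P)
    (hX_dep : ∑' i : ℤ, ∑ k ∈ Finset.Icc 1 m,
      ENNReal.ofReal ((i : ℝ) ^ 2) * physicalDependence P (fun s => f s ^ k) ε i < ∞)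
    -- the function of the moments
    (g : EuclideanSpace ℝ (Fin m) → ℝ) (hg_meas : Measurable g)
    (v₀ : EuclideanSpace ℝ (Fin m)) (hv₀ : v₀ = momentVector P X m) (hg_zero : g v₀ = 0)
    (a : ℝ) (ha : 0 < a)
    (hg_diff : ∀ x ∈ openCube v₀ (2 * a), DifferentiableAt ℝ g x)
    (hg_grad : ∃ C : ℝ, ∀ x ∈ openCube v₀ (2 * a), ‖gradient g x‖ ≤ C)
    -- number and length of the blocks
    (b ℓ : ℕ → ℕ) (hb : Tendsto b atTop atTop) (hℓ : Tendsto ℓ atTop atTop)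
    (hbℓ : Tendsto (fun n => (b n : ℝ) / (ℓ n : ℝ)) atTop (𝓝 0))
    -- the cut-off function
    (η : EuclideanSpace ℝ (Fin m) → ℝ) (hη_smooth : ContDiff ℝ (⊤ : ℕ∞) η)
    (hη_range : ∀ x, η x ∈ Set.Icc (0 : ℝ) 1)
    (hη_one : ∀ x, ‖x - v₀‖ ≤ a → η x = 1) (hη_zero : ∀ x, 2 * a < ‖x - v₀‖ → η x = 0)
    -- the original and the truncated triangular array, and the long-run variance
    (W Wη : ℕ → ℕ → Ω → ℝ)
    (hW : ∀ n j, W n j = blockStat g X (ℓ n) j)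
    (hWη : ∀ n j, Wη n j = blockStat (fun x => g x * η x) X (ℓ n) j)
    (σ : ℝ) (hσ : σ = Real.sqrt (longRunVariance P (linearised g v₀ X))) :
    -- the expectations in the centring term exist
    (∀ n, ∀ j ∈ Finset.Icc 1 (b n), ∀ k ∈ Finset.Icc 1 (b n), j ≠ k →
      Integrable (fun ω => h (Wη n j ω, Wη n k ω)) P) ∧
    -- the series that defines the long-run variance converges absolutely
    Summable (fun t : ℤ => cov[linearised g v₀ X 0, linearised g v₀ X t; P]) ∧
    -- the central limit theorem
    (0 < longRunVariance P (linearised g v₀ X) →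
      ∃ v : ℝ≥0, (v : ℝ) = 4 * gaussianKernelCov h σ ∧
        TendstoInDistribution
          (fun n ω => Real.sqrt (b n) * (uStat h (b n) (W n) ω - uStatMean P h (b n) (Wη n)))
          atTop (id : ℝ → ℝ) (fun _ => P) (gaussianReal 0 v)) := by
  obtain ⟨K, hK⟩ := h_lip
  have hh := LipKernel.of_lipschitzWith hK
  have hK0 : (0 : ℝ) ≤ K := K.2
  have hhm : Measurable h := hK.continuous.measurable
  subst hX
  set μ := P.map (ε 0) with hμ
  have : IsProbabilityMeasure μ := Measure.isProbabilityMeasure_map (hε_meas 0).aemeasurable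
  have hN : MeasurePreserving (fun ω u => ε u ω) P (noiseLaw μ) :=
    measurePreserving_noise hε_meas hε_indep hε_ident
  obtain ⟨hφ', h0⟩ :=
    exists_shortRange_centredPower hε_meas hε_indep hε_ident hf hX_moment hX_dep
  rw [← hv₀] at hφ' h0
  choose D hφ using hφ'
  obtain ⟨L, hL0, hL⟩ := exists_abs_mul_cutoff_sub_le ha hg_zero hg_diff hg_grad hη_smooth
    hη_range hη_zero
  set φ := centredPower f v₀ with hφ_def
  set G : EuclideanSpace ℝ (Fin m) → ℝ := fun y => g (v₀ + y) * η (v₀ + y) with hG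
  have hGL : ∀ y z, |G y - G z| ≤ L * ‖y - z‖ := fun y z => by
    simpa only [add_sub_add_left_eq_sub] using hL (v₀ + y) (v₀ + z)
  have hG0 : G 0 = 0 := by simp [hG, hg_zero]
  have hv₀_mem : v₀ ∈ openCube v₀ (2 * a) :=
    ball_subset_openCube _ _ (Metric.mem_ball_self (by positivity))
  have hG' : HasFDerivAt G (fderiv ℝ g v₀) 0 := hasFDerivAt_mul_cutoff ha (hg_diff _ hv₀_mem) hη_one
  have hGm : Measurable G := (continuous_of_abs_sub_le hL0 hGL).measurable
  have hbm : ∀ p j, Measurable (shiftedBlockValue G φ p j) := fun p j =>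
    (measurable_blockValue (fun k => (hφ k).measurable) hGm p).comp (measurable_shift _)
  have hWη_eq : ∀ n j ω, Wη n j ω = shiftedBlockValue G φ (ℓ n) j fun u => ε u ω :=
    fun n j ω => by rw [hWη, blockStat_eq _ v₀]
  obtain ⟨C, -, hBC⟩ := (sqUnifIntegrable_blockValue hφ h0 hL0 hGL hG0).exists_bound fun p =>
    (measurable_blockValue (fun k => (hφ k).measurable) hGm p).aestronglyMeasurable
  have hWη2 : ∀ n j, MemLp (Wη n j) 2 P := fun n j => by
    rw [funext (hWη_eq n j)]
    exact (memLp_of_eLpNorm_le_ofReal (measurable_blockValue (fun k => (hφ k).measurable) hGm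
      (ℓ n)).aestronglyMeasurable (hBC (ℓ n))).comp_measurePreserving
      ((measurePreserving_shift _).comp hN)
  have hcov := covariance_linearised hε_meas hε_indep hε_ident hφ h0 g
  have hlin := ShortRange.finset_sum Finset.univ fun k _ => (hφ k).const_mul (partialDeriv g v₀ k)
  have hlin0 : ∫ x, ∑ k, partialDeriv g v₀ k * φ k x ∂(noiseLaw μ) = 0 := by
    rw [integral_finsetSum _ fun k _ => ((hφ k).memLp.integrable (by norm_num)).const_mul _]
    simp [integral_const_mul, h0]
  refine ⟨fun n j _ k _ _ => (hh.memLp_comp hK0 (hWη2 n j) (hWη2 n k)).integrable (by norm_num),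
    ?_, fun hpos => ?_⟩
  · simp_rw [hcov]
    exact hlin.summable_autocov hlin0
  have hσ2 : ∑' d, autocov μ (fun x => ∑ k, fderiv ℝ g v₀ (EuclideanSpace.single k 1) * φ k x) d =
      σ ^ 2 := by
    rw [hσ, Real.sq_sqrt hpos.le, longRunVariance]
    exact tsum_congr fun t => (hcov t).symm
  have hv0 : 0 ≤ 4 * gaussianKernelCov h σ :=
    mul_nonneg (by norm_num) (hh.gaussianKernelCov_nonneg hK0 h_symm σ)
  obtain ⟨v, hv⟩ : ∃ v : ℝ≥0, (v : ℝ) = 4 * gaussianKernelCov h σ :=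
    ⟨_, Real.coe_toNNReal _ hv0⟩
  refine ⟨v, hv, ?_⟩
  have hclt := hh.tendstoInDistribution_uStat_blocks hK0 h_symm hφ h0 hL0 hGL hG0 hG' hσ2 hb hℓ hbℓ
    hv
  rw [← tendstoInDistribution_comp_iff hN fun n =>
    ((measurable_uStat hhm (hbm (ℓ n))).sub_const _).const_mul _] at hclt
  have hmean : ∀ n, uStatMean (noiseLaw μ) h (b n) (shiftedBlockValue G φ (ℓ n)) =
      uStatMean P h (b n) (Wη n) := fun n => by
    refine offDiagAverage_congr fun j _ k _ _ => ?_
    simp_rw [hWη_eq]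
    exact (integral_comp_of_measurePreserving
      (g := fun x => h (shiftedBlockValue G φ (ℓ n) j x, shiftedBlockValue G φ (ℓ n) k x)) hN
      (hhm.comp ((hbm _ j).prodMk (hbm _ k))).aestronglyMeasurable).symm
  have hWm : ∀ n j, Measurable (W n j) := fun n j => by
    rw [hW, funext (blockStat_eq g v₀ (ℓ n) j)]
    exact ((measurable_blockValue (fun k => (hφ k).measurable)
      (hg_meas.comp (measurable_const_add v₀)) (ℓ n)).comp (measurable_shift _)).comp hN.measurable
  refine tendstoInDistribution_of_tendstoInMeasure_sub _ _ hclt ?_ fun n =>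
    (((measurable_uStat hhm (hWm n)).sub_const _).const_mul _).aemeasurable
  obtain ⟨B, hB⟩ := exists_measureReal_norm_blockMean_le hφ h0
  -- Some block among the `b n` is bad with probability at most `b n * B / (ℓ n * a ^ 2)`, which
  -- tends to `0`. Otherwise the cut-off equals `1` at all block moments, and the two U-statistics
  -- coincide.
  set bad : ℕ → ℕ → Set Ω := fun n j =>
    {ω | a < ‖blockMean φ (ℓ n) (shift (blockStart (ℓ n) j) fun u => ε u ω)‖} with hbad
  have hu : Tendsto (fun n => B / a ^ 2 * ((b n : ℝ) / ℓ n)) atTop (𝓝 0) := by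
    simpa using hbℓ.const_mul (B / a ^ 2)
  refine tendstoInMeasure_zero_of_measureReal (S := fun n => ⋃ j ∈ Finset.Icc 1 (b n), bad n j) hu
    ?_ ?_
  · filter_upwards [hℓ.eventually_ge_atTop 1] with n hn
    have hbadm : ∀ j, P.real (bad n j) ≤ B / (ℓ n * a ^ 2) := fun j => by
      have hT : MeasurePreserving (fun ω => shift (blockStart (ℓ n) j) fun u => ε u ω) P
        (noiseLaw μ) := (measurePreserving_shift _).comp hN
      have hm := measurableSet_lt measurable_const
        (measurable_blockMean (fun k => (hφ k).measurable) (ℓ n)).norm (f := fun _ => a)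
      exact (hT.measureReal_preimage hm.nullMeasurableSet).trans_le (hB a ha (ℓ n) hn)
    calc P.real (⋃ j ∈ Finset.Icc 1 (b n), bad n j)
        ≤ ∑ j ∈ Finset.Icc 1 (b n), P.real (bad n j) := measureReal_biUnion_finset_le _ _
      _ ≤ ∑ j ∈ Finset.Icc 1 (b n), B / (ℓ n * a ^ 2) := Finset.sum_le_sum fun j _ => hbadm j
      _ = B / a ^ 2 * ((b n : ℝ) / ℓ n) := by
          rw [Finset.sum_const, Nat.card_Icc, Nat.add_sub_cancel, nsmul_eq_mul]
          field_simp
  · filter_upwards [hℓ.eventually_ge_atTop 1] with n hn ω hω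
    have hW_eq : ∀ j ∈ Finset.Icc 1 (b n),
        W n j ω = shiftedBlockValue G φ (ℓ n) j fun u => ε u ω := fun j hj => by
      rw [← hWη_eq, hW, hWη, blockStat, blockStat]
      have h1 : ‖blockMoments (bernoulliShift f ε) m (ℓ n) j ω - v₀‖ ≤ a := by
        rw [blockMoments_eq v₀ (by omega), add_sub_cancel_left]
        by_contra hcon
        exact hω (Set.mem_biUnion hj (not_le.1 hcon))
      rw [hη_one _ h1, mul_one]
    have h2 : uStat h (b n) (W n) ω =
        uStat h (b n) (shiftedBlockValue G φ (ℓ n)) fun u => ε u ω :=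
      offDiagAverage_congr fun j hj k hk _ => by rw [hW_eq j hj, hW_eq k hk]
    simp only [Pi.sub_apply, h2, ← hmean]
    exact sub_self _
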